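/- Let $\vartheta > 1/2$ be a real number and suppose that the primes have admissible level of distribution $\vartheta$, that is, for all $\varepsilon > 0$ and $A > 0$, $$\sum_{q \le x^{\vartheta-\varepsilon}} \max_{\substack{a \bmod q\\ (a,q)=1}} \Bigl| \sum_{\substack{p \le x,\ p \text{ prime}\\ p \equiv a\ (\mathrm{mod}\ q)}} \log p - \frac{x}{\varphi(q)} \Bigr| \ll_{\varepsilon, A} \frac{x}{(\log x)^A} \qquad (x \to \infty).$$ Then there are constants $C(\vartheta)$ and $C_0(\vartheta)$ such that for every real $x > C_0(\vartheta)$ the interval $[x, x + C(\vartheta)]$ contains an integer $d$ which can be written in infinitely many ways as the difference of two consecutive primes, i.e. $p_{n+1} - p_n = d$ for infinitely many $n$, where $p_n$ denotes the $n$-th prime. -/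

import Mathlib

open scoped Asymptotics

/-- `θ(x; q, a)`, the sum of `log p` over the primes `p ≤ x` with `p ≡ a (mod q)`. -/
noncomputable def primeTheta (x : ℝ) (q : ℕ) (a : ZMod q) : ℝ :=
  ∑ p ∈ (Finset.Icc 1 ⌊x⌋₊).filter (fun p : ℕ => p.Prime ∧ (p : ZMod q) = a), Real.log p

/-- The largest error `|θ(x; q, a) - x / φ(q)|` over the reduced residue classes `a` modulo `q`.
For `q ≥ 1` the index type is finite and nonempty, so the supremum is a maximum. -/
noncomputable def maxThetaError (x : ℝ) (q : ℕ) : ℝ :=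
  ⨆ a : (ZMod q)ˣ, |primeTheta x q (a : ZMod q) - x / (Nat.totient q : ℝ)|

/-- The primes have the admissible level of distribution `ϑ`: for all `ε > 0` and `A > 0`,
the sum of the maximal errors over the moduli `1 ≤ q ≤ x ^ (ϑ - ε)` is
`O_{ε, A} (x / (log x) ^ A)` as `x → ∞`. -/
def PrimesHaveLevel (ϑ : ℝ) : Prop :=
  ∀ ε : ℝ, 0 < ε → ∀ A : ℝ, 0 < A →
    (fun x : ℝ => ∑ q ∈ Finset.Icc 1 ⌊x ^ (ϑ - ε)⌋₊, maxThetaError x q)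
      =O[Filter.atTop] (fun x : ℝ => x / (Real.log x) ^ A)

/-- `d` is the difference of two consecutive primes in infinitely many ways. -/
def IsDePolignac (d : ℕ) : Prop :=
  {n : ℕ | Nat.nth Nat.Prime (n + 1) = Nat.nth Nat.Prime n + d}.Infinite

open Finset Real

/-!
Goldston–Pintz–Yıldırım sieve. For a set `H` of `k = (2 m + 1) ^ 2` shifts, give each
`n ∈ (N, 2 N]` the nonnegative weight `(∑ λ_d) ^ 2`, where `d` runs over the divisors of
`∏ h ∈ H, (n + h)` and the `λ_d` are Selberg's weights with diagonal variables `(L - log d)⁺ ^ m`,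
`L = η log N`. The sum of the weights has a moment of order `2 m` in dimension `k` as main term. The
sum of the weights against `log (n + h)` over the primes `n + h` is, by the level of distribution,
at least a moment of order `2 m + 2` in dimension `k - 1`, up to the factor `1 / (m + 1) ^ 2`.
Partial summation with Mertens' estimate relates the two moments. Summing over `h`, the primes win
against `log (3 N)` times the sum of the weights as soon as `η (2 m + 1) ^ 2 > (m + 1) ^ 2`. A level
`ϑ > 1/2` allows some `η > 1/4`, hence a suitable `m`, and then two of the `n + h` are prime for
arbitrarily large `n`.

The sieve leaves the residue classes of `n` modulo small primes free. Choosing them so that each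
`n + s` with `s ≤ max H`, `s ∉ H` has its own small prime divisor, two neighbouring primes among
the `n + h` are consecutive primes. So every admissible set of `k` shifts has a difference that is
a gap between consecutive primes infinitely often. If such gaps avoided arbitrarily long intervals,
one could choose multiples of `k!` one after the other, each far beyond the previous ones, with no
such difference; but multiples of `k!` form an admissible set.
-/

/-! ### Sums over subsets -/

section SubsetSums

variable {ι M : Type*} [DecidableEq ι] [AddCommMonoid M]

theorem sum_Icc_eq_sum_powerset_sdiff {U P : Finset ι} (hU : U ⊆ P) (f : Finset ι → M) :
    ∑ S ∈ Icc U P, f S = ∑ T ∈ (P \ U).powerset, f (U ∪ T) := by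
  rw [Icc_eq_image_powerset hU, sum_image]
  intro S hS T hT hST
  have hdisj : ∀ R ∈ ((P \ U).powerset : Set (Finset ι)), Disjoint R U := fun R hR =>
    disjoint_of_subset_left (mem_powerset.1 hR) sdiff_disjoint
  simpa only [union_sdiff_left, sdiff_eq_self_of_disjoint (hdisj S hS),
    sdiff_eq_self_of_disjoint (hdisj T hT)] using congrArg (· \ U) hST

theorem sum_powerset_sum_powerset_eq (P : Finset ι) (f : Finset ι → Finset ι → M) :
    ∑ S ∈ P.powerset, ∑ U ∈ S.powerset, f S U = ∑ U ∈ P.powerset, ∑ S ∈ Icc U P, f S U :=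
  sum_comm' fun S U => by
    simp only [mem_powerset, Finset.mem_Icc]
    exact ⟨fun h => ⟨⟨h.2, h.1⟩, h.2.trans h.1⟩, fun h => ⟨h.1.2, h.1.1⟩⟩

theorem sum_Icc_sum_Icc_comm (U P : Finset ι) (f : Finset ι → Finset ι → M) :
    ∑ S ∈ Icc U P, ∑ R ∈ Icc S P, f S R = ∑ R ∈ Icc U P, ∑ S ∈ Icc U R, f S R :=
  sum_comm' fun S R => by
    simp only [Finset.mem_Icc]
    exact ⟨fun h => ⟨⟨h.1.1, h.2.1⟩, h.1.1.trans h.2.1, h.2.2⟩,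
      fun h => ⟨⟨h.1.1, h.1.2.trans h.2.2⟩, h.1.2, h.2.2⟩⟩

theorem sum_sum_powerset_inter_eq (P : Finset ι) (f : Finset ι → Finset ι → Finset ι → M) :
    ∑ S ∈ P.powerset, ∑ T ∈ P.powerset, ∑ U ∈ (S ∩ T).powerset, f S T U =
      ∑ U ∈ P.powerset, ∑ S ∈ Icc U P, ∑ T ∈ Icc U P, f S T U := by
  rw [← sum_powerset_sum_powerset_eq]
  refine sum_congr rfl fun S _ => sum_comm' fun T U => ?_
  simp only [mem_powerset, Finset.mem_Icc, subset_inter_iff]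
  tauto

theorem sum_powerset_union {P Q : Finset ι} (hPQ : Disjoint P Q) (f : Finset ι → M) :
    ∑ U ∈ (P ∪ Q).powerset, f U = ∑ S ∈ P.powerset, ∑ T ∈ Q.powerset, f (S ∪ T) := by
  refine Eq.trans ?_ (sum_product P.powerset Q.powerset fun x => f (x.1 ∪ x.2))
  have hinter : ∀ U ⊆ P ∪ Q, U ∩ P ∪ U ∩ Q = U := fun U hU => by
    rw [← inter_union_distrib_left, inter_eq_left.2 hU]
  refine sum_nbij' (fun U => (U ∩ P, U ∩ Q)) (fun x => x.1 ∪ x.2) ?_ ?_ ?_ ?_ ?_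
  · intro U _
    simp only [mem_product, mem_powerset, inter_subset_right, and_self]
  · intro x hx
    simp only [mem_product, mem_powerset] at hx ⊢
    exact union_subset_union hx.1 hx.2
  · exact fun U hU => hinter U (mem_powerset.1 hU)
  · rintro ⟨S, T⟩ hx
    simp only [mem_product, mem_powerset] at hx
    have hTP : T ∩ P = ∅ :=
      disjoint_iff_inter_eq_empty.1 (disjoint_of_subset_left hx.2 hPQ.symm)
    have hSQ : S ∩ Q = ∅ := disjoint_iff_inter_eq_empty.1 (disjoint_of_subset_left hx.1 hPQ)
    simp only [union_inter_distrib_right, hTP, hSQ, inter_eq_left.2 hx.1, inter_eq_left.2 hx.2,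
      union_empty, empty_union]
  · exact fun U hU => congrArg f (hinter U (mem_powerset.1 hU)).symm

theorem sum_powerset_union_le_of_antitone {P Q : Finset ι} (hPQ : Disjoint P Q) {f u : ι → ℝ}
    (hf : ∀ p ∈ P ∪ Q, 0 ≤ f p) (hu : ∀ p ∈ P, 0 ≤ u p) {G : ℝ → ℝ} (hG : Antitone G) :
    ∑ U ∈ (P ∪ Q).powerset, (∏ p ∈ U, f p) * G (∑ p ∈ U, u p) ≤
      (∏ p ∈ P, (1 + f p)) * ∑ T ∈ Q.powerset, (∏ p ∈ T, f p) * G (∑ p ∈ T, u p) := by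
  rw [sum_powerset_union hPQ, prod_one_add, sum_mul]
  refine sum_le_sum fun S hS => ?_
  rw [mul_sum]
  refine sum_le_sum fun T hT => ?_
  rw [mem_powerset] at hS hT
  have hST : Disjoint S T := disjoint_of_subset_left hS (disjoint_of_subset_right hT hPQ)
  rw [prod_union hST, sum_union hST, mul_assoc]
  have hfS : 0 ≤ ∏ p ∈ S, f p := prod_nonneg fun p hp => hf p (mem_union_left _ (hS hp))
  have hfT : 0 ≤ ∏ p ∈ T, f p := prod_nonneg fun p hp => hf p (mem_union_right _ (hT hp))
  have huS : 0 ≤ ∑ p ∈ S, u p := sum_nonneg fun p hp => hu p (hS hp)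
  gcongr
  exact hG (le_add_of_nonneg_left huS)

end SubsetSums

/-! ### Selberg's quadratic form -/

section SelbergForm

variable {ι K : Type*} [DecidableEq ι] [Field K]

/-- Selberg's quadratic form of the density `w`: the main term of `∑ a n * (∑ S, l S) ^ 2`, where
`S` runs over the sets of primes of `P` that sieve out `n`. Squarefree numbers are encoded by their
sets of prime factors, so that `S ∪ T` is a least common multiple. -/
def selbergForm (P : Finset ι) (l : Finset ι → K) (w : ι → K) : K :=
  ∑ S ∈ P.powerset, ∑ T ∈ P.powerset, l S * l T * ∏ p ∈ S ∪ T, w p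

/-- Selberg's weights for the density `w` with the diagonal variables `y`, which turn `selbergForm`
into a sum of squares. -/
def selbergWeight (P : Finset ι) (w : ι → K) (y : Finset ι → K) (S : Finset ι) : K :=
  (-1) ^ #S * (∏ p ∈ S, (w p)⁻¹) * ∑ R ∈ Icc S P, y R * ∏ p ∈ R, w p / (1 - w p)

theorem prod_union_eq_sum_powerset_inter {S T : Finset ι} {w : ι → K} (hw : ∀ p ∈ S, w p ≠ 0) :
    ∏ p ∈ S ∪ T, w p =
      ∑ U ∈ (S ∩ T).powerset, (∏ p ∈ U, ((w p)⁻¹ - 1)) * ((∏ p ∈ S, w p) * ∏ p ∈ T, w p) := by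
  have hinv : (∏ p ∈ S ∩ T, (w p)⁻¹) * ∏ p ∈ S ∩ T, w p = 1 := by
    rw [← prod_mul_distrib]
    exact prod_eq_one fun p hp => inv_mul_cancel₀ (hw p (mem_inter.1 hp).1)
  rw [← sum_mul, ← prod_one_add, ← prod_union_inter]
  simp only [add_sub_cancel]
  linear_combination -(∏ p ∈ S ∪ T, w p) * hinv

theorem selbergForm_eq_sum_sq {P : Finset ι} {w : ι → K} (hw : ∀ p ∈ P, w p ≠ 0)
    (l : Finset ι → K) :
    selbergForm P l w =
      ∑ U ∈ P.powerset, (∏ p ∈ U, ((w p)⁻¹ - 1)) * (∑ S ∈ Icc U P, l S * ∏ p ∈ S, w p) ^ 2 := by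
  calc selbergForm P l w
      = ∑ S ∈ P.powerset, ∑ T ∈ P.powerset, ∑ U ∈ (S ∩ T).powerset,
          (∏ p ∈ U, ((w p)⁻¹ - 1)) * ((l S * ∏ p ∈ S, w p) * (l T * ∏ p ∈ T, w p)) := by
        refine sum_congr rfl fun S hS => sum_congr rfl fun T _ => ?_
        rw [prod_union_eq_sum_powerset_inter fun p hp => hw p (mem_powerset.1 hS hp), mul_sum]
        exact sum_congr rfl fun U _ => by ring
    _ = _ := by
        rw [sum_sum_powerset_inter_eq]
        exact sum_congr rfl fun U _ => by rw [sq, sum_mul_sum]; simp only [mul_sum]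

theorem sum_Icc_neg_one_pow_mul_prod {U R : Finset ι} (hU : U ⊆ R) (g : ι → K) :
    ∑ S ∈ Icc U R, (-1) ^ #S * ∏ p ∈ S, g p =
      (-1) ^ #U * (∏ p ∈ U, g p) * ∏ p ∈ R \ U, (1 - g p) := by
  simp only [← prod_neg, sub_eq_add_neg, prod_one_add, mul_sum]
  rw [sum_Icc_eq_sum_powerset_sdiff hU]
  exact sum_congr rfl fun T hT => prod_union <|
    disjoint_of_subset_right (mem_powerset.1 hT) disjoint_sdiff

theorem sum_selbergWeight_mul_prod {P : Finset ι} {w : ι → K} (hw : ∀ p ∈ P, w p ≠ 0)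
    (v : ι → K) (y : Finset ι → K) (U : Finset ι) :
    ∑ S ∈ Icc U P, selbergWeight P w y S * ∏ p ∈ S, v p =
      (-1) ^ #U * (∏ p ∈ U, v p / (1 - w p)) *
        ∑ R ∈ Icc U P, y R * ∏ p ∈ R \ U, (w p - v p) / (1 - w p) := by
  have hswap : ∑ S ∈ Icc U P, selbergWeight P w y S * ∏ p ∈ S, v p =
      ∑ R ∈ Icc U P, y R * (∏ p ∈ R, w p / (1 - w p)) *
        ∑ S ∈ Icc U R, (-1) ^ #S * ∏ p ∈ S, v p / w p := by
    simp only [mul_sum, ← sum_Icc_sum_Icc_comm U P, selbergWeight, sum_mul, div_eq_mul_inv,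
      prod_mul_distrib]
    exact sum_congr rfl fun S _ => sum_congr rfl fun R _ => by ring
  rw [hswap, mul_sum]
  refine sum_congr rfl fun R hR => ?_
  obtain ⟨hUR, hRP⟩ := Finset.mem_Icc.1 hR
  have hU : ∏ p ∈ U, v p / (1 - w p) =
      (∏ p ∈ U, w p / (1 - w p)) * ∏ p ∈ U, v p / w p := by
    rw [← prod_mul_distrib]
    exact prod_congr rfl fun p hp => by have := hw p (hRP (hUR hp)); field_simp
  have hRU : ∏ p ∈ R \ U, (w p - v p) / (1 - w p) =
      (∏ p ∈ R \ U, w p / (1 - w p)) * ∏ p ∈ R \ U, (1 - v p / w p) := by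
    rw [← prod_mul_distrib]
    exact prod_congr rfl fun p hp => by have := hw p (hRP (sdiff_subset hp)); field_simp
  rw [sum_Icc_neg_one_pow_mul_prod hUR, hU, hRU, ← prod_sdiff hUR]
  ring

theorem selbergForm_selbergWeight {P : Finset ι} {w v : ι → K} (hw : ∀ p ∈ P, w p ≠ 0)
    (hv : ∀ p ∈ P, v p ≠ 0) (y : Finset ι → K) :
    selbergForm P (selbergWeight P w y) v =
      ∑ U ∈ P.powerset, (∏ p ∈ U, ((v p)⁻¹ - 1)) * ((∏ p ∈ U, v p / (1 - w p)) *
        ∑ R ∈ Icc U P, y R * ∏ p ∈ R \ U, (w p - v p) / (1 - w p)) ^ 2 := by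
  rw [selbergForm_eq_sum_sq hv]
  refine sum_congr rfl fun U _ => ?_
  rw [sum_selbergWeight_mul_prod hw, mul_assoc, mul_pow ((-1) ^ #U), ← pow_mul, mul_comm #U,
    pow_mul, neg_one_sq, one_pow, one_mul]

theorem selbergForm_selbergWeight_self {P : Finset ι} {w : ι → K} (hw : ∀ p ∈ P, w p ≠ 0)
    (hw₁ : ∀ p ∈ P, w p ≠ 1) (y : Finset ι → K) :
    selbergForm P (selbergWeight P w y) w =
      ∑ U ∈ P.powerset, (∏ p ∈ U, w p / (1 - w p)) * y U ^ 2 := by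
  rw [selbergForm_selbergWeight hw hw]
  refine sum_congr rfl fun U hU => ?_
  rw [mem_powerset] at hU
  have hdiag : ∑ R ∈ Icc U P, y R * ∏ p ∈ R \ U, (w p - w p) / (1 - w p) = y U := by
    rw [sum_eq_single U _ fun h => (h (left_mem_Icc.2 hU)).elim]
    · rw [sdiff_self, bot_eq_empty, prod_empty, mul_one]
    · intro R hR hne
      have hRU : (R \ U).Nonempty :=
        sdiff_nonempty.2 fun h => hne (subset_antisymm h (Finset.mem_Icc.1 hR).1)
      obtain ⟨p, hp⟩ := hRU
      rw [prod_eq_zero hp (by rw [sub_self, zero_div]), mul_zero]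
  rw [hdiag, mul_pow, ← mul_assoc, ← prod_pow, ← prod_mul_distrib]
  congr 1
  refine prod_congr rfl fun p hp => ?_
  have := hw p (hU hp)
  have : 1 - w p ≠ 0 := sub_ne_zero.2 (hw₁ p (hU hp)).symm
  field_simp

end SelbergForm

/-! ### Sums over integers and sums over sets of primes -/

theorem sum_one_div_le_of_forall_mem_factoredNumbers {s T : Finset ℕ} (hT : ∀ p ∈ T, p.Prime)
    (hs : ∀ n ∈ s, n ∈ Nat.factoredNumbers T) :
    ∑ n ∈ s, (1 : ℝ) / n ≤ ∏ p ∈ T, (1 - 1 / (p : ℝ))⁻¹ := by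
  let f : ℕ →* ℝ :=
    ((invMonoidWithZeroHom (G₀ := ℝ)).toMonoidHom).comp (Nat.castRingHom ℝ : ℕ →* ℝ)
  have hf : ∀ n, f n = 1 / (n : ℝ) := fun n => (one_div _).symm
  have hf₁ : ∀ {p : ℕ}, p.Prime → ‖f p‖ < 1 := fun {p} hp => by
    rw [hf, norm_div, norm_one, Real.norm_natCast, div_lt_one (by exact_mod_cast hp.pos)]
    exact_mod_cast hp.one_lt
  have hsum :=
    (EulerProduct.summable_and_hasSum_factoredNumbers_prod_filter_prime_geometric hf₁ T).2
  rw [filter_true_of_mem hT] at hsum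
  simp only [hf] at hsum
  rw [← sum_subtype_of_mem (fun n : ℕ => (1 : ℝ) / n) hs]
  exact sum_le_hasSum _ (fun n _ => by positivity) hsum

theorem sum_one_div_of_primeFactors_eq_le (X : ℕ) {T : Finset ℕ} (hT : ∀ p ∈ T, p.Prime) :
    ∑ n ∈ Icc 1 X with n.primeFactors = T, (1 : ℝ) / n ≤ ∏ p ∈ T, 1 / ((p : ℝ) - 1) := by
  set d := ∏ p ∈ T, p with hd
  set s := (Icc 1 X).filter (·.primeFactors = T)
  have hmul : ∀ n ∈ s, d * (n / d) = n := fun n hn => Nat.mul_div_cancel' <| by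
    rw [hd, ← (mem_filter.1 hn).2]
    exact Nat.prod_primeFactors_dvd n
  have hmem : ∀ m ∈ s.image (· / d), m ∈ Nat.factoredNumbers T := by
    rintro _ hm
    obtain ⟨n, hn, rfl⟩ := mem_image.1 hm
    have hn₀ : n ≠ 0 := Nat.one_le_iff_ne_zero.1 (Finset.mem_Icc.1 (mem_filter.1 hn).1).1
    have hdvd : n / d ∣ n := Dvd.intro_left d (hmul n hn)
    refine ⟨ne_zero_of_dvd_ne_zero hn₀ hdvd, fun p hp => ?_⟩
    rw [← (mem_filter.1 hn).2]
    exact Nat.primeFactors_mono hdvd hn₀ (List.mem_toFinset.2 hp)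
  have hinj : Set.InjOn (· / d) (s : Set ℕ) := fun a ha b hb hab => by
    rw [← hmul a ha, ← hmul b hb, show a / d = b / d from hab]
  calc ∑ n ∈ s, (1 : ℝ) / n
      = (∏ p ∈ T, 1 / (p : ℝ)) * ∑ m ∈ s.image (· / d), (1 : ℝ) / m := by
        rw [sum_image hinj, mul_sum]
        refine sum_congr rfl fun n hn => ?_
        conv_lhs => rw [← hmul n hn, hd]
        push_cast
        rw [prod_div_distrib, prod_const_one, one_div_mul_one_div]
    _ ≤ (∏ p ∈ T, 1 / (p : ℝ)) * ∏ p ∈ T, (1 - 1 / (p : ℝ))⁻¹ :=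
        mul_le_mul_of_nonneg_left (sum_one_div_le_of_forall_mem_factoredNumbers hT hmem)
          (prod_nonneg fun p _ => by positivity)
    _ = _ := by
        rw [← prod_mul_distrib]
        refine prod_congr rfl fun p hp => ?_
        have hp₀ : (p : ℝ) ≠ 0 := by exact_mod_cast (hT p hp).ne_zero
        rw [one_sub_div hp₀, inv_div, one_div_mul_eq_div, div_div_cancel_left' hp₀, one_div]

theorem sum_primeFactors_log_le_log (n : ℕ) : ∑ p ∈ n.primeFactors, log p ≤ log n := by
  rcases n.eq_zero_or_pos with rfl | hn
  · simp only [Nat.primeFactors_zero, sum_empty, Nat.cast_zero, log_zero, le_refl]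
  have hprime : ∀ p ∈ n.primeFactors, 0 < p := fun p hp => (Nat.prime_of_mem_primeFactors hp).pos
  rw [← log_prod fun p hp => Nat.cast_ne_zero.2 (hprime p hp).ne', ← Nat.cast_prod]
  exact log_le_log (Nat.cast_pos.2 (prod_pos hprime))
    (Nat.cast_le.2 (Nat.le_of_dvd hn (Nat.prod_primeFactors_dvd n)))

theorem sum_antitone_log_div_le {X : ℕ} {G : ℝ → ℝ} (hG : Antitone G) (hG₀ : ∀ x, 0 ≤ G x) :
    ∑ n ∈ Icc 1 X, G (log n) / n ≤
      ∑ T ∈ (Nat.primesLE X).powerset, (∏ p ∈ T, 1 / ((p : ℝ) - 1)) * G (∑ p ∈ T, log p) := by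
  have hmaps : ∀ n ∈ Icc 1 X, n.primeFactors ∈ (Nat.primesLE X).powerset := fun n hn =>
    mem_powerset.2 fun p hp => Nat.mem_primesLE.2
      ⟨(Nat.le_of_mem_primeFactors hp).trans (Finset.mem_Icc.1 hn).2,
        Nat.prime_of_mem_primeFactors hp⟩
  rw [← sum_fiberwise_of_maps_to hmaps]
  refine sum_le_sum fun T hT => ?_
  have hTp : ∀ p ∈ T, p.Prime := fun p hp => Nat.prime_of_mem_primesLE (mem_powerset.1 hT hp)
  refine le_trans ?_ (mul_le_mul_of_nonneg_right (sum_one_div_of_primeFactors_eq_le X hTp) (hG₀ _))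
  rw [sum_mul]
  refine sum_le_sum fun n hn => ?_
  rw [← (mem_filter.1 hn).2, div_eq_mul_one_div, mul_comm]
  exact mul_le_mul_of_nonneg_left (hG (sum_primeFactors_log_le_log n)) (by positivity)

theorem prod_one_sub_one_div_mul_prod_div_sub_one {Q : Finset ℕ} (hQ : ∀ p ∈ Q, 1 < p) :
    (∏ p ∈ Q, (1 - 1 / (p : ℝ))) * ∏ p ∈ Q, (p : ℝ) / (p - 1) = 1 := by
  rw [← prod_mul_distrib]
  refine prod_eq_one fun p hp => ?_
  have hp₁ : (p : ℝ) - 1 ≠ 0 := sub_ne_zero.2 (by exact_mod_cast (hQ p hp).ne')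
  have hp₀ : (p : ℝ) ≠ 0 := by exact_mod_cast (zero_lt_one.trans (hQ p hp)).ne'
  rw [one_sub_div hp₀, div_mul_div_cancel₀ hp₀, div_self hp₁]

theorem prod_one_sub_one_div_nonneg (Q : Finset ℕ) : 0 ≤ ∏ p ∈ Q, (1 - 1 / (p : ℝ)) :=
  prod_nonneg fun p _ => by
    rcases p.eq_zero_or_pos with rfl | hp
    · norm_num
    · exact sub_nonneg.2 (div_le_one_of_le₀ (by exact_mod_cast hp) p.cast_nonneg)

theorem prod_mul_sum_antitone_log_div_le {X : ℕ} {Q : Finset ℕ} (hQ : Q ⊆ Nat.primesLE X)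
    {G : ℝ → ℝ} (hG : Antitone G) (hG₀ : ∀ x, 0 ≤ G x) :
    (∏ p ∈ Q, (1 - 1 / (p : ℝ))) * ∑ n ∈ Icc 1 X, G (log n) / n ≤
      ∑ T ∈ (Nat.primesLE X \ Q).powerset,
        (∏ p ∈ T, 1 / ((p : ℝ) - 1)) * G (∑ p ∈ T, log p) := by
  have hone : ∀ p ∈ Nat.primesLE X, (1 : ℝ) < p := fun p hp => by
    exact_mod_cast Nat.one_lt_of_mem_primesLE hp
  have hle := sum_powerset_union_le_of_antitone (P := Q) (Q := Nat.primesLE X \ Q) disjoint_sdiff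
    (f := fun p : ℕ => 1 / ((p : ℝ) - 1)) (u := fun p : ℕ => log p)
    (fun p hp => one_div_nonneg.2 <| sub_nonneg.2
      (hone p (by rwa [union_sdiff_of_subset hQ] at hp)).le)
    (fun p hp => log_nonneg (hone p (hQ hp)).le) hG
  rw [union_sdiff_of_subset hQ] at hle
  have hprod : ∏ p ∈ Q, (1 + 1 / ((p : ℝ) - 1)) = ∏ p ∈ Q, (p : ℝ) / (p - 1) :=
    prod_congr rfl fun p hp => by
      rw [one_add_div (sub_pos.2 (hone p (hQ hp))).ne', sub_add_cancel]
  calc _ ≤ _ := mul_le_mul_of_nonneg_left ((sum_antitone_log_div_le hG hG₀).trans hle)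
        (prod_one_sub_one_div_nonneg Q)
    _ = _ := by
        rw [hprod, ← mul_assoc, prod_one_sub_one_div_mul_prod_div_sub_one fun p hp =>
          Nat.one_lt_of_mem_primesLE (hQ hp), one_mul]

theorem posPart_sub_log_pow_succ_sub_le (A : ℝ) (m n : ℕ) :
    (A - log (n + 1 : ℕ))⁺ ^ (m + 1) - (A - log (n + 2 : ℕ))⁺ ^ (m + 1) ≤
      (m + 1) * ((A - log (n + 1 : ℕ))⁺ ^ m / (n + 1 : ℕ)) := by
  set a := (A - log (n + 1 : ℕ))⁺ with ha
  set b := (A - log (n + 2 : ℕ))⁺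
  have hlog : log (n + 2 : ℕ) ≤ log (n + 1 : ℕ) + 1 / (n + 1 : ℕ) := by
    have h := log_le_sub_one_of_pos (x := (n + 2 : ℕ) / (n + 1 : ℕ)) (by positivity)
    rw [log_div (by positivity) (by positivity)] at h
    have hfrac : ((n + 2 : ℕ) : ℝ) / (n + 1 : ℕ) - 1 = 1 / (n + 1 : ℕ) := by
      push_cast
      field_simp
      ring
    linarith
  have hba : b ≤ a := posPart_mono <| sub_le_sub_left
    (log_le_log (by positivity) (by push_cast; linarith)) A
  have hab : a - b ≤ 1 / (n + 1 : ℕ) := by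
    have hle : A - log (n + 2 : ℕ) ≤ b := le_posPart _
    rw [sub_le_iff_le_add, ha, posPart_def]
    exact sup_le (by linarith) (by positivity)
  have hb₀ : 0 ≤ b := posPart_nonneg _
  have ha₀ : 0 ≤ a := posPart_nonneg _
  calc a ^ (m + 1) - b ^ (m + 1)
      ≤ (a - b) * (m + 1) * a ^ m := by
        have h := (le_abs_self _).trans (abs_pow_sub_pow_le a b (m + 1))
        rwa [abs_of_nonneg (sub_nonneg.2 hba), abs_of_nonneg ha₀, abs_of_nonneg hb₀,
          max_eq_left hba, Nat.add_sub_cancel, Nat.cast_succ] at h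
    _ ≤ 1 / (n + 1 : ℕ) * (m + 1) * a ^ m := by gcongr
    _ = _ := by ring

theorem posPart_pow_succ_div_le_sum_Icc {X : ℕ} {A : ℝ} (hA : A ≤ log (X + 1 : ℕ)) (m : ℕ) :
    A⁺ ^ (m + 1) / (m + 1) ≤ ∑ n ∈ Icc 1 X, (A - log n)⁺ ^ m / n := by
  have htelescope : A⁺ ^ (m + 1) = ∑ n ∈ range X,
      ((A - log (n + 1 : ℕ))⁺ ^ (m + 1) - (A - log (n + 2 : ℕ))⁺ ^ (m + 1)) := by
    rw [sum_range_sub' fun n : ℕ => (A - log (n + 1 : ℕ))⁺ ^ (m + 1),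
      posPart_eq_zero.2 (sub_nonpos.2 hA), zero_add, Nat.cast_one, log_one, sub_zero,
      zero_pow m.succ_ne_zero, sub_zero]
  rw [div_le_iff₀ (by positivity), htelescope, mul_comm, mul_sum, range_eq_Ico,
    ← Ico_add_one_right_eq_Icc, ← sum_Ico_add' _ 0 X 1]
  exact sum_le_sum fun n _ => posPart_sub_log_pow_succ_sub_le A m n

theorem prod_mul_posPart_pow_succ_le_sum_Icc {X : ℕ} {P₀ P U : Finset ℕ} (hdisj : Disjoint P₀ P)
    (hP : P₀ ∪ P = Nat.primesLE X) (hU : U ⊆ P) {A : ℝ} (hA : A ≤ log (X + 1 : ℕ)) (m : ℕ) :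
    (∏ p ∈ P₀, (1 - 1 / (p : ℝ))) * ((A - ∑ p ∈ U, log p)⁺ ^ (m + 1) / (m + 1)) ≤
      (∏ p ∈ U, (p : ℝ) / (p - 1)) * ∑ R ∈ Icc U P,
        (A - ∑ p ∈ R, log p)⁺ ^ m * ∏ p ∈ R \ U, 1 / ((p : ℝ) - 1) := by
  have hUX : U ⊆ Nat.primesLE X := hP ▸ hU.trans subset_union_right
  have hQX : P₀ ∪ U ⊆ Nat.primesLE X := union_subset (hP ▸ subset_union_left) hUX
  have hQ : Nat.primesLE X \ (P₀ ∪ U) = P \ U := by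
    ext p
    have := disjoint_left.1 hdisj
    grind
  have hone : ∀ p ∈ U, (1 : ℝ) < p := fun p hp => by
    exact_mod_cast Nat.one_lt_of_mem_primesLE (hUX hp)
  have hpos : 0 ≤ ∏ p ∈ U, (p : ℝ) / (p - 1) := prod_nonneg fun p hp =>
    div_nonneg p.cast_nonneg (sub_pos.2 (hone p hp)).le
  have hprod := prod_one_sub_one_div_mul_prod_div_sub_one fun p hp =>
    Nat.one_lt_of_mem_primesLE (hUX hp)
  set A' := A - ∑ p ∈ U, log p
  have hA'X : A' ≤ log (X + 1 : ℕ) :=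
    (sub_le_self A (sum_nonneg fun p hp => log_nonneg (hone p hp).le)).trans hA
  have hG : Antitone fun x : ℝ => (A' - x)⁺ ^ m := fun x y hxy =>
    pow_le_pow_left₀ (posPart_nonneg _) (posPart_mono (sub_le_sub_left hxy A')) m
  have hle := prod_mul_sum_antitone_log_div_le hQX hG fun x => pow_nonneg (posPart_nonneg _) m
  rw [hQ, prod_union (disjoint_of_subset_right hU hdisj)] at hle
  calc (∏ p ∈ P₀, (1 - 1 / (p : ℝ))) * (A'⁺ ^ (m + 1) / (m + 1))
      ≤ (∏ p ∈ P₀, (1 - 1 / (p : ℝ))) * ∑ n ∈ Icc 1 X, (A' - log n)⁺ ^ m / n :=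
        mul_le_mul_of_nonneg_left (posPart_pow_succ_div_le_sum_Icc hA'X m)
          (prod_one_sub_one_div_nonneg P₀)
    _ = (∏ p ∈ U, (p : ℝ) / (p - 1)) * (((∏ p ∈ P₀, (1 - 1 / (p : ℝ))) *
          ∏ p ∈ U, (1 - 1 / (p : ℝ))) * ∑ n ∈ Icc 1 X, (A' - log n)⁺ ^ m / n) := by
        linear_combination (-(∏ p ∈ P₀, (1 - 1 / (p : ℝ))) *
          ∑ n ∈ Icc 1 X, (A' - log n)⁺ ^ m / n) * hprod
    _ ≤ _ := mul_le_mul_of_nonneg_left hle hpos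
    _ = _ := by
        rw [sum_Icc_eq_sum_powerset_sdiff hU]
        congr 1
        refine sum_congr rfl fun T hT => ?_
        have hUT : Disjoint U T :=
          disjoint_of_subset_right (mem_powerset.1 hT) disjoint_sdiff
        rw [sum_union hUT, union_sdiff_cancel_left hUT, sub_sub, mul_comm]

/-! ### Partial summation and moments -/

section PartialSummation

open MeasureTheory

theorem integral_succ_mul_sub_pow (L u : ℝ) (m : ℕ) :
    ∫ v in u..L, ((m : ℝ) + 1) * (L - v) ^ m = (L - u) ^ (m + 1) := by
  rw [intervalIntegral.integral_const_mul,
    intervalIntegral.integral_comp_sub_left (fun x => x ^ m) L, integral_pow, sub_self,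
    zero_pow m.succ_ne_zero, sub_zero, mul_div_cancel₀ _ m.cast_add_one_ne_zero]

theorem integral_succ_mul_sub_pow_mul_linear (c C L : ℝ) (m : ℕ) :
    ∫ v in 0..L, ((m : ℝ) + 1) * (L - v) ^ m * (c * v + C) =
      c * (L ^ (m + 2) / (m + 2)) + C * L ^ (m + 1) := by
  have hsplit : ∀ v, ((m : ℝ) + 1) * (L - v) ^ m * (c * v + C) =
      (c * L + C) * (((m : ℝ) + 1) * (L - v) ^ m) -
        c * (m + 1) / (m + 2) * ((((m + 1 : ℕ) : ℝ) + 1) * (L - v) ^ (m + 1)) := fun v => by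
    push_cast
    field_simp
    ring
  simp only [hsplit]
  rw [intervalIntegral.integral_sub (Continuous.intervalIntegrable (by fun_prop) _ _)
      (Continuous.intervalIntegrable (by fun_prop) _ _),
    intervalIntegral.integral_const_mul (c * L + C),
    intervalIntegral.integral_const_mul (c * (m + 1) / (m + 2)),
    integral_succ_mul_sub_pow, integral_succ_mul_sub_pow]
  field_simp
  ring

theorem posPart_sub_pow_succ_eq_setIntegral {u : ℝ} (hu : 0 ≤ u) (L : ℝ) (m : ℕ) :
    (L - u)⁺ ^ (m + 1) =
      ∫ v in Set.Ioc 0 L, (Set.Ioi u).indicator (fun v => ((m : ℝ) + 1) * (L - v) ^ m) v := by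
  rw [setIntegral_indicator measurableSet_Ioi, Set.Ioc_inter_Ioi, max_eq_right hu]
  rcases le_total u L with huL | hLu
  · rw [← intervalIntegral.integral_of_le huL, integral_succ_mul_sub_pow,
      posPart_eq_self.2 (sub_nonneg.2 huL)]
  · rw [Set.Ioc_eq_empty hLu.not_gt, setIntegral_empty, posPart_eq_zero.2 (sub_nonpos.2 hLu),
      zero_pow m.succ_ne_zero]

theorem sum_mul_posPart_pow_succ_le {α : Type*} {s : Finset α} {a u : α → ℝ}
    (ha : ∀ i ∈ s, 0 ≤ a i) (hu : ∀ i ∈ s, 0 ≤ u i) {c C L : ℝ} (hL : 0 ≤ L)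
    (h : ∀ v, 0 ≤ v → ∑ i ∈ s with u i ≤ v, a i ≤ c * v + C) (m : ℕ) :
    ∑ i ∈ s, a i * (L - u i)⁺ ^ (m + 1) ≤ c * (L ^ (m + 2) / (m + 2)) + C * L ^ (m + 1) := by
  set f : ℝ → ℝ := fun v => ((m : ℝ) + 1) * (L - v) ^ m
  have hintegrable : ∀ i ∈ s, IntegrableOn (fun v => a i * (Set.Ioi (u i)).indicator f v)
      (Set.Ioc 0 L) := fun i _ => (((by fun_prop : Continuous f).intervalIntegrable 0 L).1.indicator
    measurableSet_Ioi).const_mul _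
  have hpointwise : ∀ v ∈ Set.Ioc 0 L,
      ∑ i ∈ s, a i * (Set.Ioi (u i)).indicator f v ≤ f v * (c * v + C) := by
    intro v hv
    have hfv : 0 ≤ f v := mul_nonneg (by positivity) (pow_nonneg (sub_nonneg.2 hv.2) m)
    refine le_trans ?_ (mul_le_mul_of_nonneg_left (h v hv.1.le) hfv)
    rw [mul_sum, sum_filter]
    refine sum_le_sum fun i hi => ?_
    by_cases hlt : u i < v
    · rw [Set.indicator_of_mem (Set.mem_Ioi.2 hlt), if_pos hlt.le, mul_comm]
    · rw [Set.indicator_of_notMem (mt Set.mem_Ioi.1 hlt), mul_zero]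
      split_ifs
      exacts [mul_nonneg hfv (ha i hi), le_rfl]
  calc ∑ i ∈ s, a i * (L - u i)⁺ ^ (m + 1)
      = ∫ v in Set.Ioc 0 L, ∑ i ∈ s, a i * (Set.Ioi (u i)).indicator f v := by
        rw [integral_finsetSum _ hintegrable]
        exact sum_congr rfl fun i hi => by
          rw [integral_const_mul, posPart_sub_pow_succ_eq_setIntegral (hu i hi)]
    _ ≤ ∫ v in Set.Ioc 0 L, f v * (c * v + C) :=
        setIntegral_mono_on (integrable_finsetSum _ hintegrable)
          ((by fun_prop : Continuous fun v => f v * (c * v + C)).intervalIntegrable 0 L).1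
          measurableSet_Ioc hpointwise
    _ = _ := by
        rw [← intervalIntegral.integral_of_le hL, integral_succ_mul_sub_pow_mul_linear]

end PartialSummation

section Moments

variable {ι : Type*}

/-- The moment `∑ g(U) (L - u(U))⁺ ^ j` over the subsets `U` of `P`, where `g` is extended
multiplicatively and `u` additively; the main terms of the sieve sums have this shape. -/
noncomputable def subsetMoment (P : Finset ι) (g u : ι → ℝ) (L : ℝ) (j : ℕ) : ℝ :=
  ∑ U ∈ P.powerset, (∏ p ∈ U, g p) * (L - ∑ p ∈ U, u p)⁺ ^ j

theorem posPart_sub_add {L x y : ℝ} (hy : 0 ≤ y) : (L - (x + y))⁺ = ((L - x)⁺ - y)⁺ := by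
  simp only [posPart_def]
  grind

theorem posPart_pow_add_two (x : ℝ) (j : ℕ) : x⁺ ^ (j + 2) = x * x⁺ ^ (j + 1) := by
  rcases le_total x 0 with h | h
  · simp only [posPart_eq_zero.2 h, zero_pow (Nat.succ_ne_zero _), mul_zero]
  · rw [posPart_eq_self.2 h, pow_succ']

theorem pow_le_subsetMoment {P : Finset ι} {g u : ι → ℝ} (hg : ∀ p ∈ P, 0 ≤ g p) {L : ℝ}
    (hL : 0 ≤ L) (j : ℕ) : L ^ j ≤ subsetMoment P g u L j := by
  have h := single_le_sum (f := fun U => (∏ p ∈ U, g p) * (L - ∑ p ∈ U, u p)⁺ ^ j)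
    (fun U hU => mul_nonneg (prod_nonneg fun p hp => hg p (mem_powerset.1 hU hp))
      (pow_nonneg (posPart_nonneg _) _)) (empty_mem_powerset P)
  simpa only [subsetMoment, prod_empty, sum_empty, one_mul, sub_zero, posPart_eq_self.2 hL] using h

theorem sum_powerset_sum_mem_eq {M : Type*} [DecidableEq ι] [AddCommMonoid M] (P : Finset ι)
    (f : Finset ι → ι → M) :
    ∑ U ∈ P.powerset, ∑ p ∈ U, f U p = ∑ V ∈ P.powerset, ∑ p ∈ P \ V, f (insert p V) p := by
  rw [sum_sigma', sum_sigma']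
  refine sum_nbij' (fun x => ⟨x.1.erase x.2, x.2⟩) (fun x => ⟨insert x.2 x.1, x.2⟩)
    ?_ ?_ ?_ ?_ ?_
  · rintro ⟨U, p⟩ h
    simp only [mem_sigma, mem_powerset, mem_sdiff, notMem_erase, not_false_eq_true,
      and_true] at h ⊢
    exact ⟨(erase_subset _ _).trans h.1, h.1 h.2⟩
  · rintro ⟨V, p⟩ h
    simp only [mem_sigma, mem_powerset, mem_sdiff, mem_insert_self, and_true] at h ⊢
    exact insert_subset h.2.1 h.1
  · rintro ⟨U, p⟩ h
    simp only [insert_erase (mem_sigma.1 h).2]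
  · rintro ⟨V, p⟩ h
    simp only [erase_insert (mem_sdiff.1 (mem_sigma.1 h).2).2]
  · rintro ⟨U, p⟩ h
    simp only [insert_erase (mem_sigma.1 h).2]

theorem sub_mul_subsetMoment_le {P : Finset ι} {g u : ι → ℝ} (hg : ∀ p ∈ P, 0 ≤ g p)
    (hu : ∀ p ∈ P, 0 ≤ u p) {κ C : ℝ}
    (h : ∀ v, 0 ≤ v → ∑ p ∈ P with u p ≤ v, g p * u p ≤ κ * v + C) (L : ℝ) (j : ℕ) :
    (L - C) * subsetMoment P g u L (j + 1) ≤
      (1 + κ / (j + 2)) * subsetMoment P g u L (j + 2) := by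
  classical
  have hgu : ∀ p ∈ P, 0 ≤ g p * u p := fun p hp => mul_nonneg (hg p hp) (hu p hp)
  have hexpand : L * subsetMoment P g u L (j + 1) - subsetMoment P g u L (j + 2) =
      ∑ V ∈ P.powerset, (∏ p ∈ V, g p) *
        ∑ p ∈ P \ V, (g p * u p) * ((L - ∑ p ∈ V, u p)⁺ - u p)⁺ ^ (j + 1) := by
    have hU : ∀ U ∈ P.powerset, L * ((∏ p ∈ U, g p) * (L - ∑ p ∈ U, u p)⁺ ^ (j + 1)) -
        (∏ p ∈ U, g p) * (L - ∑ p ∈ U, u p)⁺ ^ (j + 2) =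
          ∑ p ∈ U, u p * ((∏ p ∈ U, g p) * (L - ∑ p ∈ U, u p)⁺ ^ (j + 1)) := fun U _ => by
      rw [posPart_pow_add_two, ← sum_mul]
      ring
    simp only [subsetMoment, mul_sum, ← sum_sub_distrib]
    rw [sum_congr rfl hU, sum_powerset_sum_mem_eq]
    refine sum_congr rfl fun V _ => sum_congr rfl fun p hp => ?_
    obtain ⟨hpP, hpV⟩ := mem_sdiff.1 hp
    rw [prod_insert hpV, sum_insert hpV, add_comm (u p), posPart_sub_add (hu p hpP)]
    ring
  have hle : ∀ V ∈ P.powerset, (∏ p ∈ V, g p) *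
      ∑ p ∈ P \ V, (g p * u p) * ((L - ∑ p ∈ V, u p)⁺ - u p)⁺ ^ (j + 1) ≤
        κ / (j + 2) * ((∏ p ∈ V, g p) * (L - ∑ p ∈ V, u p)⁺ ^ (j + 2)) +
          C * ((∏ p ∈ V, g p) * (L - ∑ p ∈ V, u p)⁺ ^ (j + 1)) := fun V hV => by
    refine (mul_le_mul_of_nonneg_left (((sum_le_sum_of_subset_of_nonneg sdiff_subset
      fun p hp _ => mul_nonneg (hgu p hp) (pow_nonneg (posPart_nonneg _) _)).trans
        (sum_mul_posPart_pow_succ_le hgu hu (posPart_nonneg _) h j)))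
      (prod_nonneg fun p hp => hg p (mem_powerset.1 hV hp))).trans (le_of_eq ?_)
    ring
  have hsum := sum_le_sum hle
  rw [← hexpand, sum_add_distrib, ← mul_sum, ← mul_sum] at hsum
  change _ ≤ _ * subsetMoment P g u L (j + 2) + C * subsetMoment P g u L (j + 1) at hsum
  linarith

theorem subsetMoment_add_le {P : Finset ι} {g f u : ι → ℝ} (hg : ∀ p ∈ P, 0 ≤ g p)
    (hf : ∀ p ∈ P, 0 ≤ f p) (hu : ∀ p ∈ P, 0 ≤ u p) {c C : ℝ}
    (h : ∀ v, 0 ≤ v → ∑ T ∈ P.powerset with ∑ p ∈ T, u p ≤ v, ∏ p ∈ T, f p ≤ c * v + C)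
    (L : ℝ) (m : ℕ) :
    subsetMoment P (g + f) u L (m + 1) ≤
      c / (m + 2) * subsetMoment P g u L (m + 2) + C * subsetMoment P g u L (m + 1) := by
  classical
  have hfT : ∀ T ∈ P.powerset, 0 ≤ ∏ p ∈ T, f p := fun T hT =>
    prod_nonneg fun p hp => hf p (mem_powerset.1 hT hp)
  have huT : ∀ T ∈ P.powerset, 0 ≤ ∑ p ∈ T, u p := fun T hT =>
    sum_nonneg fun p hp => hu p (mem_powerset.1 hT hp)
  have hexpand : subsetMoment P (g + f) u L (m + 1) =
      ∑ V ∈ P.powerset, (∏ p ∈ V, g p) * ∑ T ∈ (P \ V).powerset,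
        (∏ p ∈ T, f p) * ((L - ∑ p ∈ V, u p)⁺ - ∑ p ∈ T, u p)⁺ ^ (m + 1) := by
    simp only [subsetMoment, Pi.add_apply, prod_add, sum_mul]
    rw [sum_powerset_sum_powerset_eq]
    refine sum_congr rfl fun V hV => ?_
    rw [sum_Icc_eq_sum_powerset_sdiff (mem_powerset.1 hV), mul_sum]
    refine sum_congr rfl fun T hT => ?_
    have hVT : Disjoint V T := disjoint_of_subset_right (mem_powerset.1 hT) disjoint_sdiff
    rw [sum_union hVT, union_sdiff_cancel_left hVT, mul_assoc,
      posPart_sub_add (huT T (powerset_mono.2 sdiff_subset hT))]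
  rw [hexpand]
  simp only [subsetMoment, mul_sum, ← sum_add_distrib]
  refine sum_le_sum fun V hV => ?_
  rw [← mul_sum]
  refine (mul_le_mul_of_nonneg_left ((sum_le_sum_of_subset_of_nonneg
    (powerset_mono.2 sdiff_subset) fun T hT _ => mul_nonneg (hfT T hT)
      (pow_nonneg (posPart_nonneg _) _)).trans
    (sum_mul_posPart_pow_succ_le hfT huT (posPart_nonneg _) h m))
    (prod_nonneg fun p hp => hg p (mem_powerset.1 hV hp))).trans (le_of_eq ?_)
  ring

end Moments

/-! ### Estimates of Mertens type -/

section Mertens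

theorem sum_primesLE_div_mul_log_le (n : ℕ) :
    ∑ p ∈ Nat.primesLE n, ((n / p : ℕ) : ℝ) * log p ≤ n * log n := by
  have hcomm : ∑ m ∈ Ioc 0 n, ∑ p ∈ m.primeFactors, log p =
      ∑ p ∈ Nat.primesLE n, ∑ m ∈ Ioc 0 n with p ∣ m, log p :=
    sum_comm' fun m p => by
      simp only [Finset.mem_Ioc, Nat.mem_primeFactors, mem_filter, Nat.mem_primesLE]
      exact ⟨fun h => ⟨⟨h.1, h.2.2.1⟩, (Nat.le_of_dvd h.1.1 h.2.2.1).trans h.1.2, h.2.1⟩,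
        fun h => ⟨h.1.1, h.2.2, h.1.2, h.1.1.1.ne'⟩⟩
  calc ∑ p ∈ Nat.primesLE n, ((n / p : ℕ) : ℝ) * log p
      = ∑ m ∈ Ioc 0 n, ∑ p ∈ m.primeFactors, log p := by
        rw [hcomm]
        exact sum_congr rfl fun p _ => by
          rw [sum_const, nsmul_eq_mul, Nat.Ioc_filter_dvd_card_eq_div]
    _ ≤ ∑ _ ∈ Ioc 0 n, log n := sum_le_sum fun _ hm =>
        (sum_primeFactors_log_le_log _).trans <|
          log_le_log (Nat.cast_pos.2 (Finset.mem_Ioc.1 hm).1)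
            (Nat.cast_le.2 (Finset.mem_Ioc.1 hm).2)
    _ = n * log n := by rw [sum_const, Nat.card_Ioc, Nat.sub_zero, nsmul_eq_mul]

theorem sum_primesLE_log_div_le {n : ℕ} (hn : n ≠ 0) :
    ∑ p ∈ Nat.primesLE n, log p / p ≤ log n + log 4 := by
  have hn₀ : (0 : ℝ) < n := Nat.cast_pos.2 (Nat.pos_of_ne_zero hn)
  have htheta : ∑ p ∈ Nat.primesLE n, log p ≤ log 4 * n := by
    have h := Chebyshev.theta_le_log4_mul_x hn₀.le
    rwa [Chebyshev.theta_eq_sum_primesLE, Nat.floor_natCast] at h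
  have hfloor : ∀ p ∈ Nat.primesLE n,
      n * (log p / p) ≤ ((n / p : ℕ) : ℝ) * log p + log p := fun p _ => by
    have h := (Nat.lt_floor_add_one ((n : ℝ) / p)).le
    rw [Nat.floor_div_natCast, Nat.floor_natCast] at h
    calc n * (log p / p) = n / p * log p := by ring
      _ ≤ ((n / p : ℕ) + 1) * log p := mul_le_mul_of_nonneg_right h (log_natCast_nonneg p)
      _ = _ := by ring
  have hsum := sum_le_sum hfloor
  rw [← mul_sum, sum_add_distrib] at hsum
  refine le_of_mul_le_mul_left ?_ hn₀
  linarith [sum_primesLE_div_mul_log_le n]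

theorem log_floor_exp_le {v : ℝ} (hv : 0 ≤ v) : log ⌊exp v⌋₊ ≤ v := by
  rw [log_le_iff_le_exp (Nat.cast_pos.2 (Nat.floor_pos.2 (one_le_exp hv)))]
  exact Nat.floor_le (exp_pos v).le

theorem sum_log_div_filter_log_le {P : Finset ℕ} (hP : ∀ p ∈ P, p.Prime) {v : ℝ} (hv : 0 ≤ v) :
    ∑ p ∈ P with log (p : ℕ) ≤ v, log p / p ≤ v + log 4 := by
  refine (sum_le_sum_of_subset_of_nonneg (fun p hp => ?_) fun p _ _ =>
    div_nonneg (log_natCast_nonneg p) p.cast_nonneg).trans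
      ((sum_primesLE_log_div_le (Nat.floor_pos.2 (one_le_exp hv)).ne').trans
        (add_le_add_left (log_floor_exp_le hv) _))
  obtain ⟨hpP, hpv⟩ := mem_filter.1 hp
  exact Nat.mem_primesLE.2 ⟨Nat.le_floor <|
    (log_le_iff_le_exp (Nat.cast_pos.2 (hP p hpP).pos)).1 hpv, hP p hpP⟩

theorem log_div_sub_le {k x : ℝ} (hk : 0 < k) (hx : 2 * k ≤ x) (hx₁ : 1 ≤ x) :
    log x / (x - k) ≤ log x / x + 4 * k * (1 / x ^ (3 / 2 : ℝ)) := by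
  have hx₀ : 0 < x := zero_lt_one.trans_le hx₁
  have hxk : 0 < x - k := by linarith
  set t := x ^ (1 / 2 : ℝ) with ht
  have ht₀ : 0 < t := rpow_pos_of_pos hx₀ _
  have htx : t * t = x := by rw [← rpow_add hx₀]; norm_num
  have hpow : x ^ (3 / 2 : ℝ) = x * t := by
    rw [show (3 / 2 : ℝ) = 1 + 1 / 2 by norm_num, rpow_add hx₀, rpow_one]
  have hlog : log x * t ≤ 2 * x := by
    have h := log_le_rpow_div hx₀.le (ε := 1 / 2) (by norm_num)
    rw [← ht, div_div_eq_mul_div, div_one] at h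
    calc log x * t ≤ t * 2 * t := mul_le_mul_of_nonneg_right h ht₀.le
      _ = 2 * x := by rw [← htx]; ring
  have hdiff : log x / (x - k) - log x / x = k * log x / (x * (x - k)) := by
    field_simp
    ring
  rw [← sub_le_iff_le_add', hdiff, hpow, mul_one_div,
    div_le_div_iff₀ (by positivity) (by positivity)]
  calc k * log x * (x * t) = k * x * (log x * t) := by ring
    _ ≤ k * x * (4 * (x - k)) := mul_le_mul_of_nonneg_left (by linarith) (by positivity)
    _ = _ := by ring

theorem exists_sum_log_div_sub_le {k : ℕ} (hk : k ≠ 0) : ∃ C : ℝ, 0 ≤ C ∧ ∀ P : Finset ℕ,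
    (∀ p ∈ P, p.Prime ∧ 2 * k ≤ p) → ∀ v : ℝ, 0 ≤ v →
      ∑ p ∈ P with log (p : ℕ) ≤ v, ((k : ℝ) - 1) / (p - k) * log p ≤ (k - 1) * v + C := by
  have hk₁ : (1 : ℝ) ≤ k := Nat.one_le_cast.2 (Nat.pos_of_ne_zero hk)
  have hk₀ : (0 : ℝ) ≤ k - 1 := sub_nonneg.2 hk₁
  have hsummable : Summable fun n : ℕ => 1 / (n : ℝ) ^ (3 / 2 : ℝ) :=
    summable_one_div_nat_rpow.2 (by norm_num)
  set Z := ∑' n : ℕ, 1 / (n : ℝ) ^ (3 / 2 : ℝ)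
  refine ⟨(k - 1) * (log 4 + 4 * k * Z), mul_nonneg hk₀ (by positivity), fun P hP v hv => ?_⟩
  set Q := P.filter fun p : ℕ => log p ≤ v
  have hQ : ∀ p ∈ Q, p.Prime ∧ 2 * k ≤ p := fun p hp => hP p (mem_filter.1 hp).1
  have hterm : ∀ p ∈ Q, log p / (p - k) ≤ log p / p + 4 * k * (1 / (p : ℝ) ^ (3 / 2 : ℝ)) :=
    fun p hp => log_div_sub_le (by linarith) (by exact_mod_cast (hQ p hp).2)
      (Nat.one_le_cast.2 (hQ p hp).1.one_le)
  calc ∑ p ∈ Q, ((k : ℝ) - 1) / (p - k) * log p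
      = (k - 1) * ∑ p ∈ Q, log p / (p - k) := by
        rw [mul_sum]
        exact sum_congr rfl fun p _ => by ring
    _ ≤ (k - 1) * (∑ p ∈ Q, log p / p + 4 * k * ∑ p ∈ Q, 1 / (p : ℝ) ^ (3 / 2 : ℝ)) := by
        rw [mul_sum Q _ (4 * (k : ℝ)), ← sum_add_distrib]
        exact mul_le_mul_of_nonneg_left (sum_le_sum hterm) hk₀
    _ ≤ (k - 1) * ((v + log 4) + 4 * k * Z) := by
        gcongr
        · exact sum_log_div_filter_log_le (fun p hp => (hP p hp).1) hv
        · exact hsummable.sum_le_tsum _ fun n _ => by positivity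
    _ = _ := by ring

theorem sum_one_div_le_card_mul {a : ℕ} (ha : a ≠ 0) {s : Finset ℕ} (hs : ∀ n ∈ s, a ≤ n) :
    ∑ n ∈ s, (1 : ℝ) / n ≤ #s * (1 / a) := by
  rw [← nsmul_eq_mul]
  exact sum_le_card_nsmul _ _ _ fun n hn => one_div_le_one_div_of_le
    (Nat.cast_pos.2 (Nat.pos_of_ne_zero ha)) (Nat.cast_le.2 (hs n hn))

theorem sum_Ico_coprime_one_div_le {W : ℕ} (hW : W ≠ 0) (J : ℕ) :
    ∑ n ∈ Ico 1 (W * (J + 1)) with W.Coprime n, (1 : ℝ) / n ≤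
      W + (W.totient : ℝ) / W * (harmonic J : ℝ) := by
  induction J with
  | zero =>
    simp only [zero_add, mul_one, harmonic_zero, Rat.cast_zero, mul_zero, add_zero]
    refine (sum_one_div_le_card_mul one_ne_zero fun n hn =>
      (Finset.mem_Ico.1 (mem_filter.1 hn).1).1).trans ?_
    rw [Nat.cast_one, div_one, mul_one, Nat.cast_le]
    exact (card_filter_le _ _).trans ((Nat.card_Ico 1 W).le.trans (W.sub_le 1))
  | succ J ih =>
    have hne : W * (J + 1) ≠ 0 := mul_ne_zero hW J.succ_ne_zero
    have hblock := sum_one_div_le_card_mul (s := (Ico (W * (J + 1)) (W * (J + 1) + W)).filter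
      (W.Coprime ·)) hne fun n hn => (Finset.mem_Ico.1 (mem_filter.1 hn).1).1
    rw [Nat.filter_coprime_Ico_eq_totient] at hblock
    have hW₀ : (W : ℝ) ≠ 0 := Nat.cast_ne_zero.2 hW
    have hterm : (W.totient : ℝ) * (1 / (W * (J + 1) : ℕ)) =
        W.totient / W * ((J + 1 : ℕ) : ℝ)⁻¹ := by
      push_cast
      field_simp
    rw [mul_add_one W (J + 1), ← Ico_union_Ico_eq_Ico (Nat.one_le_iff_ne_zero.2 hne)
      (Nat.le_add_right _ W), filter_union, sum_union (disjoint_filter_filter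
        (Ico_disjoint_Ico_consecutive _ _ _)), harmonic_succ]
    push_cast at hterm hblock ⊢
    linarith

theorem sum_Icc_coprime_one_div_le {W : ℕ} (hW : W ≠ 0) (Y : ℕ) :
    ∑ n ∈ Icc 1 Y with W.Coprime n, (1 : ℝ) / n ≤
      (W.totient : ℝ) / W * log Y + (W + 1) := by
  have hφ₁ : (W.totient : ℝ) / W ≤ 1 :=
    div_le_one_of_le₀ (Nat.cast_le.2 (Nat.totient_le W)) W.cast_nonneg
  have hsubset : Icc 1 Y ⊆ Ico 1 (W * (Y / W + 1)) := fun n hn =>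
    Finset.mem_Ico.2 ⟨(Finset.mem_Icc.1 hn).1, (Finset.mem_Icc.1 hn).2.trans_lt
      (Nat.lt_mul_div_succ Y (Nat.pos_of_ne_zero hW))⟩
  have hharmonic : (harmonic (Y / W) : ℝ) ≤ 1 + log Y := by
    refine (harmonic_le_one_add_log _).trans (add_le_add_right ?_ 1)
    rcases (Y / W).eq_zero_or_pos with h | h
    · rw [h, Nat.cast_zero, log_zero]
      exact log_natCast_nonneg Y
    · exact log_le_log (Nat.cast_pos.2 h) (Nat.cast_le.2 (Nat.div_le_self Y W))
  calc ∑ n ∈ Icc 1 Y with W.Coprime n, (1 : ℝ) / n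
      ≤ ∑ n ∈ Ico 1 (W * (Y / W + 1)) with W.Coprime n, (1 : ℝ) / n :=
        sum_le_sum_of_subset_of_nonneg (filter_subset_filter _ hsubset) fun n _ _ => by positivity
    _ ≤ W + (W.totient : ℝ) / W * (1 + log Y) :=
        (sum_Ico_coprime_one_div_le hW _).trans (by gcongr)
    _ ≤ _ := by linarith

theorem injOn_prod_powerset {P : Finset ℕ} (hP : ∀ p ∈ P, p.Prime) :
    Set.InjOn (fun T : Finset ℕ => ∏ p ∈ T, p) (P.powerset : Set (Finset ℕ)) := by
  have hfactors : ∀ T ∈ (P.powerset : Set (Finset ℕ)), (∏ p ∈ T, p).primeFactors = T :=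
    fun T hT => Nat.primeFactors_prod fun p hp => hP p (mem_powerset.1 hT hp)
  exact fun S hS T hT h => (hfactors S hS).symm.trans ((congrArg _ h).trans (hfactors T hT))

theorem sum_powerset_prod_one_div_le {P : Finset ℕ} {W : ℕ} (hP : ∀ p ∈ P, p.Prime ∧ ¬p ∣ W)
    (v : ℝ) :
    ∑ T ∈ P.powerset with ∑ p ∈ T, log (p : ℕ) ≤ v, ∏ p ∈ T, (1 : ℝ) / p ≤
      ∑ n ∈ Icc 1 ⌊exp v⌋₊ with W.Coprime n, (1 : ℝ) / n := by
  set F := P.powerset.filter fun T : Finset ℕ => ∑ p ∈ T, log p ≤ v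
  have hcast : ∀ T ∈ F, ∏ p ∈ T, (1 : ℝ) / p = 1 / (∏ p ∈ T, p : ℕ) := fun T _ => by
    rw [prod_div_distrib, prod_const_one, Nat.cast_prod]
  have hinj : Set.InjOn (fun T : Finset ℕ => ∏ p ∈ T, p) (F : Set (Finset ℕ)) :=
    (injOn_prod_powerset fun p hp => (hP p hp).1).mono (filter_subset _ _)
  rw [sum_congr rfl hcast, ← sum_image (f := fun n : ℕ => (1 : ℝ) / n) hinj]
  refine sum_le_sum_of_subset_of_nonneg (image_subset_iff.2 fun T hT => ?_)
    fun n _ _ => by positivity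
  obtain ⟨hTP, hTv⟩ := mem_filter.1 hT
  have hprime : ∀ p ∈ T, p.Prime := fun p hp => (hP p (mem_powerset.1 hTP hp)).1
  have hpos : 0 < ∏ p ∈ T, p := prod_pos fun p hp => (hprime p hp).pos
  refine mem_filter.2 ⟨Finset.mem_Icc.2 ⟨hpos, Nat.le_floor ?_⟩, Nat.Coprime.prod_right fun p hp =>
    ((hprime p hp).coprime_iff_not_dvd.2 (hP p (mem_powerset.1 hTP hp)).2).symm⟩
  rw [← log_le_iff_le_exp (Nat.cast_pos.2 hpos), Nat.cast_prod,
    log_prod fun p hp => Nat.cast_ne_zero.2 (hprime p hp).ne_zero]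
  exact hTv

theorem sum_filter_prod_add_le {ι : Type*} {P : Finset ι} {f g u : ι → ℝ}
    (hf : ∀ p ∈ P, 0 ≤ f p) (hg : ∀ p ∈ P, 0 ≤ g p) (hu : ∀ p ∈ P, 0 ≤ u p) (v : ℝ) :
    ∑ U ∈ P.powerset with ∑ p ∈ U, u p ≤ v, ∏ p ∈ U, (f p + g p) ≤
      (∑ S ∈ P.powerset with ∑ p ∈ S, u p ≤ v, ∏ p ∈ S, f p) *
        ∑ T ∈ P.powerset with ∑ p ∈ T, u p ≤ v, ∏ p ∈ T, g p := by
  classical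
  set F := P.powerset.filter fun U => ∑ p ∈ U, u p ≤ v
  have hsubset : ∀ {U}, U ∈ F → U ⊆ P := fun hU => mem_powerset.1 (mem_filter.1 hU).1
  have hlower : ∀ {S U}, S ⊆ U → U ∈ F → S ∈ F := fun hSU hU =>
    mem_filter.2 ⟨mem_powerset.2 (hSU.trans (hsubset hU)),
      (sum_le_sum_of_subset_of_nonneg hSU fun p hp _ => hu p (hsubset hU hp)).trans
        (mem_filter.1 hU).2⟩
  have hcomm : ∑ U ∈ F, ∑ S ∈ U.powerset, (∏ p ∈ S, f p) * ∏ p ∈ U \ S, g p =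
      ∑ S ∈ F, ∑ U ∈ F with S ⊆ U, (∏ p ∈ S, f p) * ∏ p ∈ U \ S, g p :=
    sum_comm' fun U S => by
      rw [mem_powerset, mem_filter (s := F)]
      exact ⟨fun h => ⟨h, hlower h.2 h.1⟩, fun h => h.1⟩
  simp only [prod_add]
  rw [hcomm, sum_mul]
  refine sum_le_sum fun S hS => ?_
  rw [← mul_sum]
  refine mul_le_mul_of_nonneg_left ?_ (prod_nonneg fun p hp => hf p (hsubset hS hp))
  have hinj : Set.InjOn (· \ S) ((F.filter (S ⊆ ·) : Finset (Finset ι)) : Set (Finset ι)) :=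
    fun U hU V hV h => by
      rw [← sdiff_union_of_subset (mem_filter.1 hU).2, ← sdiff_union_of_subset (mem_filter.1 hV).2]
      exact congrArg (· ∪ S) h
  rw [← sum_image (f := fun T => ∏ p ∈ T, g p) hinj]
  refine sum_le_sum_of_subset_of_nonneg (image_subset_iff.2 fun U hU =>
    hlower sdiff_subset (mem_filter.1 hU).1) fun T hT _ =>
      prod_nonneg fun p hp => hg p (hsubset hT hp)

theorem sum_filter_prod_one_div_le {P : Finset ℕ} {W : ℕ} (hW : W ≠ 0)
    (hP : ∀ p ∈ P, p.Prime ∧ ¬p ∣ W) {v : ℝ} (hv : 0 ≤ v) :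
    ∑ T ∈ P.powerset with ∑ p ∈ T, log (p : ℕ) ≤ v, ∏ p ∈ T, (1 : ℝ) / p ≤
      (W.totient : ℝ) / W * v + (W + 1) :=
  ((sum_powerset_prod_one_div_le hP v).trans (sum_Icc_coprime_one_div_le hW _)).trans <| by
    gcongr
    exact log_floor_exp_le hv

theorem sum_filter_prod_div_le {P : Finset ℕ} (hP : ∀ p ∈ P, p.Prime) (K : ℕ) {v : ℝ}
    (hv : 0 ≤ v) :
    ∑ T ∈ P.powerset with ∑ p ∈ T, log (p : ℕ) ≤ v, ∏ p ∈ T, (K : ℝ) / p ≤ (2 + v) ^ K := by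
  have hone : ∑ T ∈ P.powerset with ∑ p ∈ T, log (p : ℕ) ≤ v, ∏ p ∈ T, (1 : ℝ) / p ≤ 2 + v := by
    have h := sum_filter_prod_one_div_le one_ne_zero
      (fun p hp => ⟨hP p hp, (hP p hp).not_dvd_one⟩) hv
    rw [Nat.totient_one, Nat.cast_one, div_one, one_mul] at h
    linarith
  induction K with
  | zero =>
    have hzero : ∀ T ∈ P.powerset.filter fun T : Finset ℕ => ∑ p ∈ T, log p ≤ v,
        T ≠ ∅ → ∏ p ∈ T, ((0 : ℕ) : ℝ) / p = 0 := fun T _ hT => by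
      obtain ⟨p, hp⟩ := nonempty_iff_ne_empty.2 hT
      exact prod_eq_zero hp (by simp)
    rw [sum_eq_single ∅ hzero (by simp [hv])]
    simp
  | succ K ih =>
    have hadd := sum_filter_prod_add_le (P := P) (f := fun p : ℕ => (K : ℝ) / p)
      (g := fun p : ℕ => (1 : ℝ) / p) (u := fun p : ℕ => log p)
      (fun p _ => by positivity) (fun p _ => by positivity)
      (fun p _ => log_natCast_nonneg p) v
    simp only [Nat.cast_succ, add_div]
    rw [pow_succ]
    exact hadd.trans (mul_le_mul ih hone (by positivity) (by positivity))

theorem natCast_sub_pos_of_two_mul_le {k p : ℕ} (hp : 0 < p) (hkp : 2 * k ≤ p) :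
    (0 : ℝ) < p - k :=
  sub_pos.2 (Nat.cast_lt.2 (by lia))

theorem div_mul_sub_le {k x : ℝ} (hk : 0 ≤ k) (hx : 0 < x) (hkx : 2 * k ≤ x) :
    k / (x * (x - k)) ≤ 2 * k * (x ^ 2)⁻¹ := by
  rw [← div_eq_mul_inv, div_le_div_iff₀ (mul_pos hx (by linarith)) (by positivity)]
  have h : 0 ≤ k * x * (x - 2 * k) := mul_nonneg (by positivity) (by linarith)
  linarith

theorem sum_inv_sq_le {D₀ : ℕ} (hD₀ : D₀ ≠ 0) {P : Finset ℕ} (hP : ∀ p ∈ P, D₀ < p) :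
    ∑ p ∈ P, ((p : ℝ) ^ 2)⁻¹ ≤ (D₀ : ℝ)⁻¹ := by
  have hsubset : P ⊆ Ioc D₀ (max D₀ (P.sup id)) := fun p hp => Finset.mem_Ioc.2
    ⟨hP p hp, le_max_of_le_right (le_sup (f := id) hp)⟩
  calc ∑ p ∈ P, ((p : ℝ) ^ 2)⁻¹
      ≤ ∑ p ∈ Ioc D₀ (max D₀ (P.sup id)), ((p : ℝ) ^ 2)⁻¹ :=
        sum_le_sum_of_subset_of_nonneg hsubset fun n _ _ => by positivity
    _ ≤ (D₀ : ℝ)⁻¹ - ((max D₀ (P.sup id) : ℕ) : ℝ)⁻¹ :=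
        sum_Ioc_inv_sq_le_sub hD₀ (le_max_left _ _)
    _ ≤ (D₀ : ℝ)⁻¹ := sub_le_self _ (by positivity)

theorem prod_one_add_div_mul_sub_le {k D₀ : ℕ} (hD₀ : D₀ ≠ 0) {P : Finset ℕ}
    (hP : ∀ p ∈ P, D₀ < p ∧ 2 * k ≤ p) :
    ∏ p ∈ P, (1 + (k : ℝ) / (p * (p - k))) ≤ exp (2 * k / D₀) := by
  have hpos : ∀ p ∈ P, (0 : ℝ) < p := fun p hp => Nat.cast_pos.2 (pos_of_gt (hP p hp).1)
  have hle : ∀ p ∈ P, 2 * (k : ℝ) ≤ p := fun p hp => by exact_mod_cast (hP p hp).2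
  have hsub : ∀ p ∈ P, (0 : ℝ) < p - k := fun p hp =>
    natCast_sub_pos_of_two_mul_le (pos_of_gt (hP p hp).1) (hP p hp).2
  calc ∏ p ∈ P, (1 + (k : ℝ) / (p * (p - k)))
      ≤ ∏ p ∈ P, exp (2 * k * ((p : ℝ) ^ 2)⁻¹) :=
        prod_le_prod (fun p hp => add_nonneg zero_le_one <|
          div_nonneg k.cast_nonneg (mul_nonneg p.cast_nonneg (hsub p hp).le)) fun p hp => by
          rw [add_comm]
          exact (add_le_add_left (div_mul_sub_le k.cast_nonneg (hpos p hp) (hle p hp)) 1).trans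
            (add_one_le_exp _)
    _ = exp (2 * k * ∑ p ∈ P, ((p : ℝ) ^ 2)⁻¹) := by rw [← exp_sum, mul_sum]
    _ ≤ exp (2 * k / D₀) := by
        rw [div_eq_mul_inv]
        gcongr
        exact sum_inv_sq_le hD₀ fun p hp => (hP p hp).1

theorem sum_filter_prod_one_div_sub_le {k D₀ W : ℕ} (hD₀ : D₀ ≠ 0) (hW : W ≠ 0) {P : Finset ℕ}
    (hP : ∀ p ∈ P, p.Prime ∧ ¬p ∣ W ∧ D₀ < p ∧ 2 * k ≤ p) {v : ℝ} (hv : 0 ≤ v) :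
    ∑ T ∈ P.powerset with ∑ p ∈ T, log (p : ℕ) ≤ v, ∏ p ∈ T, 1 / ((p : ℝ) - k) ≤
      exp (2 * k / D₀) * ((W.totient : ℝ) / W * v + (W + 1)) := by
  have hp₀ : ∀ p ∈ P, (0 : ℝ) < p := fun p hp => Nat.cast_pos.2 (hP p hp).1.pos
  have hpk : ∀ p ∈ P, (0 : ℝ) < p - k := fun p hp =>
    natCast_sub_pos_of_two_mul_le (hP p hp).1.pos (hP p hp).2.2.2
  have hnonneg : ∀ p ∈ P, (0 : ℝ) ≤ k / (p * (p - k)) := fun p hp =>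
    div_nonneg k.cast_nonneg (mul_pos (hp₀ p hp) (hpk p hp)).le
  set F := P.powerset.filter fun T : Finset ℕ => ∑ p ∈ T, log p ≤ v
  have hsubset : ∀ T ∈ F, T ⊆ P := fun T hT => mem_powerset.1 (mem_filter.1 hT).1
  calc ∑ T ∈ F, ∏ p ∈ T, 1 / ((p : ℝ) - k)
      = ∑ T ∈ F, ∏ p ∈ T, ((k : ℝ) / (p * (p - k)) + 1 / p) :=
        sum_congr rfl fun T hT => prod_congr rfl fun p hp => by
          have h₀ := (hp₀ p (hsubset T hT hp)).ne'
          have h₁ := (hpk p (hsubset T hT hp)).ne'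
          field_simp
          ring
    _ ≤ (∑ T ∈ F, ∏ p ∈ T, (k : ℝ) / (p * (p - k))) * ∑ T ∈ F, ∏ p ∈ T, (1 : ℝ) / p :=
        sum_filter_prod_add_le hnonneg (fun p _ => by positivity)
          (fun p _ => log_natCast_nonneg p) v
    _ ≤ exp (2 * k / D₀) * ((W.totient : ℝ) / W * v + (W + 1)) := by
        refine mul_le_mul ?_ (sum_filter_prod_one_div_le hW
          (fun p hp => ⟨(hP p hp).1, (hP p hp).2.1⟩) hv) (by positivity) (exp_nonneg _)
        refine le_trans ?_ (prod_one_add_div_mul_sub_le hD₀ fun p hp => (hP p hp).2.2)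
        rw [prod_one_add]
        exact sum_le_sum_of_subset_of_nonneg (filter_subset _ _) fun T hT _ =>
          prod_nonneg fun p hp => hnonneg p (mem_powerset.1 hT hp)

end Mertens

/-! ### Squares of divisor sums -/

section DivisorSumSquares

variable {ι α : Type*} [DecidableEq ι] {P : Finset ι} {N : Finset α} {A : α → Finset ι}

theorem sum_mul_sum_powerset_sq (hA : ∀ n ∈ N, A n ⊆ P) (a : α → ℝ) (l : Finset ι → ℝ) :
    ∑ n ∈ N, a n * (∑ S ∈ (A n).powerset, l S) ^ 2 =
      ∑ S ∈ P.powerset, ∑ T ∈ P.powerset, l S * l T * ∑ n ∈ N with S ∪ T ⊆ A n, a n := by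
  have hsum : ∀ n ∈ N, ∑ S ∈ (A n).powerset, l S = ∑ S ∈ P.powerset, if S ⊆ A n then l S else 0 :=
    fun n hn => by
      rw [← sum_filter]
      refine sum_congr (ext fun S => ?_) fun _ _ => rfl
      rw [mem_filter, mem_powerset, mem_powerset]
      exact ⟨fun h => ⟨h.trans (hA n hn), h⟩, fun h => h.2⟩
  have hsq : ∀ n ∈ N, a n * (∑ S ∈ (A n).powerset, l S) ^ 2 =
      ∑ S ∈ P.powerset, ∑ T ∈ P.powerset, l S * l T * if S ∪ T ⊆ A n then a n else 0 :=
    fun n hn => by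
      rw [hsum n hn, sq, sum_mul_sum, mul_sum]
      refine sum_congr rfl fun S _ => ?_
      rw [mul_sum]
      refine sum_congr rfl fun T _ => ?_
      by_cases hS : S ⊆ A n <;> by_cases hT : T ⊆ A n <;>
        simp [hS, hT, union_subset_iff, mul_comm]
  rw [sum_congr rfl hsq, sum_comm]
  refine sum_congr rfl fun S _ => ?_
  rw [sum_comm]
  refine sum_congr rfl fun T _ => ?_
  rw [← mul_sum, sum_filter]

theorem abs_sum_mul_sum_powerset_sq_sub_le (hA : ∀ n ∈ N, A n ⊆ P) {a : α → ℝ}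
    {l : Finset ι → ℝ} {X : ℝ} {w : ι → ℝ} {E : Finset ι → ℝ}
    (hE : ∀ S ⊆ P, ∀ T ⊆ P, l S ≠ 0 → l T ≠ 0 →
      |∑ n ∈ N with S ∪ T ⊆ A n, a n - X * ∏ p ∈ S ∪ T, w p| ≤ E (S ∪ T)) :
    |∑ n ∈ N, a n * (∑ S ∈ (A n).powerset, l S) ^ 2 - X * selbergForm P l w| ≤
      ∑ S ∈ P.powerset, ∑ T ∈ P.powerset, |l S| * |l T| * E (S ∪ T) := by
  rw [sum_mul_sum_powerset_sq hA, selbergForm, mul_sum, ← sum_sub_distrib]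
  refine (abs_sum_le_sum_abs _ _).trans (sum_le_sum fun S hS => ?_)
  rw [mul_sum, ← sum_sub_distrib]
  refine (abs_sum_le_sum_abs _ _).trans (sum_le_sum fun T hT => ?_)
  rw [mul_left_comm X (l S * l T), ← mul_sub, abs_mul, abs_mul]
  by_cases hS₀ : l S = 0
  · simp only [hS₀, abs_zero, zero_mul, le_refl]
  by_cases hT₀ : l T = 0
  · simp only [hT₀, abs_zero, mul_zero, zero_mul, le_refl]
  exact mul_le_mul_of_nonneg_left (hE S (mem_powerset.1 hS) T (mem_powerset.1 hT) hS₀ hT₀)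
    (by positivity)

theorem sum_sum_powerset_union_le {g : Finset ι → ℝ} (hg : ∀ U ⊆ P, 0 ≤ g U) :
    ∑ S ∈ P.powerset, ∑ T ∈ P.powerset, g (S ∪ T) ≤ ∑ U ∈ P.powerset, 4 ^ #U * g U := by
  have hmaps : ∀ x ∈ P.powerset ×ˢ P.powerset, x.1 ∪ x.2 ∈ P.powerset := fun x hx => by
    rw [mem_product, mem_powerset, mem_powerset] at hx
    exact mem_powerset.2 (union_subset hx.1 hx.2)
  rw [← sum_product', ← sum_fiberwise_of_maps_to hmaps]
  refine sum_le_sum fun U hU => ?_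
  have hfiber : (P.powerset ×ˢ P.powerset).filter (fun x => x.1 ∪ x.2 = U) ⊆
      U.powerset ×ˢ U.powerset := fun x hx => by
    rw [mem_product, mem_powerset, mem_powerset, ← (mem_filter.1 hx).2]
    exact ⟨subset_union_left, subset_union_right⟩
  calc ∑ x ∈ P.powerset ×ˢ P.powerset with x.1 ∪ x.2 = U, g (x.1 ∪ x.2)
      = ∑ x ∈ P.powerset ×ˢ P.powerset with x.1 ∪ x.2 = U, g U :=
        sum_congr rfl fun x hx => by rw [(mem_filter.1 hx).2]
    _ ≤ ∑ _x ∈ U.powerset ×ˢ U.powerset, g U :=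
        sum_le_sum_of_subset_of_nonneg hfiber fun _ _ _ => hg U (mem_powerset.1 hU)
    _ = 4 ^ #U * g U := by
        rw [sum_const, card_product, card_powerset, nsmul_eq_mul, ← mul_pow]
        norm_num

theorem sum_sum_abs_mul_abs_mul_union_le {u : ι → ℝ} (hu : ∀ p ∈ P, 0 ≤ u p)
    {l : Finset ι → ℝ} {B L : ℝ} (hB : 0 ≤ B) (hl : ∀ S ⊆ P, |l S| ≤ B * 2 ^ #S)
    (hl₀ : ∀ S ⊆ P, l S ≠ 0 → ∑ p ∈ S, u p ≤ L) {E : Finset ι → ℝ} (hE : ∀ U ⊆ P, 0 ≤ E U) :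
    ∑ S ∈ P.powerset, ∑ T ∈ P.powerset, |l S| * |l T| * E (S ∪ T) ≤
      B ^ 2 * ∑ U ∈ P.powerset with ∑ p ∈ U, u p ≤ 2 * L, 16 ^ #U * E U := by
  set g : Finset ι → ℝ := fun U => if ∑ p ∈ U, u p ≤ 2 * L then B ^ 2 * (4 ^ #U * E U) else 0
  have hg : ∀ U ⊆ P, 0 ≤ g U := fun U hU =>
    ite_nonneg (mul_nonneg (sq_nonneg B) (mul_nonneg (by positivity) (hE U hU))) le_rfl
  have hsupport : ∀ S ⊆ P, ∀ T ⊆ P, l S ≠ 0 → l T ≠ 0 → ∑ p ∈ S ∪ T, u p ≤ 2 * L :=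
    fun S hS T hT hS₀ hT₀ => by
      have hinter : 0 ≤ ∑ p ∈ S ∩ T, u p := sum_nonneg fun p hp => hu p (hS (mem_inter.1 hp).1)
      linarith [sum_union_inter (s₁ := S) (s₂ := T) (f := u), hl₀ S hS hS₀, hl₀ T hT hT₀]
  have hbound : ∀ S ∈ P.powerset, ∀ T ∈ P.powerset, |l S| * |l T| * E (S ∪ T) ≤ g (S ∪ T) := by
    intro S hS T hT
    rw [mem_powerset] at hS hT
    have hST := union_subset hS hT
    by_cases hS₀ : l S = 0
    · simpa only [hS₀, abs_zero, zero_mul] using hg _ hST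
    by_cases hT₀ : l T = 0
    · simpa only [hT₀, abs_zero, mul_zero, zero_mul] using hg _ hST
    have hl' : ∀ R ⊆ P, R ⊆ S ∪ T → |l R| ≤ B * 2 ^ #(S ∪ T) := fun R hR hRU =>
      (hl R hR).trans (by gcongr; exact one_le_two)
    rw [show g (S ∪ T) = B ^ 2 * (4 ^ #(S ∪ T) * E (S ∪ T)) from
      if_pos (hsupport S hS T hT hS₀ hT₀), ← mul_assoc]
    refine mul_le_mul_of_nonneg_right ((mul_le_mul (hl' S hS subset_union_left)
      (hl' T hT subset_union_right) (abs_nonneg _) (by positivity)).trans_eq ?_) (hE _ hST)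
    rw [mul_mul_mul_comm, ← mul_pow, ← sq]
    norm_num
  refine (sum_le_sum fun S hS => sum_le_sum fun T hT => hbound S hS T hT).trans
    ((sum_sum_powerset_union_le hg).trans_eq ?_)
  rw [mul_sum, sum_filter]
  refine sum_congr rfl fun U _ => ?_
  simp only [g, mul_ite, mul_zero]
  rw [mul_left_comm, ← mul_assoc (4 ^ #U : ℝ), ← mul_pow]
  norm_num

end DivisorSumSquares

/-! ### The sieve weights of a tuple -/

section TupleWeight

/-- The Selberg weights `λ_d`, `d = ∏ p ∈ S, p`, for `k` residue classes modulo every prime of `P`,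
with diagonal variables `(L - log d)⁺ ^ m`. In the notation of Goldston, Pintz and Yıldırım,
`L = log R` and `m = ℓ`. -/
noncomputable def tupleWeight (P : Finset ℕ) (k : ℕ) (L : ℝ) (m : ℕ) (S : Finset ℕ) : ℝ :=
  selbergWeight P (fun p => (k : ℝ) / p) (fun R => (L - ∑ p ∈ R, log p)⁺ ^ m) S

variable {P S : Finset ℕ} {k m : ℕ} {L : ℝ}

theorem tupleWeight_eq_zero (hm : m ≠ 0) (hS : L ≤ ∑ p ∈ S, log p) :
    tupleWeight P k L m S = 0 := by
  have hzero : ∀ R ∈ Icc S P, (L - ∑ p ∈ R, log p)⁺ ^ m = 0 := fun R hR => by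
    have hle : L ≤ ∑ p ∈ R, log p := hS.trans <|
      sum_le_sum_of_subset_of_nonneg (Finset.mem_Icc.1 hR).1 fun p _ _ => log_natCast_nonneg p
    rw [posPart_eq_zero.2 (sub_nonpos.2 hle), zero_pow hm]
  rw [tupleWeight, selbergWeight, sum_eq_zero fun R hR => by rw [hzero R hR, zero_mul], mul_zero]

theorem sum_lt_of_tupleWeight_ne_zero (hm : m ≠ 0) (hS : tupleWeight P k L m S ≠ 0) :
    ∑ p ∈ S, log p < L :=
  not_le.1 fun h => hS (tupleWeight_eq_zero hm h)

theorem div_div_one_sub_div {k p : ℝ} (hp : p ≠ 0) : k / p / (1 - k / p) = k / (p - k) := by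
  rw [one_sub_div hp, div_div_div_cancel_right₀ hp]

theorem tupleWeight_eq (hk : k ≠ 0) (hP : ∀ p ∈ P, p.Prime ∧ 2 * k ≤ p) (hS : S ⊆ P) :
    tupleWeight P k L m S = (-1) ^ #S * ((∏ p ∈ S, (p : ℝ) / (p - k)) *
      ∑ T ∈ (P \ S).powerset, (L - ∑ p ∈ S ∪ T, log p)⁺ ^ m * ∏ p ∈ T, (k : ℝ) / (p - k)) := by
  have hp₀ : ∀ p ∈ P, (p : ℝ) ≠ 0 := fun p hp => Nat.cast_ne_zero.2 (hP p hp).1.ne_zero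
  have hfactor : ∏ p ∈ S, (p : ℝ) / (p - k) =
      (∏ p ∈ S, ((k : ℝ) / p)⁻¹) * ∏ p ∈ S, (k : ℝ) / (p - k) := by
    rw [← prod_mul_distrib]
    refine prod_congr rfl fun p _ => ?_
    rw [inv_div, div_mul_div_cancel₀ (Nat.cast_ne_zero.2 hk)]
  rw [tupleWeight, selbergWeight, sum_Icc_eq_sum_powerset_sdiff hS, hfactor, mul_assoc, mul_assoc,
    mul_sum ((P \ S).powerset) _ (∏ p ∈ S, (k : ℝ) / (p - k))]
  refine congrArg _ (congrArg _ (sum_congr rfl fun T hT => ?_))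
  have hdisj : Disjoint S T := disjoint_of_subset_right (mem_powerset.1 hT) disjoint_sdiff
  have hprod : ∀ R ⊆ P, ∏ p ∈ R, (k : ℝ) / p / (1 - k / p) = ∏ p ∈ R, (k : ℝ) / (p - k) :=
    fun R hR => prod_congr rfl fun p hp => div_div_one_sub_div (hp₀ p (hR hp))
  rw [hprod _ (union_subset hS ((mem_powerset.1 hT).trans sdiff_subset)), prod_union hdisj,
    mul_left_comm]

theorem sum_posPart_pow_mul_prod_le (hm : m ≠ 0) (hP : ∀ p ∈ P, p.Prime ∧ 2 * k ≤ p)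
    (hL : 0 ≤ L) (S : Finset ℕ) :
    ∑ T ∈ (P \ S).powerset, (L - ∑ p ∈ S ∪ T, log p)⁺ ^ m * ∏ p ∈ T, (k : ℝ) / (p - k) ≤
      (2 + L) ^ (m + 2 * k) := by
  have hterm : ∀ p ∈ P, 0 ≤ (k : ℝ) / (p - k) ∧ (k : ℝ) / (p - k) ≤ ((2 * k : ℕ) : ℝ) / p := by
    intro p hp
    have hpk := natCast_sub_pos_of_two_mul_le (hP p hp).1.pos (hP p hp).2
    have hkp : 2 * (k : ℝ) ≤ p := by exact_mod_cast (hP p hp).2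
    refine ⟨by positivity, ?_⟩
    rw [div_le_div_iff₀ hpk (Nat.cast_pos.2 (hP p hp).1.pos), Nat.cast_mul, Nat.cast_two]
    calc (k : ℝ) * p = k * (2 * (p - p / 2)) := by ring
      _ ≤ k * (2 * (p - k)) := by gcongr; linarith
      _ = 2 * k * (p - k) := by ring
  have hcutoff : ∀ T ∈ (P \ S).powerset,
      (L - ∑ p ∈ S ∪ T, log p)⁺ ^ m * ∏ p ∈ T, (k : ℝ) / (p - k) ≤
        if ∑ p ∈ T, log p ≤ L then (2 + L) ^ m * ∏ p ∈ T, ((2 * k : ℕ) : ℝ) / p else 0 := by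
    intro T hT
    have hTP := (mem_powerset.1 hT).trans sdiff_subset
    have hTS : ∑ p ∈ T, log p ≤ ∑ p ∈ S ∪ T, log p := sum_le_sum_of_subset_of_nonneg
      subset_union_right fun p _ _ => log_natCast_nonneg p
    split_ifs with hTL
    · refine mul_le_mul (pow_le_pow_left₀ (posPart_nonneg _) ?_ m)
        (prod_le_prod (fun p hp => (hterm p (hTP hp)).1) fun p hp => (hterm p (hTP hp)).2)
        (prod_nonneg fun p hp => (hterm p (hTP hp)).1) (by positivity)
      have hlog : 0 ≤ ∑ p ∈ S ∪ T, log p := sum_nonneg fun p _ => log_natCast_nonneg p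
      rw [posPart_def]
      exact sup_le (by linarith) (by linarith)
    · rw [posPart_eq_zero.2 (by linarith), zero_pow hm, zero_mul]
  calc _ ≤ _ := sum_le_sum hcutoff
    _ = (2 + L) ^ m * ∑ T ∈ (P \ S).powerset with ∑ p ∈ T, log (p : ℕ) ≤ L,
        ∏ p ∈ T, ((2 * k : ℕ) : ℝ) / p := by rw [← sum_filter, mul_sum]
    _ ≤ (2 + L) ^ (m + 2 * k) := by
      rw [pow_add]
      gcongr
      exact sum_filter_prod_div_le (fun p hp => (hP p (sdiff_subset hp)).1) _ hL

theorem abs_tupleWeight_le (hk : k ≠ 0) (hm : m ≠ 0) (hP : ∀ p ∈ P, p.Prime ∧ 2 * k ≤ p)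
    (hL : 0 ≤ L) (hS : S ⊆ P) :
    |tupleWeight P k L m S| ≤ (2 + L) ^ (m + 2 * k) * 2 ^ #S := by
  have hpk : ∀ p ∈ P, (0 : ℝ) < p - k := fun p hp =>
    natCast_sub_pos_of_two_mul_le (hP p hp).1.pos (hP p hp).2
  have hprod₀ : 0 ≤ ∏ p ∈ S, (p : ℝ) / (p - k) := prod_nonneg fun p hp =>
    div_nonneg p.cast_nonneg (hpk p (hS hp)).le
  have hprod : ∏ p ∈ S, (p : ℝ) / (p - k) ≤ 2 ^ #S := by
    refine (prod_le_prod (fun p hp => div_nonneg p.cast_nonneg (hpk p (hS hp)).le)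
      fun p hp => ?_).trans_eq (prod_const 2)
    have hkp : 2 * (k : ℝ) ≤ p := by exact_mod_cast (hP p (hS hp)).2
    rw [div_le_iff₀ (hpk p (hS hp))]
    linarith
  have hsum₀ : 0 ≤ ∑ T ∈ (P \ S).powerset,
      (L - ∑ p ∈ S ∪ T, log p)⁺ ^ m * ∏ p ∈ T, (k : ℝ) / (p - k) :=
    sum_nonneg fun T hT => mul_nonneg (by positivity) <| prod_nonneg fun p hp =>
      div_nonneg k.cast_nonneg (hpk p (sdiff_subset (mem_powerset.1 hT hp))).le
  rw [tupleWeight_eq hk hP hS, abs_mul, abs_pow, abs_neg, abs_one, one_pow, one_mul,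
    abs_of_nonneg (mul_nonneg hprod₀ hsum₀), mul_comm]
  exact mul_le_mul (sum_posPart_pow_mul_prod_le hm hP hL S) hprod hprod₀ (by positivity)

theorem selbergForm_tupleWeight_self (hk : k ≠ 0) (hP : ∀ p ∈ P, p.Prime ∧ 2 * k ≤ p) :
    selbergForm P (tupleWeight P k L m) (fun p => (k : ℝ) / p) =
      subsetMoment P (fun p => (k : ℝ) / (p - k)) (fun p => log p) L (2 * m) := by
  have hp₀ : ∀ p ∈ P, (p : ℝ) ≠ 0 := fun p hp => Nat.cast_ne_zero.2 (hP p hp).1.ne_zero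
  have hne : ∀ p ∈ P, (k : ℝ) / p ≠ 1 := fun p hp h => by
    rw [div_eq_one_iff_eq (hp₀ p hp)] at h
    exact (natCast_sub_pos_of_two_mul_le (hP p hp).1.pos (hP p hp).2).ne' (by rw [h, sub_self])
  refine (selbergForm_selbergWeight_self
    (fun p hp => div_ne_zero (Nat.cast_ne_zero.2 hk) (hp₀ p hp)) hne _).trans
      (sum_congr rfl fun U hU => ?_)
  rw [← pow_mul, mul_comm m]
  exact congrArg (· * _) (prod_congr rfl fun p hp =>
    div_div_one_sub_div (hp₀ p (mem_powerset.1 hU hp)))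

theorem sub_div_one_sub_tuple_density {k p : ℝ} (hp : p ≠ 0) (hp₁ : p ≠ 1) (hpk : p ≠ k) :
    (k / p - (k - 1) / (p - 1)) / (1 - k / p) = 1 / (p - 1) := by
  have h₁ : p - 1 ≠ 0 := sub_ne_zero.2 hp₁
  have h₂ : p - k ≠ 0 := sub_ne_zero.2 hpk
  rw [one_sub_div hp]
  field_simp
  ring

theorem inv_sub_one_mul_sq_tuple_density {k p : ℝ} (hk : k ≠ 1) (hp : p ≠ 0) (hp₁ : p ≠ 1)
    (hpk : p ≠ k) :
    (((k - 1) / (p - 1))⁻¹ - 1) * ((k - 1) / (p - 1) / (1 - k / p)) ^ 2 =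
      (k - 1) / (p - k) * (p / (p - 1)) ^ 2 := by
  have h₁ : p - 1 ≠ 0 := sub_ne_zero.2 hp₁
  have h₂ : p - k ≠ 0 := sub_ne_zero.2 hpk
  have h₃ : k - 1 ≠ 0 := sub_ne_zero.2 hk
  rw [one_sub_div hp]
  field_simp
  ring

theorem selbergForm_tupleWeight (hk : 2 ≤ k) (hP : ∀ p ∈ P, p.Prime ∧ 2 * k ≤ p) :
    selbergForm P (tupleWeight P k L m) (fun p => ((k : ℝ) - 1) / (p - 1)) =
      ∑ U ∈ P.powerset, (∏ p ∈ U, ((k : ℝ) - 1) / (p - k)) * ((∏ p ∈ U, (p : ℝ) / (p - 1)) *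
        ∑ R ∈ Icc U P, (L - ∑ p ∈ R, log p)⁺ ^ m * ∏ p ∈ R \ U, 1 / ((p : ℝ) - 1)) ^ 2 := by
  have hk₀ : k ≠ 0 := by lia
  have hk₁ : (k : ℝ) ≠ 1 := Nat.cast_ne_one.2 (by lia)
  have hp₀ : ∀ p ∈ P, (p : ℝ) ≠ 0 := fun p hp => Nat.cast_ne_zero.2 (hP p hp).1.ne_zero
  have hp₁ : ∀ p ∈ P, (p : ℝ) ≠ 1 := fun p hp => Nat.cast_ne_one.2 (hP p hp).1.ne_one
  have hpk : ∀ p ∈ P, (p : ℝ) ≠ k := fun p hp =>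
    sub_ne_zero.1 (natCast_sub_pos_of_two_mul_le (hP p hp).1.pos (hP p hp).2).ne'
  refine (selbergForm_selbergWeight
    (fun p hp => div_ne_zero (Nat.cast_ne_zero.2 hk₀) (hp₀ p hp))
    (fun p hp => div_ne_zero (sub_ne_zero.2 hk₁) (sub_ne_zero.2 (hp₁ p hp))) _).trans
      (sum_congr rfl fun U hU => ?_)
  rw [mem_powerset] at hU
  have hsum : ∀ R ∈ Icc U P, ∏ p ∈ R \ U, ((k : ℝ) / p - (k - 1) / (p - 1)) / (1 - k / p) =
      ∏ p ∈ R \ U, 1 / ((p : ℝ) - 1) := fun R hR => prod_congr rfl fun p hp => by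
    have hpP := (Finset.mem_Icc.1 hR).2 (sdiff_subset hp)
    exact sub_div_one_sub_tuple_density (hp₀ p hpP) (hp₁ p hpP) (hpk p hpP)
  rw [sum_congr rfl fun R hR => congrArg _ (hsum R hR), mul_pow, mul_pow, ← mul_assoc, ← mul_assoc,
    ← prod_pow, ← prod_pow, ← prod_mul_distrib, ← prod_mul_distrib]
  exact congrArg (· * _) (prod_congr rfl fun p hp =>
    inv_sub_one_mul_sq_tuple_density hk₁ (hp₀ p (hU hp)) (hp₁ p (hU hp)) (hpk p (hU hp)))

theorem le_selbergForm_tupleWeight {X : ℕ} {P₀ : Finset ℕ} (hdisj : Disjoint P₀ P)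
    (hX : P₀ ∪ P = Nat.primesLE X) (hLX : L ≤ log (X + 1 : ℕ)) (hk : 2 ≤ k)
    (hP : ∀ p ∈ P, 2 * k ≤ p) :
    ((∏ p ∈ P₀, (1 - 1 / (p : ℝ))) / (m + 1)) ^ 2 *
        subsetMoment P (fun p => ((k : ℝ) - 1) / (p - k)) (fun p => log p) L (2 * m + 2) ≤
      selbergForm P (tupleWeight P k L m) (fun p => ((k : ℝ) - 1) / (p - 1)) := by
  have hP' : ∀ p ∈ P, p.Prime ∧ 2 * k ≤ p := fun p hp =>
    ⟨Nat.prime_of_mem_primesLE (hX ▸ mem_union_right _ hp), hP p hp⟩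
  rw [selbergForm_tupleWeight hk hP', subsetMoment, mul_sum]
  refine sum_le_sum fun U hU => ?_
  rw [mem_powerset] at hU
  have hg : 0 ≤ ∏ p ∈ U, ((k : ℝ) - 1) / (p - k) := prod_nonneg fun p hp =>
    div_nonneg (sub_nonneg.2 (Nat.one_le_cast.2 (by lia)))
      (natCast_sub_pos_of_two_mul_le (hP' p (hU hp)).1.pos (hP p (hU hp))).le
  set c := ∏ p ∈ P₀, (1 - 1 / (p : ℝ))
  have hc : 0 ≤ c := prod_one_sub_one_div_nonneg P₀
  calc (c / (m + 1)) ^ 2 *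
        ((∏ p ∈ U, ((k : ℝ) - 1) / (p - k)) * (L - ∑ p ∈ U, log p)⁺ ^ (2 * m + 2))
      = (∏ p ∈ U, ((k : ℝ) - 1) / (p - k)) *
          (c * ((L - ∑ p ∈ U, log p)⁺ ^ (m + 1) / (m + 1))) ^ 2 := by ring
    _ ≤ _ := mul_le_mul_of_nonneg_left (pow_le_pow_left₀ (by positivity)
        (prod_mul_posPart_pow_succ_le_sum_Icc hdisj hX hU hLX m) 2) hg

end TupleWeight

/-! ### Sums over residue classes -/

section ResidueClasses

theorem sum_filter_exists_eq_sum_sum_filter {α β M : Type*} [AddCommMonoid M] {s : Finset α}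
    {I : Finset β} {R : α → β → Prop} [∀ n, DecidablePred (R n)]
    (hR : ∀ n ∈ s, ∀ h ∈ I, ∀ h' ∈ I, R n h → R n h' → h = h') (f : α → M) :
    ∑ n ∈ s with ∃ h ∈ I, R n h, f n = ∑ h ∈ I, ∑ n ∈ s with R n h, f n := by
  classical
  simp only [sum_filter]
  rw [sum_comm]
  refine sum_congr rfl fun n hn => ?_
  split_ifs with h
  · obtain ⟨h, hI, hRn⟩ := h
    rw [sum_eq_single_of_mem h hI fun h' hI' hne => if_neg fun hRn' =>
      hne (hR n hn h' hI' h hI hRn' hRn), if_pos hRn]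
  · push Not at h
    exact (sum_eq_zero fun h' hI' => if_neg (h h' hI')).symm

theorem modEq_prod_iff {Q : Finset ℕ} (hQ : ∀ p ∈ Q, p.Prime) {a b : ℕ} :
    a ≡ b [MOD ∏ p ∈ Q, p] ↔ ∀ p ∈ Q, a ≡ b [MOD p] := by
  refine ⟨fun h p hp => h.of_dvd (dvd_prod_of_mem (fun p => p) hp), fun h => ?_⟩
  rw [Nat.modEq_iff_dvd, Nat.cast_prod]
  exact prod_dvd_of_coprime (fun p hp q hq hpq => Nat.isCoprime_iff_coprime.2
    ((Nat.coprime_primes (hQ p hp) (hQ q hq)).2 hpq)) fun p hp => Nat.modEq_iff_dvd.1 (h p hp)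

theorem dvd_add_iff_modEq {p n h : ℕ} (hp : 0 < p) : p ∣ n + h ↔ n ≡ (p - 1) * h [MOD p] := by
  have hneg : (p - 1) * h + h ≡ 0 [MOD p] := by
    rw [← Nat.succ_mul, Nat.succ_eq_add_one, Nat.sub_add_cancel hp]
    exact Nat.modEq_zero_iff_dvd.2 (dvd_mul_right p h)
  rw [← Nat.modEq_zero_iff_dvd]
  exact ⟨fun hn => Nat.ModEq.add_right_cancel' h (hn.trans hneg.symm),
    fun hn => (hn.add_right h).trans hneg⟩

theorem forall_insert_modEq_update_iff {P₀ : Finset ℕ} {r : ℕ → ℕ} {p n h : ℕ} (hp₀ : 0 < p)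
    (hp : p ∉ P₀) : (∀ q ∈ insert p P₀, n ≡ Function.update r p ((p - 1) * h) q [MOD q]) ↔
      p ∣ n + h ∧ ∀ q ∈ P₀, n ≡ r q [MOD q] := by
  rw [forall_mem_insert, Function.update_self, dvd_add_iff_modEq hp₀]
  exact and_congr_right' <| forall₂_congr fun q hq => by
    rw [Function.update_of_ne (ne_of_mem_of_not_mem hq hp)]

theorem sum_filter_modEq_dvd_insert {M I U P₀ : Finset ℕ} {r : ℕ → ℕ} {p : ℕ} (hp₀ : 0 < p)
    (hp : p ∉ P₀) (hI : ∀ h ∈ I, ∀ h' ∈ I, h ≡ h' [MOD p] → h = h') (a : ℕ → ℝ) :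
    ∑ n ∈ M with (∀ q ∈ P₀, n ≡ r q [MOD q]) ∧ ∀ q ∈ insert p U, ∃ h ∈ I, q ∣ n + h, a n =
      ∑ h ∈ I, ∑ n ∈ M with
        (∀ q ∈ insert p P₀, n ≡ Function.update r p ((p - 1) * h) q [MOD q]) ∧
          ∀ q ∈ U, ∃ h ∈ I, q ∣ n + h, a n := by
  have hunique : ∀ n ∈ M.filter fun n => (∀ q ∈ P₀, n ≡ r q [MOD q]) ∧
      ∀ q ∈ U, ∃ h ∈ I, q ∣ n + h, ∀ h ∈ I, ∀ h' ∈ I, p ∣ n + h → p ∣ n + h' → h = h' :=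
    fun n _ h hh h' hh' hd hd' => hI h hh h' hh' <|
      Nat.ModEq.add_left_cancel' n <|
        (Nat.modEq_zero_iff_dvd.2 hd).trans (Nat.modEq_zero_iff_dvd.2 hd').symm
  have hsplit := sum_filter_exists_eq_sum_sum_filter hunique a
  simp only [filter_filter] at hsplit
  refine Eq.trans ?_ (hsplit.trans ?_)
  · refine sum_congr (filter_congr fun n _ => ?_) fun _ _ => rfl
    rw [forall_mem_insert, and_assoc, and_comm (a := ∃ h ∈ I, p ∣ n + h)]
  · refine sum_congr rfl fun h _ => sum_congr (filter_congr fun n _ => ?_) fun _ _ => rfl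
    rw [forall_insert_modEq_update_iff hp₀ hp, and_comm, and_assoc]

theorem abs_sum_filter_modEq_dvd_sub_le {M I U P₀ : Finset ℕ} {r : ℕ → ℕ} {a : ℕ → ℝ} {Y E : ℝ}
    (hU : ∀ p ∈ U, p.Prime) (hI : ∀ p ∈ U, ∀ h ∈ I, ∀ h' ∈ I, h ≡ h' [MOD p] → h = h')
    (hP₀ : ∀ p ∈ P₀, p.Prime) (hdisj : Disjoint P₀ U)
    (hE : ∀ b : ℕ, (∀ p ∈ P₀, b ≡ r p [MOD p]) → (∀ p ∈ U, ∃ h ∈ I, p ∣ b + h) →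
      |∑ n ∈ M with n ≡ b [MOD ∏ p ∈ P₀ ∪ U, p], a n - Y| ≤ E) :
    |∑ n ∈ M with (∀ p ∈ P₀, n ≡ r p [MOD p]) ∧ ∀ p ∈ U, ∃ h ∈ I, p ∣ n + h, a n -
      (#I : ℝ) ^ #U * Y| ≤ (#I : ℝ) ^ #U * E := by
  induction U using Finset.induction_on generalizing P₀ r with
  | empty =>
    obtain ⟨b, hb⟩ := Nat.chineseRemainderOfFinset r (fun p => p) P₀
      (fun p hp => (hP₀ p hp).ne_zero)
      fun p hp q hq hpq => (Nat.coprime_primes (hP₀ p hp) (hP₀ q hq)).2 hpq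
    have hclass : ∀ n, (∀ p ∈ P₀, n ≡ r p [MOD p]) ↔ n ≡ b [MOD ∏ p ∈ P₀, p] := fun n => by
      rw [modEq_prod_iff hP₀]
      exact forall₂_congr fun p hp => ⟨fun h => h.trans (hb p hp).symm, fun h => h.trans (hb p hp)⟩
    simpa [hclass] using hE b hb (by simp)
  | insert p U hp ih =>
    have hpP₀ : p ∉ P₀ := fun h => disjoint_left.1 hdisj h (mem_insert_self p U)
    have hp₀ := (hU p (mem_insert_self p U)).pos
    have hterm : ∀ h ∈ I, _ := fun h hh => ih (P₀ := insert p P₀)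
      (r := Function.update r p ((p - 1) * h)) (fun q hq => hU q (mem_insert_of_mem hq))
      (fun q hq => hI q (mem_insert_of_mem hq))
      ((forall_mem_insert _ _ _).2 ⟨hU p (mem_insert_self p U), hP₀⟩)
      (disjoint_insert_left.2 ⟨hp, disjoint_of_subset_right (subset_insert p U) hdisj⟩)
      fun b hb hbU => by
        rw [insert_union, ← union_insert]
        obtain ⟨hpb, hbP₀⟩ := (forall_insert_modEq_update_iff hp₀ hpP₀).1 hb
        exact hE b hbP₀ ((forall_mem_insert _ _ _).2 ⟨⟨h, hh, hpb⟩, hbU⟩)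
    rw [sum_filter_modEq_dvd_insert hp₀ hpP₀ (hI p (mem_insert_self p U)),
      card_insert_of_notMem hp, pow_succ', mul_assoc, mul_assoc, ← nsmul_eq_mul,
      ← sum_const, ← sum_sub_distrib, ← nsmul_eq_mul]
    exact (abs_sum_le_sum_abs _ _).trans (sum_le_card_nsmul _ _ _ hterm)

theorem abs_card_filter_modEq_sub_le {q : ℕ} (hq : 0 < q) {a c : ℕ} (hac : a ≤ c) (b : ℕ) :
    |(#{n ∈ Ioc a c | n ≡ b [MOD q]} : ℝ) - ((c : ℝ) - a) / q| ≤ 1 := by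
  have hle : ((a : ℚ) - b) / q ≤ ((c : ℚ) - b) / q := by gcongr
  have hcard : ((#{n ∈ Ioc a c | n ≡ b [MOD q]} : ℤ) : ℚ) =
      ⌊((c : ℚ) - b) / q⌋ - ⌊((a : ℚ) - b) / q⌋ := by
    rw [Nat.Ioc_filter_modEq_card a c hq b, max_eq_left (sub_nonneg.2 (Int.floor_mono hle)),
      Int.cast_sub]
  have hrat : |(#{n ∈ Ioc a c | n ≡ b [MOD q]} : ℚ) - ((c : ℚ) - a) / q| ≤ 1 := by
    rw [Int.cast_natCast] at hcard
    have hdiv : ((c : ℚ) - a) / q = ((c : ℚ) - b) / q - ((a : ℚ) - b) / q := by ring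
    rw [hcard, hdiv, abs_le]
    constructor <;>
      linarith [Int.floor_le (((c : ℚ) - b) / q), Int.lt_floor_add_one (((c : ℚ) - b) / q),
        Int.floor_le (((a : ℚ) - b) / q), Int.lt_floor_add_one (((a : ℚ) - b) / q)]
  have hreal := (Rat.cast_le (K := ℝ)).2 hrat
  push_cast at hreal
  exact hreal

end ResidueClasses

/-! ### Primes in arithmetic progressions -/

section PrimeProgressions

/-- The function equal to `log` on the primes and to `0` elsewhere, which detects primes among the
shifts of `n`. -/
noncomputable def primeLog (n : ℕ) : ℝ :=
  if n.Prime then log n else 0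

theorem maxThetaError_nonneg (x : ℝ) (q : ℕ) : 0 ≤ maxThetaError x q :=
  iSup_nonneg fun _ => abs_nonneg _

theorem abs_primeTheta_sub_le {q : ℕ} (hq : q ≠ 0) (x : ℝ) {b : ℕ} (hb : b.Coprime q) :
    |primeTheta x q (b : ZMod q) - x / (q.totient : ℝ)| ≤ maxThetaError x q := by
  have : NeZero q := ⟨hq⟩
  exact le_ciSup (f := fun a : (ZMod q)ˣ => |primeTheta x q (a : ZMod q) - x / (q.totient : ℝ)|)
    (Set.finite_range _).bddAbove (ZMod.unitOfCoprime b hb)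

theorem primeTheta_natCast (m q b : ℕ) :
    primeTheta m q (b : ZMod q) = ∑ n ∈ Ioc 0 m, if n ≡ b [MOD q] then primeLog n else 0 := by
  rw [primeTheta, Nat.floor_natCast, sum_filter,
    ← Icc_add_one_left_eq_Ioc]
  refine sum_congr rfl fun n _ => ?_
  simp only [primeLog, ZMod.natCast_eq_natCast_iff, and_comm, ite_and]

theorem sum_filter_modEq_primeLog (N h q b : ℕ) :
    ∑ n ∈ Ioc N (2 * N) with n ≡ b [MOD q], primeLog (n + h) =
      primeTheta (2 * N + h : ℕ) q (b + h : ℕ) - primeTheta (N + h : ℕ) q (b + h : ℕ) := by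
  rw [primeTheta_natCast, primeTheta_natCast, eq_sub_iff_add_eq',
    ← sum_Ioc_consecutive _ (N + h).zero_le (by lia : N + h ≤ 2 * N + h), sum_filter,
    ← map_add_right_Ioc, sum_map]
  refine congrArg _ (sum_congr rfl fun n _ => if_congr ?_ rfl rfl)
  exact ⟨Nat.ModEq.add_right h, Nat.ModEq.add_right_cancel' h⟩

theorem abs_sum_filter_modEq_primeLog_sub_le {N h q b : ℕ} (hq : q ≠ 0)
    (hb : (b + h).Coprime q) :
    |∑ n ∈ Ioc N (2 * N) with n ≡ b [MOD q], primeLog (n + h) - N / (q.totient : ℝ)| ≤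
      maxThetaError (2 * N + h : ℕ) q + maxThetaError (N + h : ℕ) q := by
  have hdiv : (N : ℝ) / (q.totient : ℝ) =
      (2 * N + h : ℕ) / (q.totient : ℝ) - (N + h : ℕ) / (q.totient : ℝ) := by
    rw [← sub_div]
    push_cast
    ring
  rw [sum_filter_modEq_primeLog, hdiv, sub_sub_sub_comm]
  exact (abs_sub _ _).trans
    (add_le_add (abs_primeTheta_sub_le hq _ hb) (abs_primeTheta_sub_le hq _ hb))

theorem primeTheta_nonneg (x : ℝ) (q : ℕ) (a : ZMod q) : 0 ≤ primeTheta x q a :=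
  sum_nonneg fun p _ => log_natCast_nonneg p

theorem primeTheta_le {x : ℝ} {q : ℕ} (hq : q ≠ 0) (hqx : q ≤ x) (a : ZMod q) :
    primeTheta x q a ≤ 2 * log x * (x / q) := by
  have : NeZero q := ⟨hq⟩
  have hq₀ : (0 : ℝ) < q := Nat.cast_pos.2 (Nat.pos_of_ne_zero hq)
  have hx₀ : 0 ≤ x := hq₀.le.trans hqx
  have hlog : 0 ≤ log x := log_nonneg ((Nat.one_le_cast.2 (Nat.pos_of_ne_zero hq)).trans hqx)
  have hsubset : ((Icc 1 ⌊x⌋₊).filter fun p : ℕ => p.Prime ∧ (p : ZMod q) = a) ⊆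
      {n ∈ Ioc 0 ⌊x⌋₊ | n ≡ a.val [MOD q]} := fun p hp => by
    rw [mem_filter, Finset.mem_Icc] at hp
    rw [mem_filter, Finset.mem_Ioc, ← ZMod.natCast_eq_natCast_iff, ZMod.natCast_zmod_val]
    exact ⟨hp.1, hp.2.2⟩
  have hcard : (#{n ∈ Ioc 0 ⌊x⌋₊ | n ≡ a.val [MOD q]} : ℝ) ≤ x / q + 1 := by
    have h := (abs_le.1 (abs_card_filter_modEq_sub_le (Nat.pos_of_ne_zero hq)
      ⌊x⌋₊.zero_le a.val)).2
    rw [Nat.cast_zero, sub_zero] at h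
    have hfloor : (⌊x⌋₊ : ℝ) / q ≤ x / q := by gcongr; exact Nat.floor_le hx₀
    linarith
  calc primeTheta x q a
      ≤ #((Icc 1 ⌊x⌋₊).filter fun p : ℕ => p.Prime ∧ (p : ZMod q) = a) • log x :=
        sum_le_card_nsmul _ _ _ fun p hp => by
          rw [mem_filter, Finset.mem_Icc] at hp
          exact log_le_log (Nat.cast_pos.2 hp.1.1) ((Nat.le_floor_iff hx₀).1 hp.1.2)
    _ ≤ (x / q + x / q) * log x := by
        rw [nsmul_eq_mul]
        gcongr
        exact ((Nat.cast_le.2 (card_le_card hsubset)).trans hcard).trans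
          (add_le_add_right ((one_le_div hq₀).2 hqx) _)
    _ = _ := by ring

theorem maxThetaError_le {x : ℝ} {q : ℕ} (hq : q ≠ 0) (hqx : q ≤ x) :
    maxThetaError x q ≤ x / q.totient * (1 + 2 * log x) := by
  have hq₁ : (1 : ℝ) ≤ q := Nat.one_le_cast.2 (Nat.pos_of_ne_zero hq)
  have hφ : (0 : ℝ) < q.totient := Nat.cast_pos.2 (Nat.totient_pos.2 (Nat.pos_of_ne_zero hq))
  have hlog : 0 ≤ log x := log_nonneg (hq₁.trans hqx)
  have hx : 0 ≤ x / q.totient := div_nonneg (by linarith) hφ.le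
  have hdiv : x / q ≤ x / q.totient :=
    div_le_div_of_nonneg_left (by linarith) hφ (Nat.cast_le.2 q.totient_le)
  refine ciSup_le fun a => abs_le.2 ?_
  have htheta := (primeTheta_le hq hqx (a : ZMod q)).trans
    (mul_le_mul_of_nonneg_left hdiv (by positivity))
  constructor <;> nlinarith [primeTheta_nonneg x q a, mul_nonneg hx hlog]

theorem totient_prod_primes {Q : Finset ℕ} (hQ : ∀ p ∈ Q, p.Prime) :
    ((∏ p ∈ Q, p).totient : ℝ) = ∏ p ∈ Q, ((p : ℝ) - 1) := by
  induction Q using Finset.induction_on with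
  | empty => simp
  | insert p Q hp ih =>
    obtain ⟨hp', hQ'⟩ := (forall_mem_insert _ _ _).1 hQ
    rw [prod_insert hp, prod_insert hp, Nat.totient_mul, Nat.totient_prime hp', Nat.cast_mul,
      ih hQ', Nat.cast_sub hp'.one_le, Nat.cast_one]
    exact Nat.Coprime.prod_right fun q hq =>
      (Nat.coprime_primes hp' (hQ' q hq)).2 (ne_of_mem_of_not_mem hq hp).symm

theorem prod_le_exp_of_sum_log_le {U : Finset ℕ} (hU : ∀ p ∈ U, p ≠ 0) {v : ℝ}
    (hv : ∑ p ∈ U, log p ≤ v) : ((∏ p ∈ U, p : ℕ) : ℝ) ≤ exp v := by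
  have hU' : ∀ p ∈ U, (p : ℝ) ≠ 0 := fun p hp => Nat.cast_ne_zero.2 (hU p hp)
  rw [Nat.cast_prod]
  rw [← log_prod hU'] at hv
  exact (le_exp_log _).trans (exp_le_exp.2 hv)

theorem one_div_totient_prod_union_le {P₀ U : Finset ℕ} (hP₀ : ∀ p ∈ P₀, p.Prime)
    (hU : ∀ p ∈ U, p.Prime) (hdisj : Disjoint P₀ U) :
    (1 : ℝ) / (∏ p ∈ P₀ ∪ U, p).totient ≤ ∏ p ∈ U, (2 : ℝ) / p := by
  have htwo : ∀ p ∈ U, (2 : ℝ) ≤ p := fun p hp => Nat.ofNat_le_cast.2 (hU p hp).two_le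
  have hone : (1 : ℝ) ≤ ∏ p ∈ P₀, ((p : ℝ) - 1) := by
    rw [← totient_prod_primes hP₀, Nat.one_le_cast]
    exact Nat.totient_pos.2 (prod_pos fun p hp => (hP₀ p hp).pos)
  have hpos : 0 < ∏ p ∈ U, ((p : ℝ) - 1) := prod_pos fun p hp => by linarith [htwo p hp]
  rw [totient_prod_primes (forall_mem_union.2 ⟨hP₀, hU⟩), prod_union hdisj]
  calc 1 / ((∏ p ∈ P₀, ((p : ℝ) - 1)) * ∏ p ∈ U, ((p : ℝ) - 1))
      ≤ 1 / ∏ p ∈ U, ((p : ℝ) - 1) :=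
        one_div_le_one_div_of_le hpos (le_mul_of_one_le_left hpos.le hone)
    _ = ∏ p ∈ U, 1 / ((p : ℝ) - 1) := by rw [prod_div_distrib, prod_const_one]
    _ ≤ ∏ p ∈ U, (2 : ℝ) / p := prod_le_prod
        (fun p hp => one_div_nonneg.2 (by linarith [htwo p hp])) fun p hp => by
          have := htwo p hp
          rw [div_le_div_iff₀ (by linarith) (by linarith)]
          linarith

end PrimeProgressions

section Moduli

variable {P₀ P : Finset ℕ} {x y L : ℝ}

theorem prod_union_le_of_sum_log_le {U : Finset ℕ} {v : ℝ} (hU : ∀ p ∈ U, p ≠ 0)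
    (hdisj : Disjoint P₀ U) (hv : ∑ p ∈ U, log p ≤ v)
    (hy : ((∏ p ∈ P₀, p : ℕ) : ℝ) * exp v ≤ y) : ((∏ p ∈ P₀ ∪ U, p : ℕ) : ℝ) ≤ y := by
  rw [prod_union hdisj, Nat.cast_mul]
  exact (mul_le_mul_of_nonneg_left (prod_le_exp_of_sum_log_le hU hv) (Nat.cast_nonneg _)).trans hy

theorem sum_filter_maxThetaError_le (hP₀ : ∀ p ∈ P₀, p.Prime) (hP : ∀ p ∈ P, p.Prime)
    (hdisj : Disjoint P₀ P) (hy : ((∏ p ∈ P₀, p : ℕ) : ℝ) * exp L ≤ y) :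
    ∑ U ∈ P.powerset with ∑ p ∈ U, log (p : ℕ) ≤ L, maxThetaError x (∏ p ∈ P₀ ∪ U, p) ≤
      ∑ q ∈ Icc 1 ⌊y⌋₊, maxThetaError x q := by
  set 𝒰 := {U ∈ P.powerset | ∑ p ∈ U, log (p : ℕ) ≤ L}
  have hsub : ∀ U ∈ 𝒰, U ⊆ P := fun U hU => mem_powerset.1 (mem_filter.1 hU).1
  have hinj : Set.InjOn (fun U : Finset ℕ => ∏ p ∈ P₀ ∪ U, p) 𝒰 := fun U hU V hV hUV => by
    have hunion := injOn_prod_powerset (forall_mem_union.2 ⟨hP₀, hP⟩)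
      (mem_coe.2 (mem_powerset.2 (union_subset_union_right (hsub U hU))))
      (mem_coe.2 (mem_powerset.2 (union_subset_union_right (hsub V hV)))) hUV
    rw [← union_sdiff_cancel_left (disjoint_of_subset_right (hsub U hU) hdisj), hunion,
      union_sdiff_cancel_left (disjoint_of_subset_right (hsub V hV) hdisj)]
  rw [← sum_image hinj (f := maxThetaError x)]
  refine sum_le_sum_of_subset_of_nonneg (fun q hq => ?_) fun q _ _ => maxThetaError_nonneg x q
  obtain ⟨U, hU, rfl⟩ := mem_image.1 hq
  have hUP : ∀ p ∈ U, p.Prime := fun p hp => hP p (hsub U hU hp)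
  exact Finset.mem_Icc.2 ⟨prod_pos fun p hp => (forall_mem_union.2 ⟨hP₀, hUP⟩ p hp).pos,
    Nat.le_floor (prod_union_le_of_sum_log_le (fun p hp => (hUP p hp).ne_zero)
      (disjoint_of_subset_right (hsub U hU) hdisj) (mem_filter.1 hU).2 hy)⟩

theorem sum_filter_pow_card_sq_mul_maxThetaError_le (hP₀ : ∀ p ∈ P₀, p.Prime)
    (hP : ∀ p ∈ P, p.Prime) (hdisj : Disjoint P₀ P) (K : ℕ) (hx : 1 ≤ x) (hL : 0 ≤ L)
    (hLx : ((∏ p ∈ P₀, p : ℕ) : ℝ) * exp L ≤ x) :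
    ∑ U ∈ P.powerset with ∑ p ∈ U, log (p : ℕ) ≤ L,
        ((K : ℝ) ^ #U) ^ 2 * maxThetaError x (∏ p ∈ P₀ ∪ U, p) ≤
      x * (1 + 2 * log x) * (2 + L) ^ (2 * K ^ 2) := by
  have hlog : 0 ≤ log x := log_nonneg hx
  have hterm : ∀ U ∈ P.powerset.filter (fun U => ∑ p ∈ U, log (p : ℕ) ≤ L),
      ((K : ℝ) ^ #U) ^ 2 * maxThetaError x (∏ p ∈ P₀ ∪ U, p) ≤
        x * (1 + 2 * log x) * ∏ p ∈ U, ((2 * K ^ 2 : ℕ) : ℝ) / p := fun U hU => by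
    obtain ⟨hUP, hUL⟩ := mem_filter.1 hU
    rw [mem_powerset] at hUP
    have hU' : ∀ p ∈ U, p.Prime := fun p hp => hP p (hUP hp)
    have hdisj' := disjoint_of_subset_right hUP hdisj
    calc ((K : ℝ) ^ #U) ^ 2 * maxThetaError x (∏ p ∈ P₀ ∪ U, p)
        ≤ ((K : ℝ) ^ #U) ^ 2 * (x / (∏ p ∈ P₀ ∪ U, p).totient * (1 + 2 * log x)) := by
          gcongr
          exact maxThetaError_le
            (prod_ne_zero_iff.2 fun p hp => (forall_mem_union.2 ⟨hP₀, hU'⟩ p hp).ne_zero)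
            (prod_union_le_of_sum_log_le (fun p hp => (hU' p hp).ne_zero) hdisj' hUL hLx)
      _ = ((K : ℝ) ^ #U) ^ 2 * (x * (1 + 2 * log x) * (1 / (∏ p ∈ P₀ ∪ U, p).totient)) := by
          ring
      _ ≤ ((K : ℝ) ^ #U) ^ 2 * (x * (1 + 2 * log x) * ∏ p ∈ U, (2 : ℝ) / p) := by
          gcongr
          exact one_div_totient_prod_union_le hP₀ hU' hdisj'
      _ = x * (1 + 2 * log x) * ∏ p ∈ U, ((2 * K ^ 2 : ℕ) : ℝ) / p := by
          have hprod : ∏ p ∈ U, ((2 * K ^ 2 : ℕ) : ℝ) / p =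
              ((K : ℝ) ^ #U) ^ 2 * ∏ p ∈ U, (2 : ℝ) / p := by
            rw [← prod_const, ← prod_pow, ← prod_mul_distrib]
            exact prod_congr rfl fun p _ => by push_cast; ring
          rw [hprod]
          ring
  refine (sum_le_sum hterm).trans ?_
  rw [← mul_sum]
  gcongr
  exact sum_filter_prod_div_le hP (2 * K ^ 2) hL

theorem sum_pow_card_mul_maxThetaError_sq_le (hP₀ : ∀ p ∈ P₀, p.Prime) (hP : ∀ p ∈ P, p.Prime)
    (hdisj : Disjoint P₀ P) (K : ℕ) (hx : 1 ≤ x) (hL : 0 ≤ L)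
    (hLx : ((∏ p ∈ P₀, p : ℕ) : ℝ) * exp L ≤ x) (hLy : ((∏ p ∈ P₀, p : ℕ) : ℝ) * exp L ≤ y) :
    (∑ U ∈ P.powerset with ∑ p ∈ U, log (p : ℕ) ≤ L,
        (K : ℝ) ^ #U * maxThetaError x (∏ p ∈ P₀ ∪ U, p)) ^ 2 ≤
      x * (1 + 2 * log x) * (2 + L) ^ (2 * K ^ 2) * ∑ q ∈ Icc 1 ⌊y⌋₊, maxThetaError x q := by
  have hlog : 0 ≤ log x := log_nonneg hx
  calc (∑ U ∈ P.powerset with ∑ p ∈ U, log (p : ℕ) ≤ L,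
        (K : ℝ) ^ #U * maxThetaError x (∏ p ∈ P₀ ∪ U, p)) ^ 2
      ≤ (∑ U ∈ P.powerset with ∑ p ∈ U, log (p : ℕ) ≤ L,
          ((K : ℝ) ^ #U) ^ 2 * maxThetaError x (∏ p ∈ P₀ ∪ U, p)) *
        ∑ U ∈ P.powerset with ∑ p ∈ U, log (p : ℕ) ≤ L, maxThetaError x (∏ p ∈ P₀ ∪ U, p) :=
        sum_sq_le_sum_mul_sum_of_sq_le_mul _
          (fun U _ => mul_nonneg (by positivity) (maxThetaError_nonneg _ _))
          (fun U _ => maxThetaError_nonneg _ _) fun U _ => le_of_eq (by ring)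
    _ ≤ _ := mul_le_mul (sum_filter_pow_card_sq_mul_maxThetaError_le hP₀ hP hdisj K hx hL hLx)
        (sum_filter_maxThetaError_le hP₀ hP hdisj hLy)
        (sum_nonneg fun U _ => maxThetaError_nonneg _ _) (by positivity)

theorem exists_sum_pow_card_mul_maxThetaError_le {ϑ : ℝ} (hlevel : PrimesHaveLevel ϑ) {ε : ℝ}
    (hε : 0 < ε) (K D : ℕ) :
    ∃ C : ℝ, 0 ≤ C ∧ ∀ᶠ x : ℝ in Filter.atTop, ∀ (P₀ P : Finset ℕ) (L : ℝ),
      (∀ p ∈ P₀, p.Prime) → (∀ p ∈ P, p.Prime) → Disjoint P₀ P → 0 ≤ L → L ≤ 2 * log x →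
      ((∏ p ∈ P₀, p : ℕ) : ℝ) * exp L ≤ x →
      ((∏ p ∈ P₀, p : ℕ) : ℝ) * exp L ≤ x ^ (ϑ - ε) →
      ∑ U ∈ P.powerset with ∑ p ∈ U, log (p : ℕ) ≤ L,
        (K : ℝ) ^ #U * maxThetaError x (∏ p ∈ P₀ ∪ U, p) ≤ C * (x / log x ^ D) := by
  have hA : (0 : ℝ) < ((1 + 2 * K ^ 2 + 2 * D : ℕ) : ℝ) := by positivity
  obtain ⟨c, hc, hbound⟩ := (hlevel ε hε _ hA).exists_pos
  refine ⟨√(c * 4 ^ (1 + 2 * K ^ 2)), sqrt_nonneg _, ?_⟩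
  filter_upwards [hbound.bound, Filter.eventually_ge_atTop (exp 1)] with x hx hxe
    P₀ P L hP₀ hP hdisj hL hLx hLx₁ hLx₂
  have hx₀ : 0 < x := (exp_pos 1).trans_le hxe
  have hlog : 1 ≤ log x := (le_log_iff_exp_le hx₀).2 hxe
  rw [rpow_natCast, norm_of_nonneg (sum_nonneg fun q _ => maxThetaError_nonneg x q),
    norm_of_nonneg (by positivity)] at hx
  refine le_of_sq_le_sq ?_ (by positivity)
  calc (∑ U ∈ P.powerset with ∑ p ∈ U, log (p : ℕ) ≤ L,
        (K : ℝ) ^ #U * maxThetaError x (∏ p ∈ P₀ ∪ U, p)) ^ 2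
      ≤ x * (1 + 2 * log x) * (2 + L) ^ (2 * K ^ 2) *
          ∑ q ∈ Icc 1 ⌊x ^ (ϑ - ε)⌋₊, maxThetaError x q :=
        sum_pow_card_mul_maxThetaError_sq_le hP₀ hP hdisj K
          ((one_le_exp zero_le_one).trans hxe) hL hLx₁ hLx₂
    _ ≤ x * (4 * log x) * (4 * log x) ^ (2 * K ^ 2) *
          (c * (x / log x ^ (1 + 2 * K ^ 2 + 2 * D))) :=
        mul_le_mul (by gcongr <;> linarith) hx (sum_nonneg fun q _ => maxThetaError_nonneg x q)
          (by positivity)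
    _ = (√(c * 4 ^ (1 + 2 * K ^ 2)) * (x / log x ^ D)) ^ 2 := by
        rw [mul_pow √_, sq_sqrt (by positivity), mul_pow, pow_add (log x) _ (2 * D), div_pow,
          ← pow_mul, mul_comm D 2]
        field_simp
        ring

end Moduli

/-! ### The sieve sums over a dyadic interval -/

section SieveSums

/-- The set of primes of `P` dividing `∏ h ∈ H, (n + h)`, encoding the squarefree divisors of that
product composed of primes of `P`. -/
def tupleDivisors (P H : Finset ℕ) (n : ℕ) : Finset ℕ :=
  {p ∈ P | ∃ h ∈ H, p ∣ n + h}

/-- The nonnegative sieve weight `(∑ λ_d) ^ 2` of `n`, with `d` running over the divisors of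
`∏ h ∈ H, (n + h)`. -/
noncomputable def tupleSieve (P H : Finset ℕ) (L : ℝ) (m n : ℕ) : ℝ :=
  (∑ S ∈ (tupleDivisors P H n).powerset, tupleWeight P #H L m S) ^ 2

/-- The integers of `(N, 2 N]` congruent to `r p` modulo every `p ∈ P₀`, over which the sieve
weights are summed. -/
def sieveRange (N : ℕ) (P₀ : Finset ℕ) (r : ℕ → ℕ) : Finset ℕ :=
  {n ∈ Ioc N (2 * N) | ∀ p ∈ P₀, n ≡ r p [MOD p]}

variable {P₀ P H U : Finset ℕ} {L : ℝ} {m N : ℕ} {r : ℕ → ℕ}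

theorem subset_tupleDivisors_iff {n : ℕ} (hU : U ⊆ P) :
    U ⊆ tupleDivisors P H n ↔ ∀ p ∈ U, ∃ h ∈ H, p ∣ n + h :=
  ⟨fun h _ hp => (mem_filter.1 (h hp)).2, fun h p hp => mem_filter.2 ⟨hU hp, h p hp⟩⟩

theorem abs_sum_mul_tupleSieve_sub_le (hH : #H ≠ 0) (hm : m ≠ 0) (hL : 0 ≤ L)
    (hP : ∀ p ∈ P, p.Prime ∧ 2 * #H ≤ p) {M : Finset ℕ} {a : ℕ → ℝ} {X : ℝ} {w : ℕ → ℝ}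
    {E : Finset ℕ → ℝ} (hE : ∀ U ⊆ P,
      |∑ n ∈ M with U ⊆ tupleDivisors P H n, a n - X * ∏ p ∈ U, w p| ≤ E U) :
    |∑ n ∈ M, a n * tupleSieve P H L m n - X * selbergForm P (tupleWeight P #H L m) w| ≤
      ((2 + L) ^ (m + 2 * #H)) ^ 2 *
        ∑ U ∈ P.powerset with ∑ p ∈ U, log (p : ℕ) ≤ 2 * L, 16 ^ #U * E U :=
  (abs_sum_mul_sum_powerset_sq_sub_le (fun _ _ => filter_subset _ _)
    fun _ hS _ hT _ _ => hE _ (union_subset hS hT)).trans <|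
  sum_sum_abs_mul_abs_mul_union_le (fun _ _ => log_natCast_nonneg _) (by positivity)
    (fun _ hS => abs_tupleWeight_le hH hm hP hL hS)
    (fun _ _ hS₀ => (sum_lt_of_tupleWeight_ne_zero hm hS₀).le)
    fun U hU => (abs_nonneg _).trans (hE U hU)

theorem abs_sum_sieveRange_one_sub_le (hP₀ : ∀ p ∈ P₀, p.Prime) (hU : ∀ p ∈ U, p.Prime)
    (hdisj : Disjoint P₀ U) (hUP : U ⊆ P) (hUH : ∀ p ∈ U, ∀ h ∈ H, h < p) :
    |∑ n ∈ sieveRange N P₀ r with U ⊆ tupleDivisors P H n, (1 : ℝ) -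
      N / ((∏ p ∈ P₀, p : ℕ) : ℝ) * ∏ p ∈ U, (#H : ℝ) / p| ≤ (#H : ℝ) ^ #U := by
  have hcount : ∀ b : ℕ, |∑ n ∈ Ioc N (2 * N) with n ≡ b [MOD ∏ p ∈ P₀ ∪ U, p], (1 : ℝ) -
      N / ((∏ p ∈ P₀ ∪ U, p : ℕ) : ℝ)| ≤ 1 := fun b => by
    have h := abs_card_filter_modEq_sub_le
      (prod_pos fun p hp => (forall_mem_union.2 ⟨hP₀, hU⟩ p hp).pos) (by lia : N ≤ 2 * N) b
    have hdiff : ((2 * N : ℕ) : ℝ) - N = N := by push_cast; ring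
    rw [hdiff] at h
    rwa [sum_const, nsmul_one]
  have hmain := abs_sum_filter_modEq_dvd_sub_le (r := r) (I := H) hU
    (fun p hp h hh h' hh' hmod => hmod.eq_of_lt_of_lt (hUH p hp h hh) (hUH p hp h' hh'))
    hP₀ hdisj fun b _ _ => hcount b
  simp only [sieveRange, filter_filter, subset_tupleDivisors_iff hUP]
  rw [mul_one, prod_union hdisj, Nat.cast_mul, mul_div_left_comm] at hmain
  rwa [prod_div_distrib, prod_const, ← Nat.cast_prod, div_mul_div_comm, mul_div_assoc]

theorem sum_filter_pow_card_le (hP : ∀ p ∈ P, p.Prime) (K : ℕ) (hL : 0 ≤ L) :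
    ∑ U ∈ P.powerset with ∑ p ∈ U, log (p : ℕ) ≤ L, (K : ℝ) ^ #U ≤ exp L * (2 + L) ^ K := by
  refine le_trans ?_ (mul_le_mul_of_nonneg_left (sum_filter_prod_div_le hP K hL) (exp_nonneg _))
  rw [mul_sum]
  refine sum_le_sum fun U hU => ?_
  obtain ⟨hUP, hUL⟩ := mem_filter.1 hU
  have hU₀ : ∀ p ∈ U, p ≠ 0 := fun p hp => (hP p (mem_powerset.1 hUP hp)).ne_zero
  have hpos : (0 : ℝ) < (∏ p ∈ U, p : ℕ) :=
    Nat.cast_pos.2 (Nat.pos_of_ne_zero (prod_ne_zero_iff.2 hU₀))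
  rw [prod_div_distrib, prod_const, ← Nat.cast_prod, mul_div_assoc', le_div_iff₀ hpos, mul_comm]
  gcongr
  exact prod_le_exp_of_sum_log_le hU₀ hUL

theorem sum_tupleSieve_le (hP₀ : ∀ p ∈ P₀, p.Prime) (hdisj : Disjoint P₀ P) (hH : #H ≠ 0)
    (hP : ∀ p ∈ P, p.Prime ∧ 2 * #H ≤ p) (hPH : ∀ p ∈ P, ∀ h ∈ H, h < p) (hm : m ≠ 0)
    (hL : 0 ≤ L) :
    ∑ n ∈ sieveRange N P₀ r, tupleSieve P H L m n ≤
      N / ((∏ p ∈ P₀, p : ℕ) : ℝ) *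
        subsetMoment P (fun p => (#H : ℝ) / (p - #H)) (fun p => log p) L (2 * m) +
      ((2 + L) ^ (m + 2 * #H)) ^ 2 * (exp (2 * L) * (2 + 2 * L) ^ (16 * #H)) := by
  have hmain := abs_sum_mul_tupleSieve_sub_le (M := sieveRange N P₀ r) (a := fun _ => 1) hH hm hL
    hP fun U hU => abs_sum_sieveRange_one_sub_le hP₀ (fun p hp => (hP p (hU hp)).1)
      (disjoint_of_subset_right hU hdisj) hU fun p hp => hPH p (hU hp)
  have herror := sum_filter_pow_card_le (fun p hp => (hP p hp).1) (16 * #H)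
    (mul_nonneg zero_le_two hL)
  simp only [Nat.cast_mul, Nat.cast_ofNat, mul_pow (16 : ℝ)] at herror
  simp only [one_mul, selbergForm_tupleWeight_self hH hP] at hmain
  linarith [(abs_le.1 hmain).2, mul_le_mul_of_nonneg_left herror
    (sq_nonneg ((2 + L) ^ (m + 2 * #H)))]

variable {X h : ℕ}

theorem subset_tupleDivisors_iff_erase {n : ℕ} (hU : U ⊆ P) (hn : ∀ p ∈ U, ¬ p ∣ n + h) :
    U ⊆ tupleDivisors P H n ↔ ∀ p ∈ U, ∃ h' ∈ H.erase h, p ∣ n + h' := by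
  rw [subset_tupleDivisors_iff hU]
  refine forall₂_congr fun p hp => ⟨?_, ?_⟩
  · rintro ⟨h', hh', hdvd⟩
    exact ⟨h', mem_erase.2 ⟨fun e => hn p hp (e ▸ hdvd), hh'⟩, hdvd⟩
  · rintro ⟨h', hh', hdvd⟩
    exact ⟨h', mem_of_mem_erase hh', hdvd⟩

theorem sum_sieveRange_primeLog_filter (hU : ∀ p ∈ U, p.Prime ∧ p ≤ N) (hUP : U ⊆ P) :
    ∑ n ∈ sieveRange N P₀ r with U ⊆ tupleDivisors P H n, primeLog (n + h) =
      ∑ n ∈ Ioc N (2 * N) with (∀ p ∈ P₀, n ≡ r p [MOD p]) ∧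
        ∀ p ∈ U, ∃ h' ∈ H.erase h, p ∣ n + h', primeLog (n + h) := by
  rw [sieveRange, filter_filter, sum_filter, sum_filter]
  refine sum_congr rfl fun n hn => ?_
  by_cases hprime : (n + h).Prime
  · have hndvd : ∀ p ∈ U, ¬ p ∣ n + h := fun p hp hdvd => by
      have := (Nat.prime_dvd_prime_iff_eq (hU p hp).1 hprime).1 hdvd
      have := (hU p hp).2
      have := (Finset.mem_Ioc.1 hn).1
      lia
    simp only [subset_tupleDivisors_iff_erase hUP hndvd]
  · simp only [primeLog, if_neg hprime, ite_self]

theorem abs_sum_sieveRange_primeLog_sub_le (hP₀ : ∀ p ∈ P₀, p.Prime)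
    (hU : ∀ p ∈ U, p.Prime ∧ p ≤ N) (hdisj : Disjoint P₀ U) (hUP : U ⊆ P)
    (hUH : ∀ p ∈ U, ∀ h ∈ H, h < p) (hh : h ∈ H) (hr : ∀ p ∈ P₀, ¬ p ∣ r p + h) :
    |∑ n ∈ sieveRange N P₀ r with U ⊆ tupleDivisors P H n, primeLog (n + h) -
      N / ((∏ p ∈ P₀, p).totient : ℝ) * ∏ p ∈ U, ((#H : ℝ) - 1) / (p - 1)| ≤
      ((#H : ℝ) - 1) ^ #U * (maxThetaError (2 * N + h : ℕ) (∏ p ∈ P₀ ∪ U, p) +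
        maxThetaError (N + h : ℕ) (∏ p ∈ P₀ ∪ U, p)) := by
  have hU' : ∀ p ∈ U, p.Prime := fun p hp => (hU p hp).1
  have hQ : ∀ p ∈ P₀ ∪ U, p.Prime := forall_mem_union.2 ⟨hP₀, hU'⟩
  have hcoprime : ∀ b : ℕ, (∀ p ∈ P₀, b ≡ r p [MOD p]) →
      (∀ p ∈ U, ∃ h' ∈ H.erase h, p ∣ b + h') → (b + h).Coprime (∏ p ∈ P₀ ∪ U, p) := by
    refine fun b hbP₀ hbU => Nat.Coprime.prod_right fun p hp =>
      ((hQ p hp).coprime_iff_not_dvd.2 fun hdvd => ?_).symm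
    rcases mem_union.1 hp with hp | hp
    · exact hr p hp ((((hbP₀ p hp).add_right h).dvd_iff dvd_rfl).1 hdvd)
    · obtain ⟨h', hh', hdvd'⟩ := hbU p hp
      have hmod : h' ≡ h [MOD p] := Nat.ModEq.add_left_cancel' b <|
        (Nat.modEq_zero_iff_dvd.2 hdvd').trans (Nat.modEq_zero_iff_dvd.2 hdvd).symm
      exact (mem_erase.1 hh').1
        (hmod.eq_of_lt_of_lt (hUH p hp h' (mem_of_mem_erase hh')) (hUH p hp h hh))
  have hmain := abs_sum_filter_modEq_dvd_sub_le (r := r) (I := H.erase h) hU'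
    (fun p hp h₁ hh₁ h₂ hh₂ hmod => hmod.eq_of_lt_of_lt (hUH p hp h₁ (mem_of_mem_erase hh₁))
      (hUH p hp h₂ (mem_of_mem_erase hh₂))) hP₀ hdisj fun b hbP₀ hbU =>
        abs_sum_filter_modEq_primeLog_sub_le (N := N)
          (prod_ne_zero_iff.2 fun p hp => (hQ p hp).ne_zero) (hcoprime b hbP₀ hbU)
  rw [← sum_sieveRange_primeLog_filter hU hUP, cast_card_erase_of_mem hh, totient_prod_primes hQ,
    prod_union hdisj, mul_div_left_comm] at hmain
  rwa [totient_prod_primes hP₀, prod_div_distrib, prod_const, div_mul_div_comm, mul_div_assoc]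

theorem le_sum_primeLog_mul_tupleSieve (hdisj : Disjoint P₀ P) (hX : P₀ ∪ P = Nat.primesLE X)
    (hXN : X ≤ N) (hLX : L ≤ log (X + 1 : ℕ)) (hH : 2 ≤ #H) (hP : ∀ p ∈ P, 2 * #H ≤ p)
    (hPH : ∀ p ∈ P, ∀ h ∈ H, h < p) (hm : m ≠ 0) (hL : 0 ≤ L) (hh : h ∈ H)
    (hr : ∀ p ∈ P₀, ¬ p ∣ r p + h) :
    N / ((∏ p ∈ P₀, p).totient : ℝ) * (((∏ p ∈ P₀, (1 - 1 / (p : ℝ))) / (m + 1)) ^ 2 *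
        subsetMoment P (fun p => ((#H : ℝ) - 1) / (p - #H)) (fun p => log p) L (2 * m + 2)) -
      ((2 + L) ^ (m + 2 * #H)) ^ 2 *
        ∑ U ∈ P.powerset with ∑ p ∈ U, log (p : ℕ) ≤ 2 * L, ((16 * #H : ℕ) : ℝ) ^ #U *
          (maxThetaError (2 * N + h : ℕ) (∏ p ∈ P₀ ∪ U, p) +
            maxThetaError (N + h : ℕ) (∏ p ∈ P₀ ∪ U, p)) ≤
      ∑ n ∈ sieveRange N P₀ r, primeLog (n + h) * tupleSieve P H L m n := by
  have hprimes : ∀ p ∈ P₀ ∪ P, p.Prime ∧ p ≤ X := fun p hp => by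
    rw [hX, Nat.mem_primesLE] at hp
    exact hp.symm
  obtain ⟨hP₀, hPX⟩ := forall_mem_union.1 hprimes
  have hmain := abs_sum_mul_tupleSieve_sub_le (M := sieveRange N P₀ r)
    (a := fun n => primeLog (n + h)) (by lia) hm hL (fun p hp => ⟨(hPX p hp).1, hP p hp⟩)
    fun U hU => abs_sum_sieveRange_primeLog_sub_le (fun p hp => (hP₀ p hp).1)
      (fun p hp => ⟨(hPX p (hU hp)).1, (hPX p (hU hp)).2.trans hXN⟩)
      (disjoint_of_subset_right hU hdisj) hU (fun p hp => hPH p (hU hp)) hh hr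
  have herror : ∑ U ∈ P.powerset with ∑ p ∈ U, log (p : ℕ) ≤ 2 * L, 16 ^ #U *
      (((#H : ℝ) - 1) ^ #U * (maxThetaError (2 * N + h : ℕ) (∏ p ∈ P₀ ∪ U, p) +
        maxThetaError (N + h : ℕ) (∏ p ∈ P₀ ∪ U, p))) ≤
      ∑ U ∈ P.powerset with ∑ p ∈ U, log (p : ℕ) ≤ 2 * L, ((16 * #H : ℕ) : ℝ) ^ #U *
        (maxThetaError (2 * N + h : ℕ) (∏ p ∈ P₀ ∪ U, p) +
          maxThetaError (N + h : ℕ) (∏ p ∈ P₀ ∪ U, p)) := by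
    have hH₁ : (0 : ℝ) ≤ (#H : ℝ) - 1 := sub_nonneg.2 (Nat.one_le_cast.2 (by lia))
    refine sum_le_sum fun U _ => ?_
    rw [← mul_assoc, ← mul_pow, Nat.cast_mul, Nat.cast_ofNat]
    gcongr
    · exact add_nonneg (maxThetaError_nonneg _ _) (maxThetaError_nonneg _ _)
    · linarith
  have hform := mul_le_mul_of_nonneg_left (le_selbergForm_tupleWeight (m := m) hdisj hX hLX hH hP)
    (by positivity : (0 : ℝ) ≤ N / ((∏ p ∈ P₀, p).totient : ℝ))
  linarith [(abs_le.1 hmain).1, mul_le_mul_of_nonneg_left herror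
    (sq_nonneg ((2 + L) ^ (m + 2 * #H)))]

end SieveSums

/-! ### The comparison of the two sieve sums -/

section Asymptotics

open Filter Topology

theorem eventually_add_mul_add_div_add_one_le {α β η : ℝ} (hη : 0 < η) (hβα : β < α * η)
    (b C C' : ℝ) :
    ∀ᶠ T : ℝ in atTop, (T + b) * (β + C' / (η * T - C)) + 1 ≤ α * (η * T - C) := by
  have hdiv (y : ℝ) : Tendsto (fun T : ℝ => y / T) atTop (𝓝 0) :=
    tendsto_const_nhds.div_atTop tendsto_id
  have hden : Tendsto (fun T => η * T - C) atTop atTop :=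
    tendsto_atTop_add_const_right _ _ (tendsto_id.const_mul_atTop hη)
  have hleft : Tendsto (fun T => (1 + b / T) * (β + C' / (η * T - C)) + 1 / T) atTop (𝓝 β) := by
    simpa using (((hdiv b).const_add 1).mul
      ((tendsto_const_nhds (x := C').div_atTop hden).const_add β)).add (hdiv 1)
  have hright : Tendsto (fun T => α * (η - C / T)) atTop (𝓝 (α * η)) := by
    simpa using ((hdiv C).const_sub η).const_mul α
  filter_upwards [hleft.eventually_lt hright hβα, eventually_gt_atTop 0] with T hT hT₀
  calc (T + b) * (β + C' / (η * T - C)) + 1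
      = T * ((1 + b / T) * (β + C' / (η * T - C)) + 1 / T) := by field_simp
    _ ≤ T * (α * (η - C / T)) := by gcongr
    _ = α * (η * T - C) := by field_simp

theorem eventually_mul_exp_le_exp {α β : ℝ} (h : α < β) (W : ℝ) :
    ∀ᶠ T : ℝ in atTop, W * exp (α * T) ≤ exp (β * T) := by
  filter_upwards [(tendsto_exp_atTop.comp
    (tendsto_id.const_mul_atTop (sub_pos.2 h))).eventually_ge_atTop W] with T hT
  calc W * exp (α * T) ≤ exp ((β - α) * T) * exp (α * T) := by gcongr; exact hT
    _ = exp (β * T) := by rw [← exp_add]; ring_nf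

theorem eventually_add_mul_pow_mul_exp_le {η δ : ℝ} (hη₀ : 0 < η) (hη : η < 1 / 2) (hδ : 0 < δ)
    (c : ℝ) (a b : ℕ) :
    ∀ᶠ T : ℝ in atTop, (T + c) * (((2 + η * T) ^ a) ^ 2 *
      (exp (2 * (η * T)) * (2 + 2 * (η * T)) ^ b)) ≤ δ * exp T := by
  have hlittle := (isLittleO_pow_exp_pos_mul_atTop (1 + 2 * a + b)
    (show 0 < 1 - 2 * η by linarith)).bound (show 0 < δ / 3 ^ (1 + 2 * a + b) by positivity)
  filter_upwards [hlittle, eventually_ge_atTop 2, eventually_ge_atTop |c|] with T hT hT₂ hTc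
  have hT₀ : 0 < T := by linarith
  have hηT₀ : 0 < η * T := by positivity
  have hηT : 2 * (η * T) ≤ T := by nlinarith
  have hc : T + c ≤ 3 * T := by linarith [le_abs_self c]
  rw [norm_of_nonneg (by positivity), norm_of_nonneg (exp_nonneg _)] at hT
  calc (T + c) * (((2 + η * T) ^ a) ^ 2 * (exp (2 * (η * T)) * (2 + 2 * (η * T)) ^ b))
      ≤ 3 * T * (((3 * T) ^ a) ^ 2 * (exp (2 * (η * T)) * (3 * T) ^ b)) := by
        gcongr <;> linarith
    _ = 3 ^ (1 + 2 * a + b) * T ^ (1 + 2 * a + b) * exp (2 * (η * T)) := by ring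
    _ ≤ 3 ^ (1 + 2 * a + b) * (δ / 3 ^ (1 + 2 * a + b) * exp ((1 - 2 * η) * T)) *
        exp (2 * (η * T)) := by gcongr
    _ = δ * (exp ((1 - 2 * η) * T) * exp (2 * (η * T))) := by field_simp
    _ = δ * exp T := by rw [← exp_add]; ring_nf

theorem eventually_pow_sq_mul_div_pow_le {η δ C : ℝ} (hη₀ : 0 < η) (hη : η < 1 / 2) (hδ : 0 < δ)
    (hC : 0 ≤ C) (a : ℕ) :
    ∀ᶠ T : ℝ in atTop, ((2 + η * T) ^ a) ^ 2 * (C / T ^ (2 * a + 1)) ≤ δ := by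
  filter_upwards [eventually_ge_atTop 2, eventually_ge_atTop ((3 ^ a) ^ 2 * C / δ)] with T hT₂ hT
  have hT₀ : 0 < T := by linarith
  calc ((2 + η * T) ^ a) ^ 2 * (C / T ^ (2 * a + 1))
      ≤ ((3 * T) ^ a) ^ 2 * (C / T ^ (2 * a + 1)) := by gcongr; nlinarith
    _ = (3 ^ a) ^ 2 * C / T := by field_simp; ring
    _ ≤ δ := (div_le_comm₀ hT₀ hδ).2 hT

theorem div_log_pow_le {N x : ℝ} (hN : exp 1 ≤ N) (hNx : N ≤ x) (hx : x ≤ 3 * N) (D : ℕ) :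
    x / log x ^ D ≤ 3 * N / log N ^ D := by
  have hN₀ : 0 < N := (exp_pos 1).trans_le hN
  have hlogN : 1 ≤ log N := (le_log_iff_exp_le hN₀).2 hN
  gcongr

end Asymptotics

section Moments

variable {P : Finset ℕ} {k D₀ W : ℕ} {C L : ℝ}

theorem subsetMoment_div_sub_le (hk : k ≠ 0) (hD₀ : D₀ ≠ 0) (hW : W ≠ 0)
    (hP : ∀ p ∈ P, p.Prime ∧ ¬p ∣ W ∧ D₀ < p ∧ 2 * k ≤ p)
    (hC : ∀ v, 0 ≤ v → ∑ p ∈ P with log (p : ℕ) ≤ v, ((k : ℝ) - 1) / (p - k) * log p ≤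
      (k - 1) * v + C)
    (hCL : C < L) (hL : 0 ≤ L) (j : ℕ) :
    subsetMoment P (fun p => (k : ℝ) / (p - k)) (fun p => log p) L (j + 1) ≤
      (exp (2 * k / D₀) * ((W.totient : ℝ) / W) / (j + 2) +
        k * (exp (2 * k / D₀) * (W + 1)) / (L - C)) *
        subsetMoment P (fun p => ((k : ℝ) - 1) / (p - k)) (fun p => log p) L (j + 2) := by
  have hk₁ : (0 : ℝ) ≤ k - 1 := sub_nonneg.2 (Nat.one_le_cast.2 (Nat.pos_of_ne_zero hk))
  have hpk : ∀ p ∈ P, (0 : ℝ) < p - k := fun p hp =>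
    natCast_sub_pos_of_two_mul_le (hP p hp).1.pos (hP p hp).2.2.2
  have hg : ∀ p ∈ P, 0 ≤ ((k : ℝ) - 1) / (p - k) := fun p hp => div_nonneg hk₁ (hpk p hp).le
  have hu : ∀ p ∈ P, 0 ≤ log (p : ℕ) := fun p _ => log_natCast_nonneg p
  set e := exp (2 * k / D₀)
  set c := (W.totient : ℝ) / W
  set M := subsetMoment P (fun p => ((k : ℝ) - 1) / (p - k)) (fun p => log p) L
  have hM : 0 ≤ M (j + 2) := (pow_nonneg hL _).trans (pow_le_subsetMoment hg hL _)
  have hshift : M (j + 1) ≤ k * M (j + 2) / (L - C) := by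
    rw [le_div_iff₀' (sub_pos.2 hCL)]
    refine (sub_mul_subsetMoment_le hg hu hC L j).trans (mul_le_mul_of_nonneg_right ?_ hM)
    have : ((k : ℝ) - 1) / (j + 2) ≤ k - 1 := div_le_self hk₁ (by linarith [j.cast_nonneg (α := ℝ)])
    linarith
  have hadd := subsetMoment_add_le (c := e * c) (C := e * (W + 1)) hg
    (fun p hp => one_div_nonneg.2 (hpk p hp).le) hu
    (fun v hv => (sum_filter_prod_one_div_sub_le hD₀ hW hP hv).trans_eq (by ring)) L j
  calc subsetMoment P (fun p => (k : ℝ) / (p - k)) (fun p => log p) L (j + 1)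
      = subsetMoment P ((fun p : ℕ => ((k : ℝ) - 1) / (p - k)) + fun p : ℕ => 1 / ((p : ℝ) - k))
          (fun p => log p) L (j + 1) := by
        congr 1
        funext p
        rw [Pi.add_apply, ← add_div, sub_add_cancel]
    _ ≤ e * c / (j + 2) * M (j + 2) + e * (W + 1) * M (j + 1) := hadd
    _ ≤ e * c / (j + 2) * M (j + 2) + e * (W + 1) * (k * M (j + 2) / (L - C)) := by gcongr
    _ = (e * c / (j + 2) + k * (e * (W + 1)) / (L - C)) * M (j + 2) := by ring

theorem mul_subsetMoment_add_one_le {m : ℕ} {Z : ℝ} (hm : m ≠ 0) (hk : k = (2 * m + 1) ^ 2)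
    (hD₀ : D₀ ≠ 0) (hW : W ≠ 0) (hP : ∀ p ∈ P, p.Prime ∧ ¬p ∣ W ∧ D₀ < p ∧ 2 * k ≤ p)
    (hC : ∀ v, 0 ≤ v → ∑ p ∈ P with log (p : ℕ) ≤ v, ((k : ℝ) - 1) / (p - k) * log p ≤
      (k - 1) * v + C)
    (hCL : C < L) (hL : 1 ≤ L) (hZ : 0 ≤ Z)
    (hmargin : Z * (exp (2 * k / D₀) * ((W.totient : ℝ) / W) / (2 * m + 1) +
        k * (exp (2 * k / D₀) * (W + 1)) / (L - C)) + 1 ≤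
      (2 * m + 1) * ((W.totient : ℝ) / W / (m + 1) ^ 2) * (L - C)) :
    Z * subsetMoment P (fun p => (k : ℝ) / (p - k)) (fun p => log p) L (2 * m) + 1 ≤
      k * ((W.totient : ℝ) / W / (m + 1) ^ 2 *
        subsetMoment P (fun p => ((k : ℝ) - 1) / (p - k)) (fun p => log p) L (2 * m + 2)) := by
  have hkR : (k : ℝ) = (2 * m + 1) ^ 2 := by rw [hk]; push_cast; rfl
  have hg : ∀ p ∈ P, 0 ≤ ((k : ℝ) - 1) / (p - k) := fun p hp => by
    refine div_nonneg ?_ (natCast_sub_pos_of_two_mul_le (hP p hp).1.pos (hP p hp).2.2.2).le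
    rw [hkR]
    nlinarith [m.cast_nonneg (α := ℝ)]
  obtain ⟨j, hj⟩ : ∃ j, 2 * m = j + 1 := ⟨2 * m - 1, by lia⟩
  have hjR : (2 * m + 1 : ℝ) = j + 2 := by
    have : (2 * m : ℝ) = j + 1 := mod_cast hj
    linarith
  have hupper := subsetMoment_div_sub_le (by simp [hk]) hD₀ hW hP hC hCL (by linarith) j
  rw [← hj, show j + 2 = 2 * m + 1 by lia, ← hjR] at hupper
  set c := (W.totient : ℝ) / W
  set X := exp (2 * k / D₀) * c / (2 * m + 1) + k * (exp (2 * k / D₀) * (W + 1)) / (L - C)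
  set M := subsetMoment P (fun p => ((k : ℝ) - 1) / (p - k)) (fun p => log p) L
  have hM : 1 ≤ M (2 * m + 1) := (one_le_pow₀ hL).trans (pow_le_subsetMoment hg (by linarith) _)
  -- With `k = (2 m + 1) ^ 2`, the factor `1 + (k - 1) / (2 m + 2)` is `2 m + 1`.
  have hratio : (L - C) * M (2 * m + 1) ≤ (2 * m + 1) * M (2 * m + 2) := by
    convert sub_mul_subsetMoment_le hg (fun p _ => log_natCast_nonneg p) hC L (2 * m) using 2
    rw [hkR]
    push_cast
    field_simp
    ring
  calc _ ≤ Z * (X * M (2 * m + 1)) + M (2 * m + 1) := by gcongr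
    _ = M (2 * m + 1) * (Z * X + 1) := by ring
    _ ≤ M (2 * m + 1) * ((2 * m + 1) * (c / (m + 1) ^ 2) * (L - C)) := by gcongr
    _ = (2 * m + 1) * (c / (m + 1) ^ 2) * ((L - C) * M (2 * m + 1)) := by ring
    _ ≤ (2 * m + 1) * (c / (m + 1) ^ 2) * ((2 * m + 1) * M (2 * m + 2)) := by gcongr
    _ = k * (c / (m + 1) ^ 2 * M (2 * m + 2)) := by rw [hkR]; ring

end Moments

/-! ### Translates containing two primes -/

section TwoPrimes

open Filter

/-- The primes `D < p ≤ e ^ L`, from which the divisors of the sieve are composed; the primes up to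
`D` are handled by fixing residue classes. -/
noncomputable def sievePrimes (D : ℕ) (L : ℝ) : Finset ℕ :=
  Nat.primesLE ⌊exp L⌋₊ \ Nat.primesLE D

variable {D₀ m : ℕ} {H : Finset ℕ} {ϑ η δ L : ℝ} {r : ℕ → ℕ}

theorem prime_and_lt_of_mem_sievePrimes {p : ℕ} (hp : p ∈ sievePrimes D₀ L) : p.Prime ∧ D₀ < p := by
  rw [sievePrimes, Finset.mem_sdiff, Nat.mem_primesLE, Nat.mem_primesLE] at hp
  exact ⟨hp.1.2, not_le.1 fun h => hp.2 ⟨h, hp.1.2⟩⟩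

theorem disjoint_primesLE_sievePrimes (D : ℕ) (L : ℝ) :
    Disjoint (Nat.primesLE D) (sievePrimes D L) :=
  disjoint_sdiff

theorem primesLE_union_sievePrimes {D : ℕ} {L : ℝ} (h : D ≤ exp L) :
    Nat.primesLE D ∪ sievePrimes D L = Nat.primesLE ⌊exp L⌋₊ :=
  union_sdiff_of_subset (Nat.primesLE_mono (Nat.le_floor h))

theorem le_log_floor_exp_add_one (L : ℝ) : L ≤ log (⌊exp L⌋₊ + 1 : ℕ) := by
  rw [le_log_iff_exp_le (by positivity)]
  exact_mod_cast (Nat.lt_floor_add_one _).le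

theorem prod_primesLE_one_sub_one_div (D : ℕ) :
    ∏ p ∈ Nat.primesLE D, (1 - 1 / (p : ℝ)) = ((primorial D).totient : ℝ) / primorial D := by
  rw [primorial_eq_prod_primesLE, totient_prod_primes fun p hp => Nat.prime_of_mem_primesLE hp,
    Nat.cast_prod, ← prod_div_distrib]
  refine prod_congr rfl fun p hp => ?_
  rw [sub_div, div_self (Nat.cast_ne_zero.2 (Nat.prime_of_mem_primesLE hp).ne_zero)]

theorem exists_lt_and_prime_of_lt_sum_primeLog {n : ℕ} {B : ℝ} (hB₀ : 0 ≤ B)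
    (hB : ∀ h ∈ H, primeLog (n + h) ≤ B) (hlt : B < ∑ h ∈ H, primeLog (n + h)) :
    ∃ h ∈ H, ∃ h' ∈ H, h < h' ∧ (n + h).Prime ∧ (n + h').Prime := by
  have hcard : 1 < #{h ∈ H | (n + h).Prime} := by
    by_contra! hcard
    refine hlt.not_ge ?_
    calc ∑ h ∈ H, primeLog (n + h) = ∑ h ∈ H with (n + h).Prime, primeLog (n + h) :=
          (sum_filter_of_ne fun h _ hne => of_not_not fun hp => hne (if_neg hp)).symm
      _ ≤ #{h ∈ H | (n + h).Prime} • B :=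
          sum_le_card_nsmul _ _ _ fun h hh => hB h (mem_filter.1 hh).1
      _ ≤ 1 • B := nsmul_le_nsmul_left hB₀ hcard
      _ = B := one_nsmul B
  obtain ⟨h, hh, h', hh', hne⟩ := one_lt_card.1 hcard
  rw [mem_filter] at hh hh'
  obtain hlt | hlt := hne.lt_or_gt
  · exact ⟨h, hh.1, h', hh'.1, hlt, hh.2, hh'.2⟩
  · exact ⟨h', hh'.1, h, hh.1, hlt, hh'.2, hh.2⟩

theorem exists_mem_sieveRange_lt_and_prime {N : ℕ} {P₀ P : Finset ℕ} (hN : N ≠ 0)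
    (hHN : ∀ h ∈ H, h ≤ N)
    (hlt : (log N + log 3) * ∑ n ∈ sieveRange N P₀ r, tupleSieve P H L m n <
      ∑ h ∈ H, ∑ n ∈ sieveRange N P₀ r, primeLog (n + h) * tupleSieve P H L m n) :
    ∃ n ∈ sieveRange N P₀ r, ∃ h ∈ H, ∃ h' ∈ H, h < h' ∧ (n + h).Prime ∧ (n + h').Prime := by
  rw [sum_comm, mul_sum] at hlt
  obtain ⟨n, hn, hlt⟩ := exists_lt_of_sum_lt hlt
  rw [← sum_mul] at hlt
  have hB₀ : 0 ≤ log N + log 3 := add_nonneg (log_natCast_nonneg N) (log_nonneg (by norm_num))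
  refine ⟨n, hn, exists_lt_and_prime_of_lt_sum_primeLog hB₀ (fun h hh => ?_)
    (lt_of_mul_lt_mul_right hlt (sq_nonneg _))⟩
  rw [primeLog]
  split_ifs with hp
  · rw [← log_mul (Nat.cast_ne_zero.2 hN) (by norm_num)]
    have hn2 := (Finset.mem_Ioc.1 (mem_filter.1 hn).1).2
    refine log_le_log (Nat.cast_pos.2 hp.pos) ?_
    exact_mod_cast (by linarith [hHN h hh] : n + h ≤ N * 3)
  · exact hB₀

theorem tendsto_log_natCast_atTop : Tendsto (fun N : ℕ => log N) atTop atTop :=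
  tendsto_log_atTop.comp tendsto_natCast_atTop_atTop

theorem eventually_sum_tupleSieve_le (hη₀ : 0 < η) (hη : η < 1 / 2) (hδ : 0 < δ) (hm : m ≠ 0)
    (hH : #H ≠ 0) (hD₀ : 2 * #H ≤ D₀) (hHD₀ : ∀ h ∈ H, h ≤ D₀) (r : ℕ → ℕ) :
    ∀ᶠ N : ℕ in atTop,
      (log N + log 3) * ∑ n ∈ sieveRange N (Nat.primesLE D₀) r,
        tupleSieve (sievePrimes D₀ (η * log N)) H (η * log N) m n ≤
      N / primorial D₀ * ((log N + log 3) * subsetMoment (sievePrimes D₀ (η * log N))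
        (fun p => (#H : ℝ) / (p - #H)) (fun p => log p) (η * log N) (2 * m)) + δ * N := by
  filter_upwards [tendsto_log_natCast_atTop.eventually
    (eventually_add_mul_pow_mul_exp_le hη₀ hη hδ (log 3) (m + 2 * #H) (16 * #H)),
    eventually_ne_atTop 0] with N hpoly hN
  have hL : 0 ≤ η * log N := mul_nonneg hη₀.le (log_natCast_nonneg N)
  have hsum := sum_tupleSieve_le (N := N) (r := r) (m := m) (L := η * log N)
    (fun p hp => Nat.prime_of_mem_primesLE hp) (disjoint_primesLE_sievePrimes D₀ (η * log N)) hH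
    (fun p hp => ⟨(prime_and_lt_of_mem_sievePrimes hp).1,
      hD₀.trans (prime_and_lt_of_mem_sievePrimes hp).2.le⟩)
    (fun p hp h hh => (hHD₀ h hh).trans_lt (prime_and_lt_of_mem_sievePrimes hp).2) hm hL
  rw [← primorial_eq_prod_primesLE] at hsum
  rw [exp_log (Nat.cast_pos.2 (Nat.pos_of_ne_zero hN))] at hpoly
  have hZ : 0 ≤ log N + log 3 := add_nonneg (log_natCast_nonneg N) (log_nonneg (by norm_num))
  linarith [mul_le_mul_of_nonneg_left hsum hZ]

theorem eventually_pow_sq_mul_sum_maxThetaError_le (hlevel : PrimesHaveLevel ϑ) (hη₀ : 0 < η)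
    (hη : η < 1 / 2) (hηϑ : 2 * η < ϑ) (hδ : 0 < δ) {P₀ : Finset ℕ} (hP₀ : ∀ p ∈ P₀, p.Prime)
    (a K : ℕ) :
    ∀ᶠ N : ℕ in atTop, ∀ P : Finset ℕ, (∀ p ∈ P, p.Prime) → Disjoint P₀ P →
      ∀ x : ℝ, N ≤ x → x ≤ 3 * N →
        ((2 + η * log N) ^ a) ^ 2 *
          ∑ U ∈ P.powerset with ∑ p ∈ U, log (p : ℕ) ≤ 2 * (η * log N),
            (K : ℝ) ^ #U * maxThetaError x (∏ p ∈ P₀ ∪ U, p) ≤ δ * N := by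
  obtain ⟨C, hC₀, hC⟩ := exists_sum_pow_card_mul_maxThetaError_le hlevel
    (show 0 < (ϑ - 2 * η) / 2 by linarith) K (2 * a + 1)
  obtain ⟨x₀, hx₀⟩ := eventually_atTop.1 hC
  set W : ℝ := ((∏ p ∈ P₀, p : ℕ) : ℝ)
  filter_upwards [tendsto_natCast_atTop_atTop.eventually (eventually_ge_atTop x₀),
    tendsto_natCast_atTop_atTop.eventually (eventually_ge_atTop (exp 1)),
    tendsto_log_natCast_atTop.eventually (eventually_pow_sq_mul_div_pow_le hη₀ hη hδ
      (show 0 ≤ 3 * C by positivity) a),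
    tendsto_log_natCast_atTop.eventually
      (eventually_mul_exp_le_exp (show 2 * η < 1 by linarith) W),
    tendsto_log_natCast_atTop.eventually
      (eventually_mul_exp_le_exp (show 2 * η < ϑ - (ϑ - 2 * η) / 2 by linarith) W)]
    with N hNx₀ hNe hpoly hW hWϑ P hP hdisj x hNx hx
  have hN₀ : (0 : ℝ) < N := (exp_pos 1).trans_le hNe
  have hlogN : 1 ≤ log N := (le_log_iff_exp_le hN₀).2 hNe
  have hlogx : log N ≤ log x := log_le_log hN₀ hNx
  rw [mul_assoc] at hW hWϑ
  rw [one_mul, exp_log hN₀] at hW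
  rw [mul_comm (ϑ - _) (log _), ← rpow_def_of_pos hN₀] at hWϑ
  have hsum := hx₀ x (hNx₀.trans hNx) P₀ P (2 * (η * log N)) hP₀ hP hdisj (by positivity)
    (by nlinarith) (hW.trans hNx) (hWϑ.trans (rpow_le_rpow hN₀.le hNx (by linarith)))
  calc ((2 + η * log N) ^ a) ^ 2 * _
      ≤ ((2 + η * log N) ^ a) ^ 2 * (C * (3 * N / log N ^ (2 * a + 1))) := by
        gcongr
        exact hsum.trans (mul_le_mul_of_nonneg_left (div_log_pow_le hNe hNx hx _) hC₀)
    _ = ((2 + η * log N) ^ a) ^ 2 * (3 * C / log N ^ (2 * a + 1)) * N := by ring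
    _ ≤ δ * N := by gcongr

theorem eventually_le_sum_primeLog_mul_tupleSieve (hlevel : PrimesHaveLevel ϑ) (hη₀ : 0 < η)
    (hη : η < 1 / 2) (hηϑ : 2 * η < ϑ) (hδ : 0 < δ) (hm : m ≠ 0) (hH : 2 ≤ #H)
    (hD₀ : 2 * #H ≤ D₀) (hHD₀ : ∀ h ∈ H, h ≤ D₀)
    (hr : ∀ p, p.Prime → p ≤ D₀ → ∀ h ∈ H, ¬p ∣ r p + h) :
    ∀ᶠ N : ℕ in atTop, ∀ h ∈ H,
      N / primorial D₀ * (((primorial D₀).totient : ℝ) / primorial D₀ / (m + 1) ^ 2 *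
        subsetMoment (sievePrimes D₀ (η * log N)) (fun p => ((#H : ℝ) - 1) / (p - #H))
          (fun p => log p) (η * log N) (2 * m + 2)) - δ * N ≤
      ∑ n ∈ sieveRange N (Nat.primesLE D₀) r,
        primeLog (n + h) * tupleSieve (sievePrimes D₀ (η * log N)) H (η * log N) m n := by
  filter_upwards [eventually_pow_sq_mul_sum_maxThetaError_le hlevel hη₀ hη hηϑ (half_pos hδ)
      (fun p (hp : p ∈ Nat.primesLE D₀) => Nat.prime_of_mem_primesLE hp) (m + 2 * #H) (16 * #H),
    eventually_ge_atTop D₀, tendsto_log_natCast_atTop.eventually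
      (eventually_mul_exp_le_exp hη₀ (D₀ : ℝ)), eventually_ne_atTop 0]
    with N herror hND₀ hD₀X hN h hh
  have hN₀ : (0 : ℝ) < N := Nat.cast_pos.2 (Nat.pos_of_ne_zero hN)
  set L := η * log N
  have hL : 0 ≤ L := mul_nonneg hη₀.le (log_natCast_nonneg N)
  rw [zero_mul, exp_zero, mul_one] at hD₀X
  have hXN : ⌊exp L⌋₊ ≤ N := by
    refine Nat.floor_le_of_le ((exp_le_exp.2 ?_).trans_eq (exp_log hN₀))
    exact mul_le_of_le_one_left (log_natCast_nonneg N) (by linarith)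
  have hmain := le_sum_primeLog_mul_tupleSieve (r := r) (disjoint_primesLE_sievePrimes D₀ L)
    (primesLE_union_sievePrimes hD₀X) hXN (le_log_floor_exp_add_one L) hH
    (fun p hp => hD₀.trans (prime_and_lt_of_mem_sievePrimes hp).2.le)
    (fun p hp h hh => (hHD₀ h hh).trans_lt (prime_and_lt_of_mem_sievePrimes hp).2) hm hL hh
    fun p hp => hr p (Nat.prime_of_mem_primesLE hp) (Nat.le_of_mem_primesLE hp) h hh
  refine le_trans ?_ hmain
  have hhN : (h : ℝ) ≤ N := Nat.cast_le.2 ((hHD₀ h hh).trans hND₀)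
  have herror (x : ℝ) := herror (sievePrimes D₀ L)
    (fun p hp => (prime_and_lt_of_mem_sievePrimes hp).1) (disjoint_primesLE_sievePrimes D₀ L) x
  have h₁ := herror (2 * N + h : ℕ) (by push_cast; linarith) (by push_cast; linarith)
  have h₂ := herror (N + h : ℕ) (by push_cast; linarith) (by push_cast; linarith)
  have hφ : ((primorial D₀).totient : ℝ) ≠ 0 :=
    Nat.cast_ne_zero.2 (Nat.totient_pos.2 (primorial_pos D₀)).ne'
  simp_rw [mul_add, sum_add_distrib]
  refine sub_le_sub (le_of_eq ?_) (by linarith)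
  rw [prod_primesLE_one_sub_one_div, ← primorial_eq_prod_primesLE]
  field_simp

theorem eventually_mul_subsetMoment_add_one_le (hη : 0 < η) (hm : m ≠ 0)
    (hH : #H = (2 * m + 1) ^ 2) (hD₀ : 2 * #H ≤ D₀)
    (hratio : exp (2 * #H / D₀) * (m + 1) ^ 2 < η * (2 * m + 1) ^ 2) :
    ∀ᶠ T : ℝ in atTop,
      (T + log 3) * subsetMoment (sievePrimes D₀ (η * T)) (fun p => (#H : ℝ) / (p - #H))
        (fun p => log p) (η * T) (2 * m) + 1 ≤
      #H * (((primorial D₀).totient : ℝ) / primorial D₀ / (m + 1) ^ 2 *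
        subsetMoment (sievePrimes D₀ (η * T)) (fun p => ((#H : ℝ) - 1) / (p - #H))
          (fun p => log p) (η * T) (2 * m + 2)) := by
  have hH₀ : #H ≠ 0 := by simp [hH]
  obtain ⟨C, -, hC⟩ := exists_sum_log_div_sub_le hH₀
  have hc : 0 < ((primorial D₀).totient : ℝ) / primorial D₀ :=
    div_pos (Nat.cast_pos.2 (Nat.totient_pos.2 (primorial_pos D₀)))
      (Nat.cast_pos.2 (primorial_pos D₀))
  set c := ((primorial D₀).totient : ℝ) / primorial D₀
  have hβα : exp (2 * #H / D₀) * c / (2 * m + 1) < (2 * m + 1) * (c / (m + 1) ^ 2) * η := by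
    rw [div_lt_iff₀ (by positivity)]
    calc exp (2 * #H / D₀) * c = c / (m + 1) ^ 2 * (exp (2 * #H / D₀) * (m + 1) ^ 2) := by
          field_simp
      _ < c / (m + 1) ^ 2 * (η * (2 * m + 1) ^ 2) := by gcongr
      _ = (2 * m + 1) * (c / (m + 1) ^ 2) * η * (2 * m + 1) := by ring
  filter_upwards [eventually_add_mul_add_div_add_one_le hη hβα (log 3) C
      (#H * (exp (2 * #H / D₀) * (primorial D₀ + 1))),
    (tendsto_id.const_mul_atTop hη).eventually (eventually_gt_atTop C),
    (tendsto_id.const_mul_atTop hη).eventually (eventually_ge_atTop 1),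
    eventually_ge_atTop 0] with T hmargin hCT hT hT₀
  have hP : ∀ p ∈ sievePrimes D₀ (η * T), p.Prime ∧ ¬p ∣ primorial D₀ ∧ D₀ < p ∧ 2 * #H ≤ p :=
    fun p hp => by
      obtain ⟨hprime, hlt⟩ := prime_and_lt_of_mem_sievePrimes hp
      exact ⟨hprime, fun h => hlt.not_ge (hprime.dvd_primorial_iff.1 h), hlt, hD₀.trans hlt.le⟩
  exact mul_subsetMoment_add_one_le hm hH (by lia) (primorial_ne_zero D₀) hP
    (hC _ fun p hp => ⟨(hP p hp).1, (hP p hp).2.2.2⟩) hCT hT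
    (add_nonneg hT₀ (log_nonneg (by norm_num))) hmargin

theorem eventually_exists_lt_and_prime (hlevel : PrimesHaveLevel ϑ) (hη₀ : 0 < η)
    (hη : η < 1 / 2) (hηϑ : 2 * η < ϑ) (hm : m ≠ 0) (hH : #H = (2 * m + 1) ^ 2)
    (hD₀ : 2 * #H ≤ D₀) (hHD₀ : ∀ h ∈ H, h ≤ D₀)
    (hratio : exp (2 * #H / D₀) * (m + 1) ^ 2 < η * (2 * m + 1) ^ 2)
    (hr : ∀ p, p.Prime → p ≤ D₀ → ∀ h ∈ H, ¬p ∣ r p + h) :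
    ∀ᶠ N : ℕ in atTop, ∃ n ∈ sieveRange N (Nat.primesLE D₀) r,
      ∃ h ∈ H, ∃ h' ∈ H, h < h' ∧ (n + h).Prime ∧ (n + h').Prime := by
  have hH₂ : 2 ≤ #H := by
    rw [hH]
    nlinarith [Nat.pos_of_ne_zero hm]
  have hW : (0 : ℝ) < primorial D₀ := Nat.cast_pos.2 (primorial_pos D₀)
  -- The errors of the `#H + 1` sums have to stay below the gain `N / W` of the main terms.
  set δ : ℝ := 1 / (2 * (#H + 1) * primorial D₀) with hδ
  have hδ₀ : 0 < δ := by positivity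
  filter_upwards [eventually_sum_tupleSieve_le hη₀ hη hδ₀ hm (by lia) hD₀ hHD₀ r,
    eventually_le_sum_primeLog_mul_tupleSieve hlevel hη₀ hη hηϑ hδ₀ hm hH₂ hD₀ hHD₀ hr,
    tendsto_log_natCast_atTop.eventually
      (eventually_mul_subsetMoment_add_one_le hη₀ hm hH hD₀ hratio),
    eventually_ge_atTop D₀, eventually_ne_atTop 0] with N hupper hlower hmoment hND₀ hN
  refine exists_mem_sieveRange_lt_and_prime hN (fun h hh => (hHD₀ h hh).trans hND₀)
    (hupper.trans_lt (lt_of_lt_of_le ?_ (card_nsmul_le_sum _ _ _ hlower)))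
  have hN₀ : (0 : ℝ) < N := Nat.cast_pos.2 (Nat.pos_of_ne_zero hN)
  have hmain := mul_le_mul_of_nonneg_left hmoment (by positivity : 0 ≤ (N : ℝ) / primorial D₀)
  have herror : (#H + 1) * (δ * N) < N / primorial D₀ := by
    calc (#H + 1) * (δ * N) = N / primorial D₀ / 2 := by rw [hδ]; field_simp
      _ < N / primorial D₀ := half_lt_self (by positivity)
  rw [nsmul_eq_mul]
  linarith

/-- For every `k`-element `H`, among the `n` in prescribed residue classes `r p` modulo the primes
`p ≤ D₀`, arbitrarily large ones have two primes among the `n + h`, `h ∈ H`. The classes must keep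
each `n + h` coprime to these `p`, and `D₀` has to be large in terms of `H`. -/
def HasPrimePairs (k : ℕ) : Prop :=
  ∀ H : Finset ℕ, #H = k → ∃ D₁ : ℕ, ∀ D₀ ≥ D₁, ∀ r : ℕ → ℕ,
    (∀ p, p.Prime → p ≤ D₀ → ∀ h ∈ H, ¬p ∣ r p + h) →
    ∀ N₀ : ℕ, ∃ n > N₀, (∀ p, p.Prime → p ≤ D₀ → n ≡ r p [MOD p]) ∧
      ∃ h ∈ H, ∃ h' ∈ H, h < h' ∧ (n + h).Prime ∧ (n + h').Prime

theorem exists_hasPrimePairs (hϑ : 1 / 2 < ϑ) (hlevel : PrimesHaveLevel ϑ) :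
    ∃ k, HasPrimePairs k := by
  obtain ⟨η, hη, hη'⟩ : ∃ η, 1 / 4 < η ∧ η < min (ϑ / 2) (1 / 2) :=
    exists_between (lt_min (by linarith) (by norm_num))
  obtain ⟨hηϑ, hη₁⟩ := lt_min_iff.1 hη'
  obtain ⟨m, hm⟩ := exists_nat_gt (max 1 (2 / (4 * η - 1)))
  obtain ⟨hm₁, hm₂⟩ := max_lt_iff.1 hm
  rw [div_lt_iff₀ (by linarith)] at hm₂
  have hmη : ((m : ℝ) + 1) ^ 2 < η * (2 * m + 1) ^ 2 := by nlinarith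
  refine ⟨(2 * m + 1) ^ 2, fun H hH => ?_⟩
  have hlim : Tendsto (fun D : ℕ => exp (2 * #H / D) * ((m : ℝ) + 1) ^ 2) atTop
      (nhds (((m : ℝ) + 1) ^ 2)) := by
    simpa using ((continuous_exp.tendsto 0).comp
      (tendsto_natCast_atTop_atTop.const_div_atTop (2 * (#H : ℝ)))).mul_const (((m : ℝ) + 1) ^ 2)
  obtain ⟨D₁, hD₁⟩ := eventually_atTop.1 ((hlim.eventually_lt_const hmη).and
    ((eventually_ge_atTop (2 * #H)).and (eventually_ge_atTop (H.sup id))))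
  refine ⟨D₁, fun D₀ hD₀ r hr N₀ => ?_⟩
  obtain ⟨hratio, hcard, hsup⟩ := hD₁ D₀ hD₀
  obtain ⟨N, hN, n, hn, hpair⟩ := ((eventually_ge_atTop N₀).and
    (eventually_exists_lt_and_prime hlevel (by linarith) hη₁ (by linarith)
      (Nat.cast_ne_zero.1 (by linarith : (m : ℝ) ≠ 0)) hH hcard
      (fun h hh => (le_sup (f := id) hh).trans hsup) hratio hr)).exists
  obtain ⟨hmem, hmod⟩ := mem_filter.1 hn
  exact ⟨n, hN.trans_lt (Finset.mem_Ioc.1 hmem).1,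
    fun p hp hpD => hmod p (Nat.mem_primesLE.2 ⟨hpD, hp⟩), hpair⟩

end TwoPrimes

/-! ### Differences of consecutive primes -/

section ConsecutivePrimes

variable {H : Finset ℕ} {D : ℕ → Prop} {k : ℕ}

/-- A finite set of shifts is admissible if some translate of it avoids the multiples of `p`, for
every prime `p`; otherwise a fixed prime divides one of the numbers `n + h` for every `n`. -/
def IsAdmissible (H : Finset ℕ) : Prop :=
  ∀ p, p.Prime → ∃ a, ∀ h ∈ H, ¬p ∣ a + h

/-- `p < q` are primes with no prime strictly between them, so that `q - p` is a gap between
consecutive primes. -/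
def AreConsecutivePrimes (p q : ℕ) : Prop :=
  p.Prime ∧ q.Prime ∧ p < q ∧ ∀ m, p < m → m < q → ¬m.Prime

theorem AreConsecutivePrimes.nth_count_add_one {p q : ℕ} (hpq : AreConsecutivePrimes p q) :
    Nat.nth Nat.Prime (Nat.count Nat.Prime p + 1) = q := by
  obtain ⟨hp, hq, hlt, hbetween⟩ := hpq
  refine le_antisymm (le_of_not_gt fun h => ?_) (le_of_not_gt fun h => ?_)
  · exact hlt.not_ge ((Nat.le_nth_of_lt_nth_succ h hq).trans_eq (Nat.nth_count hp))
  · refine hbetween _ ?_ h (Nat.nth_mem_of_infinite Nat.infinite_setOfPred_prime _)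
    calc p = Nat.nth Nat.Prime (Nat.count Nat.Prime p) := (Nat.nth_count hp).symm
      _ < _ := Nat.nth_strictMono Nat.infinite_setOfPred_prime (Nat.lt_succ_self _)

theorem isDePolignac_sub_of_infinite {h h' : ℕ}
    (hinf : {n | AreConsecutivePrimes (n + h) (n + h')}.Infinite) : IsDePolignac (h' - h) := by
  have hinj : Set.InjOn (fun n => Nat.count Nat.Prime (n + h))
      {n | AreConsecutivePrimes (n + h) (n + h')} := fun a ha b hb hab =>
    Nat.add_right_cancel (Nat.count_injective ha.1 hb.1 hab)
  refine (hinf.image hinj).mono ?_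
  rintro _ ⟨n, hn, rfl⟩
  rw [Set.mem_ofPred_eq, hn.nth_count_add_one, Nat.nth_count hn.1]
  have := hn.2.2.1
  lia

theorem IsAdmissible.exists_forall_dvd_add (hH : IsAdmissible H) {S : Finset ℕ}
    (hHS : Disjoint H S) {Q : ℕ → ℕ} (hQ : Set.InjOn Q S) (hHQ : ∀ h ∈ H, ∀ s ∈ S, h < Q s)
    (hSQ : ∀ s ∈ S, s < Q s) :
    ∃ r : ℕ → ℕ, (∀ p, p.Prime → ∀ h ∈ H, ¬p ∣ r p + h) ∧
      ∀ s ∈ S, (Q s).Prime → Q s ∣ r (Q s) + s := by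
  have hresidue (p : ℕ) (hp : p.Prime) :
      ∃ a, (∀ h ∈ H, ¬p ∣ a + h) ∧ ∀ s ∈ S, Q s = p → p ∣ a + s := by
    by_cases hex : ∃ s ∈ S, Q s = p
    · obtain ⟨s, hs, rfl⟩ := hex
      have hdvd : Q s ∣ (Q s - 1) * s + s := (dvd_add_iff_modEq hp.pos).2 rfl
      refine ⟨(Q s - 1) * s, fun h hh hdvd' => ?_, fun t ht hts => hQ ht hs hts ▸ hdvd⟩
      have hmod : h ≡ s [MOD Q s] := Nat.ModEq.add_left_cancel' ((Q s - 1) * s)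
        ((Nat.modEq_zero_iff_dvd.2 hdvd').trans (Nat.modEq_zero_iff_dvd.2 hdvd).symm)
      exact disjoint_left.1 hHS hh (hmod.eq_of_lt_of_lt (hHQ h hh s hs) (hSQ s hs) ▸ hs)
    · obtain ⟨a, ha⟩ := hH p hp
      exact ⟨a, ha, fun s hs hsp => absurd ⟨s, hs, hsp⟩ hex⟩
  choose! r hr using hresidue
  exact ⟨r, fun p hp => (hr p hp).1, fun s hs hp => (hr _ hp).2 s hs rfl⟩

theorem exists_areConsecutivePrimes {n h₁ h₂ : ℕ} (hh₁ : h₁ ∈ H) (hh₂ : h₂ ∈ H) (hlt : h₁ < h₂)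
    (hp₁ : (n + h₁).Prime) (hp₂ : (n + h₂).Prime)
    (hcomp : ∀ s ≤ H.sup id, s ∉ H → ¬(n + s).Prime) :
    ∃ h ∈ H, ∃ h' ∈ H, h < h' ∧ AreConsecutivePrimes (n + h) (n + h') := by
  have hne : {h ∈ H | h₁ < h ∧ (n + h).Prime}.Nonempty := ⟨h₂, mem_filter.2 ⟨hh₂, hlt, hp₂⟩⟩
  obtain ⟨h', hmem, hleast⟩ := exists_min_image _ id hne
  obtain ⟨hh', hlt', hp'⟩ := mem_filter.1 hmem
  refine ⟨h₁, hh₁, h', hh', hlt', hp₁, hp', Nat.add_lt_add_left hlt' n, fun m hm₁ hm₂ hm => ?_⟩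
  obtain ⟨s, rfl⟩ := Nat.exists_eq_add_of_le ((Nat.le_add_right n h₁).trans hm₁.le)
  have hs₁ : h₁ < s := Nat.lt_of_add_lt_add_left hm₁
  have hs₂ : s < h' := Nat.lt_of_add_lt_add_left hm₂
  by_cases hs : s ∈ H
  · exact hs₂.not_ge (hleast s (mem_filter.2 ⟨hs, hs₁, hm⟩))
  · exact hcomp s (hs₂.le.trans (le_sup (f := id) hh')) hs hm

theorem HasPrimePairs.exists_gt_areConsecutivePrimes (hk : HasPrimePairs k) (hcard : #H = k)
    (hH : IsAdmissible H) (N₀ : ℕ) :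
    ∃ n > N₀, ∃ h ∈ H, ∃ h' ∈ H, h < h' ∧ AreConsecutivePrimes (n + h) (n + h') := by
  obtain ⟨D₁, hD₁⟩ := hk H hcard
  set B := H.sup id
  -- Force the prime `Q s` to divide `n + s` for every shift `s ≤ B` outside `H`.
  set Q : ℕ → ℕ := fun s => Nat.nth Nat.Prime (s + B)
  have hmono : StrictMono Q := (Nat.nth_strictMono Nat.infinite_setOfPred_prime).comp
    fun _ _ h => Nat.add_lt_add_right h B
  have hprime (s : ℕ) : (Q s).Prime := Nat.nth_mem_of_infinite Nat.infinite_setOfPred_prime _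
  have hlt (s : ℕ) : s + B < Q s := Nat.lt_of_succ_lt (Nat.add_two_le_nth_prime (s + B))
  have hHB : ∀ h ∈ H, h ≤ B := fun h hh => le_sup (f := id) hh
  obtain ⟨r, hrH, hrS⟩ := hH.exists_forall_dvd_add (S := range (B + 1) \ H) disjoint_sdiff
    hmono.injective.injOn (fun h hh s _ => (hHB h hh).trans_lt ((Nat.le_add_left B s).trans_lt
      (hlt s))) fun s _ => (Nat.le_add_right s B).trans_lt (hlt s)
  obtain ⟨n, hn, hmod, h₁, hh₁, h₂, hh₂, h₁₂, hp₁, hp₂⟩ :=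
    hD₁ (max D₁ (Q B)) (le_max_left _ _) r (fun p hp _ => hrH p hp) (max N₀ (Q B))
  refine ⟨n, (le_max_left _ _).trans_lt hn,
    exists_areConsecutivePrimes hh₁ hh₂ h₁₂ hp₁ hp₂ fun s hsB hs hp => ?_⟩
  have hQs : Q s ≤ Q B := hmono.monotone hsB
  have hdvd : Q s ∣ n + s := by
    rw [((hmod _ (hprime s) (hQs.trans (le_max_right _ _))).add_right s).dvd_iff dvd_rfl]
    exact hrS s (Finset.mem_sdiff.2 ⟨mem_range.2 (Nat.lt_succ_of_le hsB), hs⟩) (hprime s)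
  have hQn : Q s < n := (hQs.trans (le_max_right _ _)).trans_lt hn
  have heq := (Nat.prime_dvd_prime_iff_eq (hprime s) hp).1 hdvd
  lia

theorem HasPrimePairs.exists_isDePolignac_sub (hk : HasPrimePairs k) (hcard : #H = k)
    (hH : IsAdmissible H) : ∃ h ∈ H, ∃ h' ∈ H, h < h' ∧ IsDePolignac (h' - h) := by
  have hfreq : ∃ᶠ n in Filter.atTop, ∃ h ∈ H, ∃ h' ∈ H,
      h < h' ∧ AreConsecutivePrimes (n + h) (n + h') :=
    Filter.frequently_atTop'.2 (hk.exists_gt_areConsecutivePrimes hcard hH)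
  simp only [Filter.frequently_exists_finset, Filter.frequently_and_distrib_left] at hfreq
  obtain ⟨h, hh, h', hh', hlt, hinf⟩ := hfreq
  exact ⟨h, hh, h', hh', hlt,
    isDePolignac_sub_of_infinite (Nat.frequently_atTop_iff_infinite.1 hinf)⟩

theorem isAdmissible_of_factorial_dvd (hH : ∀ h ∈ H, (#H).factorial ∣ h) : IsAdmissible H := by
  intro p hp
  rcases le_or_gt p #H with hle | hlt
  · refine ⟨1, fun h hh hdvd => hp.one_lt.ne' (Nat.dvd_one.1 ?_)⟩
    exact (Nat.dvd_add_iff_left ((Nat.dvd_factorial hp.pos hle).trans (hH h hh))).2 hdvd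
  · by_contra! hcon
    have := Fact.mk hp
    have hcover : (univ : Finset (ZMod p)) ⊆ H.image (fun h : ℕ => -(h : ZMod p)) := fun z _ => by
      obtain ⟨h, hh, hdvd⟩ := hcon z.val
      have hz := (ZMod.natCast_eq_zero_iff _ _).2 hdvd
      rw [Nat.cast_add, ZMod.natCast_zmod_val] at hz
      exact mem_image.2 ⟨h, hh, (eq_neg_of_add_eq_zero_left hz).symm⟩
    have hcard := (card_le_card hcover).trans card_image_le
    rw [card_univ, ZMod.card] at hcard
    exact hlt.not_ge hcard

theorem exists_finset_dvd_forall_not_sub {q : ℕ} (hq : q ≠ 0)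
    (hgap : ∀ B, ∃ y, ∀ d ∈ Set.Icc y (y + B), ¬D d) (k : ℕ) :
    ∃ H : Finset ℕ, #H = k ∧ (∀ h ∈ H, q ∣ h) ∧ ∀ h ∈ H, ∀ h' ∈ H, h < h' → ¬D (h' - h) := by
  induction k with
  | zero => exact ⟨∅, by simp⟩
  | succ k ih =>
    obtain ⟨H, hcard, hdvd, hD⟩ := ih
    have hle : ∀ h ∈ H, h ≤ H.sup id := fun h hh => le_sup (f := id) hh
    obtain ⟨y, hy⟩ := hgap (H.sup id + q)
    set m := q * ((y + H.sup id) / q + 1)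
    have hlt : y + H.sup id < m := Nat.lt_mul_div_succ _ (Nat.pos_of_ne_zero hq)
    have hmle : m ≤ y + H.sup id + q :=
      Nat.add_le_add_right (Nat.mul_div_le (y + H.sup id) q) q
    have hmH : m ∉ H := fun h => (hle m h).not_gt ((Nat.le_add_left _ y).trans_lt hlt)
    refine ⟨insert m H, by rw [card_insert_of_notMem hmH, hcard],
      forall_mem_insert _ _ _ |>.2 ⟨dvd_mul_right _ _, hdvd⟩, fun h hh h' hh' hhh' => ?_⟩
    rcases mem_insert.1 hh with rfl | hh <;> rcases mem_insert.1 hh' with rfl | hh'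
    · exact absurd hhh' (lt_irrefl _)
    · have := hle h' hh'
      lia
    · have := hle h hh
      exact hy _ ⟨by lia, by lia⟩
    · exact hD h hh h' hh' hhh'

theorem exists_forall_exists_mem_Icc
    (hD : ∀ H : Finset ℕ, #H = k → IsAdmissible H → ∃ h ∈ H, ∃ h' ∈ H, h < h' ∧ D (h' - h)) :
    ∃ B, ∀ y, ∃ d ∈ Set.Icc y (y + B), D d := by
  by_contra! hgap
  obtain ⟨H, hcard, hdvd, hH⟩ := exists_finset_dvd_forall_not_sub k.factorial_ne_zero hgap k
  obtain ⟨h, hh, h', hh', hlt, hDh⟩ := hD H hcard (isAdmissible_of_factorial_dvd (by rwa [hcard]))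
  exact hH h hh h' hh' hlt hDh

end ConsecutivePrimes

theorem theorem3 (ϑ : ℝ) (hϑ : 1 / 2 < ϑ) (hlevel : PrimesHaveLevel ϑ) :
    ∃ C C₀ : ℝ, ∀ x : ℝ, C₀ < x →
      ∃ d : ℕ, (d : ℝ) ∈ Set.Icc x (x + C) ∧ IsDePolignac d := by
  obtain ⟨k, hk⟩ := exists_hasPrimePairs hϑ hlevel
  obtain ⟨B, hB⟩ := exists_forall_exists_mem_Icc fun H hcard hH =>
    hk.exists_isDePolignac_sub (H := H) hcard hH
  refine ⟨B + 1, 0, fun x hx => ?_⟩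
  obtain ⟨d, ⟨hle, hge⟩, hd⟩ := hB ⌈x⌉₊
  have hge' : (d : ℝ) ≤ ⌈x⌉₊ + B := by exact_mod_cast hge
  exact ⟨d, ⟨Nat.ceil_le.1 hle, by linarith [Nat.ceil_lt_add_one hx.le]⟩, hd⟩
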